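/- **Setting.** A *closed curve* is a continuous map $C:[0,1]\to\mathbb R^2$ with $C(0)=C(1)$; write $[C]$ for its image, and extend $C$ $1$-periodically to $\mathbb R$. It is *piecewise regular* if $[0,1]$ is divided into finitely many closed intervals on each of which $C$ is $C^1$ with nowhere vanishing derivative. An *intersection point* is a point passed at two or more parameters in $[0,1)$. A piecewise regular $C$ is *normal* if $C(t)\ne C(0)$ for $0<t<1$, there are only finitely many intersection points, and each of them is passed exactly twice, with linearly independent tangent vectors. $P_C$ consists of $p_0=C(0)$ and the intersection points. The *Whitney index* of $C$ is the winding number about $0$ of the derivative of a sufficiently close smoothing of $C$, namely of $t\mapsto \frac1h\int_t^{t+h}C(u)\,du$ for small $h>0$ (for a regular curve: the winding number of $C'$). A piecewise regular closed curve $C$ is *self-overlapping* if there is an immersion $F$ of the closed unit disk $D^2$ with boundary $C$: $F:D^2\to\mathbb R^2$ is continuous and locally injective, $F(e^{2\pi i t})=C(t)$, and $F$ is $C^1$ with invertible derivative at every point of $D^2$ except at the points $e^{2\pi i t}$ for which $C$ is not $C^1$ near $t$. It is *positive* if its Whitney index is $1$. **Decompositions.** A *closed subcurve* $\gamma$ of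 $C$ follows $C$ from a parameter $a$ to a parameter $b$, where $0\le a<b\le 1$ and $C(a)=C(b)$, skipping finitely many intervals $(c_j,d_j)$ with $C(c_j)=C(d_j)$, where the $[c_j,d_j]$ are pairwise disjoint subintervals of $(a,b)$; it is parametrized over $[0,1]$ proportionally to the remaining parameter length, and its *root* is $C(a)$. A *decomposition* of a normal curve $C$ is a finite family $\Gamma$ of self-overlapping closed subcurves of $C$ whose images have union $[C]$ and satisfy $[\gamma]\cap[\gamma']\subseteq P_C$ for distinct members $\gamma,\gamma'$; $|\Gamma|$ is the number of members. $C$ is a *$k$-boundary* if it has a decomposition into $k$ positive self-overlapping subcurves. **Induced homotopy.** Order $\Gamma=(\gamma_1,\dots,\gamma_l)$ so that the root of $\gamma_i$ does not lie on $\gamma_j$ for any $j>i$, and for each $i$ choose an immersion $F_i$ of the disk with boundary $\gamma_i$ as above. The *induced homotopy* $H_\Gamma$ contracts $\gamma_l,\gamma_{l-1},\dots,\gamma_1$ one after the other, each to its root: when $\gamma_i$ is contracted, its point $F_i(z)$, $|z|=1$, moves along $s\mapsto F_i((1-s)z+s)$, $0\le s\le 1$, each subcurve that has already been contracted to a point of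 $\gamma_i$ moves with that point, and the rest of the current curve stays fixed. **Area.** A *null-homotopy* of $C$ is a continuous $H:[0,1]^2\to\mathbb R^2$ with $H(0,t)=C(t)$ and $H(1,t)=H(s,0)=H(s,1)=p_0$. Its *area* is $\mathrm{Area}(H)=\int_{\mathbb R^2}E_H(x)\,dx$, where $E_H(x)$ is the number of connected components of $H^{-1}(x)$. Let $\sigma(C)=\inf_H\mathrm{Area}(H)$ over the piecewise differentiable null-homotopies $H$ of $C$ (those for which finitely many line segments divide the square so that $H$ is $C^1$ off the segments and, along each segment, $C^1$ up to finitely many points). A null-homotopy $H$ of $C$ is *minimum* if $\mathrm{Area}(H)=\sigma(C)$. **Theorem (Minimum Homotopy Decomposition).** Let $C$ be a normal curve. 1. If $C$ is self-overlapping and $\Gamma$ is a decomposition of $C$ with $|\Gamma|>1$, then every homotopy $H_\Gamma$ induced by $\Gamma$ is a null-homotopy of $C$ that is not minimum. 2. If $C$ is a $k$-boundary and $\Gamma$ is a decomposition of $C$ with $|\Gamma|>k$, then every homotopy $H_\Gamma$ induced by $\Gamma$ is a null-homotopy of $C$ that is not minimum. -/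

import Mathlib

open Set Filter Topology MeasureTheory
open scoped ENNReal

noncomputable section

namespace MinHomotopy

/-! ### Normal curves

The plane is `ℂ`.  A closed curve is a continuous `1`-periodic map `ℝ → ℂ` (the periodic extension
of a map on `[0,1]` with equal values at the end points); its base point is `C 0`. -/

/-- Parametrization of the unit circle by `ℝ / ℤ`. -/
def circ (t : ℝ) : ℂ := Complex.exp (2 * Real.pi * t * Complex.I)

/-- `C` is piecewise regular: `[0,1]` is divided into finitely many intervals, on each of which
(end points included) `C` is continuously differentiable with nowhere vanishing derivative. -/
def IsPiecewiseRegular (C : ℝ → ℂ) : Prop :=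
  ∃ (m : ℕ) (τ : Fin (m + 1) → ℝ), StrictMono τ ∧ τ 0 = 0 ∧ τ (Fin.last m) = 1 ∧
    ∀ i : Fin m,
      ContDiffOn ℝ 1 C (Icc (τ i.castSucc) (τ i.succ)) ∧
      ∀ t ∈ Icc (τ i.castSucc) (τ i.succ),
        derivWithin C (Icc (τ i.castSucc) (τ i.succ)) t ≠ 0

/-- The intersection points of a closed curve: points passed at two or more parameters
(parameters are taken in `[0,1)`, since `0` and `1` are the same point of the circle). -/
def intersectionPoints (C : ℝ → ℂ) : Set ℂ :=
  {p | ∃ s ∈ Ico (0 : ℝ) 1, ∃ t ∈ Ico (0 : ℝ) 1, s ≠ t ∧ C s = p ∧ C t = p}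

/-- `p` is passed exactly twice, with linearly independent tangent vectors. -/
def IsSimpleCrossing (C : ℝ → ℂ) (p : ℂ) : Prop :=
  ∃ t₁ t₂ : ℝ, t₁ ≠ t₂ ∧ {t | t ∈ Ico (0 : ℝ) 1 ∧ C t = p} = {t₁, t₂} ∧
    DifferentiableAt ℝ C t₁ ∧ DifferentiableAt ℝ C t₂ ∧
    LinearIndependent ℝ ![deriv C t₁, deriv C t₂]

/-- (Piecewise regular, non-constant) normal closed curves. -/
structure IsNormalCurve (C : ℝ → ℂ) : Prop where
  continuous : Continuous C
  periodic : Function.Periodic C 1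
  piecewiseRegular : IsPiecewiseRegular C
  base_simple : ∀ t ∈ Ioo (0 : ℝ) 1, C t ≠ C 0
  finite_intersections : (intersectionPoints C).Finite
  simple_crossings : ∀ p ∈ intersectionPoints C, IsSimpleCrossing C p

/-- The set `P_C` of the base point and the intersection points. -/
def vertices (C : ℝ → ℂ) : Set ℂ := insert (C 0) (intersectionPoints C)

/-! ### Whitney index -/

/-- The closed curve `f` avoids `0` and has winding number `n` about `0`: it has a continuous
argument `θ` along `[0,1]`, which grows by `2πn`. -/
def HasWindingNumberZero (f : ℝ → ℂ) (n : ℤ) : Prop :=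
  ∃ θ : ℝ → ℝ, ContinuousOn θ (Icc 0 1) ∧
    (∀ t ∈ Icc (0 : ℝ) 1, f t ≠ 0 ∧ f t = (‖f t‖ : ℂ) * Complex.exp (θ t * Complex.I)) ∧
    θ 1 - θ 0 = 2 * Real.pi * n

/-- The `C¹` closed curve near `C` that is obtained by rounding the corners of `C` through local
averaging at scale `h`. -/
def smoothing (C : ℝ → ℂ) (h : ℝ) (t : ℝ) : ℂ := (h : ℂ)⁻¹ * ∫ u in t..(t + h), C u

/-- `C` has Whitney index `n`: the derivative of every sufficiently close smoothing of `C`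
has winding number `n` about the origin.  (For a regular curve the derivatives of the smoothings
converge uniformly to `C'`, so `n` is the winding number of `C'`.) -/
def HasWhitneyIndex (C : ℝ → ℂ) (n : ℤ) : Prop :=
  ∀ᶠ h in 𝓝[>] (0 : ℝ), HasWindingNumberZero (deriv (smoothing C h)) n

/-! ### Self-overlapping curves -/

/-- The closed unit disk `D²`. -/
def disk : Set ℂ := Metric.closedBall 0 1

/-- The points of the unit circle over which the closed curve `C` fails to be `C¹`. -/
def corners (C : ℝ → ℂ) : Set ℂ := {z | ∃ t : ℝ, z = circ t ∧ ¬ ContDiffAt ℝ 1 C t}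

/-- `F` is an immersion of the closed disk with boundary curve `C`.  If `C` is regular there are
no corners and this is a `C¹` immersion of the closed disk (then `locallyInjective` is
automatic).  At the finitely many corners of a piecewise regular curve, where no differentiable
immersion can exist, `F` is an immersion in the topological sense. -/
structure IsImmersedDisk (F : ℂ → ℂ) (C : ℝ → ℂ) : Prop where
  continuousOn : ContinuousOn F disk
  locallyInjective : ∀ z ∈ disk, ∃ U ∈ 𝓝[disk] z, InjOn F U
  immersion : ∀ z ∈ disk, z ∉ corners C →
    ContDiffWithinAt ℝ 1 F disk z ∧ Function.Injective (fderivWithin ℝ F disk z)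
  boundary : ∀ t : ℝ, F (circ t) = C t

def IsSelfOverlapping (C : ℝ → ℂ) : Prop := ∃ F : ℂ → ℂ, IsImmersedDisk F C

/-- A self-overlapping curve is positive if its Whitney index is `1`. -/
def IsPositiveSelfOverlapping (C : ℝ → ℂ) : Prop :=
  IsSelfOverlapping C ∧ HasWhitneyIndex C 1

/-! ### Closed subcurves and decompositions -/

/-- A closed subcurve of `C`: follow `C` from `left` to `right`, where `C left = C right`, and skip
finitely many disjoint intervals (`gaps`) over each of which `C` returns to the same point. -/
structure ClosedSubcurve (C : ℝ → ℂ) where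
  left : ℝ
  right : ℝ
  gaps : Finset (ℝ × ℝ)
  left_nonneg : 0 ≤ left
  left_lt_right : left < right
  right_le_one : right ≤ 1
  closed : C left = C right
  gaps_mem : ∀ g ∈ gaps, left < g.1 ∧ g.1 < g.2 ∧ g.2 < right
  gaps_closed : ∀ g ∈ gaps, C g.1 = C g.2
  gaps_disjoint : ∀ g ∈ gaps, ∀ g' ∈ gaps, g ≠ g' → Disjoint (Icc g.1 g.2) (Icc g'.1 g'.2)

namespace ClosedSubcurve

variable {C : ℝ → ℂ}

/-- The parameters (of `C`) that the subcurve runs through. -/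
def support (γ : ClosedSubcurve C) : Set ℝ :=
  Icc γ.left γ.right \ ⋃ g ∈ γ.gaps, Ioo g.1 g.2

/-- The image `[γ]`. -/
def trace (γ : ClosedSubcurve C) : Set ℂ := C '' γ.support

/-- The root of `γ`: the first point of `γ` in the order of travel along `C`. -/
def root (γ : ClosedSubcurve C) : ℂ := C γ.left

/-- Total length of the parameter set of `γ`. -/
def length (γ : ClosedSubcurve C) : ℝ := γ.right - γ.left - ∑ g ∈ γ.gaps, (g.2 - g.1)

/-- The proportion of the parameter set of `γ` that lies in `[left, t]`: for `t` between `left`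
and `right` it increases from `0` to `1`, and it is constant exactly on the gaps. -/
def progress (γ : ClosedSubcurve C) (t : ℝ) : ℝ :=
  (t - γ.left - ∑ g ∈ γ.gaps, (min t g.2 - min t g.1)) / γ.length

/-- The first parameter of `C` at which the proportion `y ∈ [0,1]` of `γ` has been travelled. -/
def time (γ : ClosedSubcurve C) (y : ℝ) : ℝ :=
  sInf {t | t ∈ Icc γ.left γ.right ∧ y ≤ γ.progress t}

/-- `γ` as a closed curve, parametrized by `progress`. -/
def curve (γ : ClosedSubcurve C) (x : ℝ) : ℂ := C (γ.time (Int.fract x))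

end ClosedSubcurve

/-- A decomposition of `C` into `l` self-overlapping closed subcurves.  (The traces are infinite and
meet in finitely many points, so the members of the family are distinct.) -/
structure Decomposition (C : ℝ → ℂ) (l : ℕ) where
  piece : Fin l → ClosedSubcurve C
  selfOverlapping : ∀ i, IsSelfOverlapping (piece i).curve
  inter_subset : ∀ i j, i ≠ j → (piece i).trace ∩ (piece j).trace ⊆ vertices C
  iUnion_trace : ⋃ i, (piece i).trace = range C

/-- `C` is a `k`-boundary: it has a decomposition into `k` positive self-overlapping curves. -/
def IsKBoundary (C : ℝ → ℂ) (k : ℕ) : Prop :=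
  ∃ Γ : Decomposition C k, ∀ i, IsPositiveSelfOverlapping (Γ.piece i).curve

/-! ### Homotopies and their area -/

/-- The square `[0,1]²`, with points `(s, t)`: `s` is the time of the homotopy and `t` is the
parameter of the curve. -/
def square : Set (ℝ × ℝ) := Icc 0 1 ×ˢ Icc 0 1

/-- `H` is a homotopy, with fixed base point, from `C` to the constant curve `C 0`. -/
structure IsNullHomotopy (C : ℝ → ℂ) (H : ℝ × ℝ → ℂ) : Prop where
  continuousOn : ContinuousOn H square
  initial : ∀ t ∈ Icc (0 : ℝ) 1, H (0, t) = C t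
  final : ∀ t ∈ Icc (0 : ℝ) 1, H (1, t) = C 0
  base_left : ∀ s ∈ Icc (0 : ℝ) 1, H (s, 0) = C 0
  base_right : ∀ s ∈ Icc (0 : ℝ) 1, H (s, 1) = C 0

/-- `H` is piecewise differentiable: finitely many line segments divide the square, `H` is `C¹` off
these segments, and along each of them it is `C¹` up to finitely many points. -/
def IsPiecewiseDifferentiable (H : ℝ × ℝ → ℂ) : Prop :=
  ∃ E : Finset ((ℝ × ℝ) × (ℝ × ℝ)),
    (∀ e ∈ E, e.1 ∈ square ∧ e.2 ∈ square) ∧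
    ContDiffOn ℝ 1 H ((Ioo 0 1 ×ˢ Ioo 0 1) \ ⋃ e ∈ E, segment ℝ e.1 e.2) ∧
    ∀ e ∈ E, ∃ T : Set ℝ, T.Finite ∧
      ContDiffOn ℝ 1 (fun u : ℝ => H (AffineMap.lineMap e.1 e.2 u)) (Ioo 0 1 \ T)

/-- `E_H(x)`: the number of connected components of the fibre of `H` over `x`. -/
def sweepCount (H : ℝ × ℝ → ℂ) (x : ℂ) : ℕ∞ :=
  ENat.card (ConnectedComponents {p : ℝ × ℝ // p ∈ square ∧ H p = x})

/-- The homotopy area, the integral of `E_H` over the plane. -/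
def area (H : ℝ × ℝ → ℂ) : ℝ≥0∞ := ∫⁻ x : ℂ, (sweepCount H x : ℝ≥0∞)

/-- The minimum homotopy area `σ(C)`. -/
def minArea (C : ℝ → ℂ) : ℝ≥0∞ :=
  ⨅ (H : ℝ × ℝ → ℂ) (_ : IsNullHomotopy C H ∧ IsPiecewiseDifferentiable H), area H

/-- A minimum homotopy is a homotopy from `C` to its base point whose area is `σ(C)`. -/
def IsMinimumHomotopy (C : ℝ → ℂ) (H : ℝ × ℝ → ℂ) : Prop :=
  IsNullHomotopy C H ∧ area H = minArea C

/-! ### The homotopy induced by a decomposition -/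

/-- Concatenation `H₁ + H₂`. -/
def concat (H₁ H₂ : ℝ × ℝ → ℂ) : ℝ × ℝ → ℂ := fun p =>
  open Classical in if p.1 ≤ 1 / 2 then H₁ (2 * p.1, p.2) else H₂ (2 * p.1 - 1, p.2)

section

variable {C : ℝ → ℂ}

/-- Contract the piece `γ` of the current curve `D` to its root.  The piece bounds the immersed
disk `F`; the disk is retracted along straight lines to the point `1` of its boundary, which
lies over the root.  The rest of `D` does not move. -/
def contractPiece (γ : ClosedSubcurve C) (F : ℂ → ℂ) (D : ℝ → ℂ) : ℝ × ℝ → ℂ := fun p =>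
  open Classical in
  if p.2 ∈ Icc γ.left γ.right then F ((1 - p.1 : ℂ) * circ (γ.progress p.2) + p.1) else D p.2

/-- The curve that is left when `γ` has been contracted to its root. -/
def afterContraction (γ : ClosedSubcurve C) (D : ℝ → ℂ) : ℝ → ℂ := fun t =>
  open Classical in if t ∈ Icc γ.left γ.right then γ.root else D t

/-- Contract the pieces of the list one after the other, starting from the curve `D`. -/
def contractList : List (ClosedSubcurve C × (ℂ → ℂ)) → (ℝ → ℂ) → ℝ × ℝ → ℂ
  | [], D => fun p => D p.2
  | [x], D => contractPiece x.1 x.2 D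
  | x :: y :: L, D =>
      concat (contractPiece x.1 x.2 D) (contractList (y :: L) (afterContraction x.1 D))

/-- `H` is a homotopy `H_Γ` induced by `Γ`: the pieces are ordered as `γ₁, …, γ_l` so that the root
of `γ_i` does not lie on any later piece, and are contracted one at a time from the last
to the first, by means of immersed disks `F` that they bound. -/
def Decomposition.Induces {l : ℕ} (Γ : Decomposition C l) (H : ℝ × ℝ → ℂ) : Prop :=
  ∃ (e : Equiv.Perm (Fin l)) (F : Fin l → ℂ → ℂ),
    (∀ i j, i < j → (Γ.piece (e i)).root ∉ (Γ.piece (e j)).trace) ∧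
    (∀ i, IsImmersedDisk (F i) (Γ.piece (e i)).curve) ∧
    H = contractList (List.ofFn fun i => (Γ.piece (e i), F i)).reverse C

end

end MinHomotopy

end

open Set Filter Topology MeasureTheory
open scoped ENNReal

noncomputable section

namespace MinHomotopy

/-! The area of an induced homotopy can be computed exactly, and two additive invariants force it to
be too large when there are too many pieces.

Let `F i` be the disks used for a decomposition. Off the image of the curve, a null set, every point
of the fibre of `F i` over `x` contributes one connected set to the fibre of the homotopy:
straight-line retraction of the disk to a boundary point reaches an interior point at one time and
along one ray. Hence the area is the integral of `∑ i, fibreCount (F i) x`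
(`IsOrdered.sweepCount_eq`).

An immersed disk preserves or reverses orientation, and this sign `ε i = ±1` controls two things
(`IsImmersedDisk.exists_sign`): the Whitney index of its boundary is `ε i`, and the winding number
of its boundary about `x` is `ε i * fibreCount (F i) x`. The first comes from shrinking the boundary
circle to the centre of the disk, the second is the argument principle. Both invariants add up over
a decomposition (`Decomposition.sum_logVar_chord`, `Decomposition.sum_logVar_sub`); for the Whitney
index this rests on the transversality of the crossings.

Compare `Γ`, with `l` pieces, and `Γ'`, with `k < l` pieces of a common sign `ε'`. Whitney indices
give `∑ ε i = k ε'`, so some `ε i₀ = -ε'`. Winding numbers give `∑ fibreCount (F' j) x = ∑ ε' ε i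
fibreCount (F i) x`, which is at most `∑ fibreCount (F i) x - fibreCount (F i₀) x`. Since the disk
`F i₀` covers an open set, the homotopy induced by `Γ'` has strictly smaller area. A
self-overlapping curve is such a `Γ'` with one piece, and a `k`-boundary has such a `Γ'` with all
signs `1`.

No formula for `σ(C)` is needed, but the competitor must exist and be admissible: `Γ'` has an
admissible order (`Decomposition.exists_isOrdered`), pieces contracted in such an order give a
null-homotopy (`PieceSystem.walk`, `IsOrdered.isNullHomotopy`), and this homotopy is piecewise
differentiable (`IsOrdered.isPiecewiseDifferentiable`). -/

/-! ### Variation of the logarithm along a path -/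

/-- A nowhere vanishing continuous function on a convex set has a continuous logarithm. -/
theorem exists_continuousOn_log {E : Type*} [NormedAddCommGroup E] [NormedSpace ℝ E]
    {K : Set E} (hK : Convex ℝ K) (hne : K.Nonempty) {f : E → ℂ} (hf : ContinuousOn f K)
    (h0 : ∀ x ∈ K, f x ≠ 0) :
    ∃ L : E → ℂ, ContinuousOn L K ∧ ∀ x ∈ K, Complex.exp (L x) = f x := by
  classical
  have := hK.contractibleSpace hne
  have := hK.locallyPathConnectedSpace
  obtain ⟨x₀, hx₀⟩ := hne
  rcases Complex.isCoveringMapOn_exp.existsUnique_continuousMap_lifts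
    ⟨K.domRestrict f, continuousOn_iff_continuous_domRestrict.mp hf⟩ (a₀ := ⟨x₀, hx₀⟩)
    (Complex.exp_log (h0 x₀ hx₀)) (fun x ↦ h0 x x.2) with ⟨g, ⟨-, hg⟩, -⟩
  refine ⟨fun z ↦ if hz : z ∈ K then g ⟨z, hz⟩ else 0, ?_, fun x hx ↦ ?_⟩
  · rw [continuousOn_iff_continuous_domRestrict]
    convert map_continuous g with z
    ext z
    simp
  · have := congrFun hg ⟨x, hx⟩
    simp only [hx, dif_pos]
    exact this

/-- `L` is a continuous logarithm of `f` on `[a,b]`. -/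
def IsLogLift (L f : ℝ → ℂ) (a b : ℝ) : Prop :=
  ContinuousOn L (Icc a b) ∧ ∀ t ∈ Icc a b, Complex.exp (L t) = f t

open Classical in
/-- The variation of a continuous logarithm of `f` along `[a,b]`. -/
def logVar (f : ℝ → ℂ) (a b : ℝ) : ℂ :=
  -- Because of the default `0`, the rules below ask for `NonvanishingOn` or for some other
  -- condition that provides a lift.
  if h : ∃ L, IsLogLift L f a b then h.choose b - h.choose a else 0

theorem exists_isLogLift {f : ℝ → ℂ} {a b : ℝ} (hab : a ≤ b) (hf : ContinuousOn f (Icc a b))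
    (h0 : ∀ t ∈ Icc a b, f t ≠ 0) : ∃ L, IsLogLift L f a b :=
  exists_continuousOn_log (convex_Icc a b) (nonempty_Icc.2 hab) hf h0

/-- A continuous function on `[a,b]` with values in `2πiℤ` is constant. -/
theorem eq_of_exp_eq_one {D : ℝ → ℂ} {a b : ℝ} (hab : a ≤ b) (hD : ContinuousOn D (Icc a b))
    (h1 : ∀ t ∈ Icc a b, Complex.exp (D t) = 1) : D b = D a := by
  have hq : ∀ t ∈ Icc a b, ∃ n : ℤ, D t = n * (2 * Real.pi * Complex.I) :=
    fun t ht => Complex.exp_eq_one_iff.1 (h1 t ht)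
  have hpre : IsPreconnected (D '' Icc a b) := (isPreconnected_Icc).image _ hD
  have hsub : D '' Icc a b ⊆ range (fun n : ℤ => (n : ℂ) * (2 * Real.pi * Complex.I)) := by
    rintro _ ⟨t, ht, rfl⟩
    obtain ⟨n, hn⟩ := hq t ht
    exact ⟨n, hn.symm⟩
  have hcount : (D '' Icc a b).Countable := (countable_range _).mono hsub
  exact hcount.isTotallyDisconnected _ subset_rfl hpre (mem_image_of_mem _ (right_mem_Icc.2 hab))
    (mem_image_of_mem _ (left_mem_Icc.2 hab))

theorem IsLogLift.sub_eq {L L' f : ℝ → ℂ} {a b : ℝ} (hab : a ≤ b) (h : IsLogLift L f a b)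
    (h' : IsLogLift L' f a b) : L b - L a = L' b - L' a := by
  have := eq_of_exp_eq_one (D := fun t => L t - L' t) hab (h.1.sub h'.1) (fun t ht => by
    rw [Complex.exp_sub, h.2 t ht, h'.2 t ht, div_self]
    rw [← h.2 t ht]; exact Complex.exp_ne_zero _)
  linear_combination this

theorem IsLogLift.logVar_eq {L f : ℝ → ℂ} {a b : ℝ} (hab : a ≤ b) (h : IsLogLift L f a b) :
    logVar f a b = L b - L a := by
  have hex : ∃ L, IsLogLift L f a b := ⟨L, h⟩
  rw [logVar, dif_pos hex]
  exact hex.choose_spec.sub_eq hab h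

theorem IsLogLift.mono {L f : ℝ → ℂ} {a b c d : ℝ} (h : IsLogLift L f a b) (hac : a ≤ c)
    (hdb : d ≤ b) : IsLogLift L f c d :=
  ⟨h.1.mono (Icc_subset_Icc hac hdb), fun t ht => h.2 t (Icc_subset_Icc hac hdb ht)⟩

/-- `f` is continuous and nowhere zero on `[a,b]`. -/
def NonvanishingOn (f : ℝ → ℂ) (a b : ℝ) : Prop :=
  ContinuousOn f (Icc a b) ∧ ∀ t ∈ Icc a b, f t ≠ 0

theorem NonvanishingOn.mono {f : ℝ → ℂ} {a b c d : ℝ} (h : NonvanishingOn f a b) (hac : a ≤ c)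
    (hdb : d ≤ b) : NonvanishingOn f c d :=
  ⟨h.1.mono (Icc_subset_Icc hac hdb), fun t ht => h.2 t (Icc_subset_Icc hac hdb ht)⟩

theorem NonvanishingOn.congr {f g : ℝ → ℂ} {a b : ℝ} (h : NonvanishingOn f a b)
    (hfg : EqOn g f (Icc a b)) : NonvanishingOn g a b :=
  ⟨h.1.congr hfg, fun t ht => by rw [hfg ht]; exact h.2 t ht⟩

theorem NonvanishingOn.union {f : ℝ → ℂ} {a b c : ℝ} (h : NonvanishingOn f a b)
    (h' : NonvanishingOn f b c) (hab : a ≤ b) (hbc : b ≤ c) : NonvanishingOn f a c := by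
  rw [NonvanishingOn, ← Icc_union_Icc_eq_Icc hab hbc]
  refine ⟨h.1.union_of_isClosed h'.1 isClosed_Icc isClosed_Icc, ?_⟩
  rintro t (ht | ht)
  exacts [h.2 t ht, h'.2 t ht]

theorem NonvanishingOn.exists_lift {f : ℝ → ℂ} {a b : ℝ} (h : NonvanishingOn f a b)
    (hab : a ≤ b) : ∃ L, IsLogLift L f a b := exists_isLogLift hab h.1 h.2

theorem logVar_add {f : ℝ → ℂ} {a b c : ℝ} (hab : a ≤ b) (hbc : b ≤ c)
    (h : NonvanishingOn f a c) : logVar f a b + logVar f b c = logVar f a c := by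
  obtain ⟨L, hL⟩ := h.exists_lift (hab.trans hbc)
  rw [(hL.mono le_rfl hbc).logVar_eq hab, (hL.mono hab le_rfl).logVar_eq hbc,
    hL.logVar_eq (hab.trans hbc)]
  ring

theorem logVar_congr {f g : ℝ → ℂ} {a b : ℝ} (hab : a ≤ b) (h : NonvanishingOn f a b)
    (hfg : EqOn g f (Icc a b)) : logVar g a b = logVar f a b := by
  obtain ⟨L, hL⟩ := h.exists_lift hab
  rw [hL.logVar_eq hab, IsLogLift.logVar_eq hab (L := L)]
  exact ⟨hL.1, fun t ht => by rw [hL.2 t ht, hfg ht]⟩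

/-- Additivity over the intervals of a subdivision. -/
theorem sum_logVar {f : ℝ → ℂ} {b : ℕ → ℝ} (hb : Monotone b) (N : ℕ)
    (h : NonvanishingOn f (b 0) (b N)) :
    ∑ k ∈ Finset.range N, logVar f (b k) (b (k + 1)) = logVar f (b 0) (b N) := by
  induction N with
  | zero =>
    obtain ⟨L, hL⟩ := h.exists_lift le_rfl
    simp [hL.logVar_eq le_rfl]
  | succ n ih =>
    rw [Finset.sum_range_succ, ih (h.mono le_rfl (hb n.le_succ))]
    exact logVar_add (hb n.zero_le) (hb n.le_succ) h

theorem logVar_of_const {f : ℝ → ℂ} {a b : ℝ} {c : ℂ} (hab : a ≤ b) (hc : c ≠ 0)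
    (h : ∀ t ∈ Icc a b, f t = c) : logVar f a b = 0 := by
  rw [IsLogLift.logVar_eq hab (L := fun _ => Complex.log c)]
  · simp
  · exact ⟨continuousOn_const, fun t ht => by rw [Complex.exp_log hc, h t ht]⟩

/-- If `L` lifts `f` then `L ∘ φ` lifts `f ∘ φ`, so `φ` need not be injective. It is applied to the
clamped progress of a piece, which is constant on gaps. -/
theorem logVar_comp {f : ℝ → ℂ} {φ : ℝ → ℝ} {a b : ℝ} (hab : a ≤ b)
    (hφ : ContinuousOn φ (Icc a b)) (hmaps : MapsTo φ (Icc a b) (Icc (φ a) (φ b)))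
    (h : NonvanishingOn f (φ a) (φ b)) :
    logVar (f ∘ φ) a b = logVar f (φ a) (φ b) := by
  have hle : φ a ≤ φ b := (hmaps (left_mem_Icc.2 hab)).2
  obtain ⟨L, hL⟩ := h.exists_lift hle
  rw [hL.logVar_eq hle, IsLogLift.logVar_eq hab (L := L ∘ φ)]
  · rfl
  · exact ⟨hL.1.comp hφ hmaps, fun t ht => hL.2 _ (hmaps ht)⟩

theorem logVar_mul {f g : ℝ → ℂ} {a b : ℝ} (hab : a ≤ b) (hf : NonvanishingOn f a b)
    (hg : NonvanishingOn g a b) :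
    logVar (fun t => f t * g t) a b = logVar f a b + logVar g a b := by
  obtain ⟨L, hL⟩ := hf.exists_lift hab
  obtain ⟨M, hM⟩ := hg.exists_lift hab
  rw [hL.logVar_eq hab, hM.logVar_eq hab, IsLogLift.logVar_eq hab (L := fun t => L t + M t)]
  · ring
  · exact ⟨hL.1.add hM.1, fun t ht => by rw [Complex.exp_add, hL.2 t ht, hM.2 t ht]⟩

theorem NonvanishingOn.mul {f g : ℝ → ℂ} {a b : ℝ} (hf : NonvanishingOn f a b)
    (hg : NonvanishingOn g a b) : NonvanishingOn (fun t => f t * g t) a b :=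
  ⟨hf.1.mul hg.1, fun t ht => mul_ne_zero (hf.2 t ht) (hg.2 t ht)⟩

theorem NonvanishingOn.conj {f : ℝ → ℂ} {a b : ℝ} (hf : NonvanishingOn f a b) :
    NonvanishingOn (fun t => (starRingEnd ℂ) (f t)) a b :=
  ⟨Complex.continuous_conj.comp_continuousOn hf.1, fun t ht => by simpa using hf.2 t ht⟩

theorem logVar_conj {f : ℝ → ℂ} {a b : ℝ} (hab : a ≤ b) (hf : NonvanishingOn f a b) :
    logVar (fun t => (starRingEnd ℂ) (f t)) a b = (starRingEnd ℂ) (logVar f a b) := by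
  obtain ⟨L, hL⟩ := hf.exists_lift hab
  rw [hL.logVar_eq hab, IsLogLift.logVar_eq hab (L := fun t => (starRingEnd ℂ) (L t))]
  · simp
  · exact ⟨Complex.continuous_conj.comp_continuousOn hL.1, fun t ht => by
      simp only [← hL.2 t ht, Complex.exp_conj]⟩

/-- A function with values in the half plane `{z | 0 < Re (z / u)}`. -/
theorem logVar_halfPlane {f : ℝ → ℂ} {a b : ℝ} {u : ℂ} (hab : a ≤ b)
    (hf : ContinuousOn f (Icc a b)) (h : ∀ t ∈ Icc a b, 0 < (f t / u).re) :
    logVar f a b = Complex.log (f b / u) - Complex.log (f a / u) := by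
  have hu : u ≠ 0 := by
    rintro rfl
    simpa using h a (left_mem_Icc.2 hab)
  -- Division by `u` moves the values into the right half plane, where the principal logarithm is
  -- continuous.
  rw [IsLogLift.logVar_eq hab (L := fun t => Complex.log (f t / u) + Complex.log u)]
  · ring
  · refine ⟨ContinuousOn.add (ContinuousOn.clog (hf.div_const u) fun t ht => ?_)
      continuousOn_const, fun t ht => ?_⟩
    · exact Or.inl (h t ht)
    · rw [Complex.exp_add, Complex.exp_log, Complex.exp_log hu, div_mul_cancel₀ _ hu]
      intro h0
      simpa [h0] using h t ht

/-- Closed paths that are close to each other have the same variation of the logarithm. -/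
theorem logVar_eq_of_norm_sub_lt {f g : ℝ → ℂ} {a b : ℝ} (hab : a ≤ b)
    (hf : ContinuousOn f (Icc a b)) (hg : ContinuousOn g (Icc a b))
    (hfab : f b = f a) (hgab : g b = g a)
    (h : ∀ t ∈ Icc a b, ‖f t - g t‖ < ‖g t‖) : logVar f a b = logVar g a b := by
  have hg0 : ∀ t ∈ Icc a b, g t ≠ 0 := fun t ht h0 => by
    have := h t ht
    rw [h0, norm_zero] at this
    exact absurd this (not_lt.2 (norm_nonneg _))
  -- The quotient `f / g` stays within distance less than `1` of `1`, so its principal logarithm is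
  -- continuous and, the paths being closed, returns to its initial value.
  have hre : ∀ t ∈ Icc a b, 0 < (f t / g t / 1).re := fun t ht => by
    have h1 : ‖f t / g t - 1‖ < 1 := by
      rw [div_sub_one (hg0 t ht), norm_div, div_lt_one (norm_pos_iff.2 (hg0 t ht))]
      exact h t ht
    have h2 := (Complex.abs_re_le_norm (f t / g t - 1)).trans_lt h1
    rw [Complex.sub_re, Complex.one_re] at h2
    rw [div_one]
    linarith [(abs_lt.1 h2).1]
  have hcont : ContinuousOn (fun t => f t / g t) (Icc a b) := hf.div hg hg0
  have h1 := logVar_halfPlane (u := 1) hab hcont hre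
  have hnv : NonvanishingOn (fun t => f t / g t) a b :=
    ⟨hcont, fun t ht h0 => by simpa [h0] using hre t ht⟩
  have h2 := logVar_mul hab hnv ⟨hg, hg0⟩
  rw [h1, hfab, hgab, sub_self, zero_add] at h2
  rw [← h2]
  symm
  refine logVar_congr hab ⟨hf, fun t ht h0 => ?_⟩ fun t ht => ?_
  · simpa [h0] using hre t ht
  · simp [div_mul_cancel₀ _ (hg0 t ht)]

/-- Homotopy invariance for closed paths. -/
theorem logVar_homotopy {K : ℝ × ℝ → ℂ} {a b c d : ℝ} (hcd : c ≤ d) (hab : a ≤ b)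
    (hK : ContinuousOn K (Icc c d ×ˢ Icc a b))
    (h0 : ∀ p ∈ Icc c d ×ˢ Icc a b, K p ≠ 0)
    (hclosed : ∀ s ∈ Icc c d, K (s, b) = K (s, a)) :
    logVar (fun t => K (d, t)) a b = logVar (fun t => K (c, t)) a b := by
  obtain ⟨L, hLc, hL⟩ := exists_continuousOn_log ((convex_Icc c d).prod (convex_Icc a b))
    ((nonempty_Icc.2 hcd).prod (nonempty_Icc.2 hab)) hK h0
  have key : ∀ s ∈ Icc c d, logVar (fun t => K (s, t)) a b = L (s, b) - L (s, a) := fun s hs =>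
    IsLogLift.logVar_eq (L := fun t => L (s, t)) hab
      ⟨hLc.comp (by fun_prop) fun t ht => ⟨hs, ht⟩, fun t ht => hL _ ⟨hs, ht⟩⟩
  rw [key d (right_mem_Icc.2 hcd), key c (left_mem_Icc.2 hcd)]
  -- With a logarithm on the whole rectangle, the variation at time `s` is continuous in `s` and
  -- lies in `2πiℤ` because each path is closed.
  refine eq_of_exp_eq_one (D := fun s => L (s, b) - L (s, a)) hcd ?_ fun s hs => ?_
  · exact (hLc.comp (by fun_prop) fun s hs => ⟨hs, right_mem_Icc.2 hab⟩).sub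
      (hLc.comp (by fun_prop) fun s hs => ⟨hs, left_mem_Icc.2 hab⟩)
  · rw [Complex.exp_sub, hL _ ⟨hs, right_mem_Icc.2 hab⟩, hL _ ⟨hs, left_mem_Icc.2 hab⟩,
      hclosed s hs, div_self (h0 _ ⟨hs, left_mem_Icc.2 hab⟩)]

/-- Adding `log ‖f‖` to `iθ` gives a logarithm, whose real part contributes nothing because `f` is
closed. This links the winding numbers of the statement to `logVar`. -/
theorem logVar_of_hasWindingNumberZero {f : ℝ → ℂ} {n : ℤ} (hf : ContinuousOn f (Icc 0 1))
    (hclosed : f 1 = f 0) (h : HasWindingNumberZero f n) :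
    logVar f 0 1 = 2 * Real.pi * Complex.I * n := by
  obtain ⟨θ, hθ, hfθ, hn⟩ := h
  rw [IsLogLift.logVar_eq zero_le_one
    (L := fun t => ((Real.log ‖f t‖ : ℝ) : ℂ) + θ t * Complex.I)]
  · rw [hclosed]
    have : ((θ 1 - θ 0 : ℝ) : ℂ) = ((2 * Real.pi * n : ℝ) : ℂ) := by rw [hn]
    push_cast at this
    linear_combination Complex.I * this
  · refine ⟨ContinuousOn.add ?_ ?_, fun t ht => ?_⟩
    · exact Complex.continuous_ofReal.comp_continuousOn
        (ContinuousOn.log hf.norm fun t ht => norm_ne_zero_iff.2 (hfθ t ht).1)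
    · exact (Complex.continuous_ofReal.comp_continuousOn hθ).mul continuousOn_const
    · rw [Complex.exp_add, ← Complex.ofReal_exp,
        Real.exp_log (norm_pos_iff.2 (hfθ t ht).1), ← (hfθ t ht).2]

/-! ### The unit circle -/

@[fun_prop]
theorem continuous_circ : Continuous circ := by unfold circ; fun_prop

theorem circ_add (s t : ℝ) : circ (s + t) = circ s * circ t := by
  unfold circ
  rw [← Complex.exp_add]
  congr 1
  push_cast
  ring

theorem circ_zero : circ 0 = 1 := by simp [circ]

theorem circ_one : circ 1 = 1 := by
  simp [circ, Complex.exp_two_pi_mul_I]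

theorem circ_add_one (t : ℝ) : circ (t + 1) = circ t := by rw [circ_add, circ_one, mul_one]

theorem norm_circ (t : ℝ) : ‖circ t‖ = 1 := by
  have : (2 * Real.pi * t * Complex.I : ℂ) = ((2 * Real.pi * t : ℝ) : ℂ) * Complex.I := by
    push_cast; ring
  rw [circ, this, Complex.norm_exp_ofReal_mul_I]

theorem circ_ne_zero (t : ℝ) : circ t ≠ 0 := Complex.exp_ne_zero _

theorem circ_mem_disk (t : ℝ) : circ t ∈ disk := by simp [disk, norm_circ]

theorem circ_eq_one_iff {t : ℝ} : circ t = 1 ↔ ∃ n : ℤ, t = n := by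
  rw [circ, Complex.exp_eq_one_iff]
  refine exists_congr fun n => ?_
  have h2 : (2 * Real.pi * Complex.I : ℂ) ≠ 0 := Complex.two_pi_I_ne_zero
  constructor
  · intro h
    have : (t : ℂ) = (n : ℂ) := mul_right_cancel₀ h2 (by linear_combination h)
    exact_mod_cast this
  · rintro rfl
    push_cast
    ring

theorem circ_eq_circ_iff {s t : ℝ} : circ s = circ t ↔ ∃ n : ℤ, s - t = n := by
  rw [← circ_eq_one_iff, sub_eq_add_neg, circ_add]
  have : circ (-t) * circ t = 1 := by rw [← circ_add, neg_add_cancel, circ_zero]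
  constructor
  · intro h; rw [h, mul_comm, this]
  · intro h
    calc circ s = circ s * circ (-t) * circ t := by rw [mul_assoc, this, mul_one]
      _ = circ t := by rw [h, one_mul]

theorem exists_circ_eq {z : ℂ} (hz : ‖z‖ = 1) : ∃ t ∈ Ico (0 : ℝ) 1, circ t = z := by
  have h : circ (Complex.arg z / (2 * Real.pi)) = z := by
    have := Complex.norm_mul_exp_arg_mul_I z
    rw [hz, Complex.ofReal_one, one_mul] at this
    conv_rhs => rw [← this]
    rw [circ]
    congr 1
    have : (Real.pi : ℂ) ≠ 0 := by exact_mod_cast Real.pi_ne_zero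
    push_cast
    field_simp
  refine ⟨Int.fract (Complex.arg z / (2 * Real.pi)), ⟨Int.fract_nonneg _, Int.fract_lt_one _⟩, ?_⟩
  refine Eq.trans ?_ h
  rw [circ_eq_circ_iff]
  exact ⟨-⌊Complex.arg z / (2 * Real.pi)⌋, by rw [Int.fract]; push_cast; ring⟩

/-- The winding number of the circle about `0`. -/
theorem logVar_const_mul_circ {c : ℂ} (hc : c ≠ 0) :
    logVar (fun t => c * circ t) 0 1 = 2 * Real.pi * Complex.I := by
  rw [IsLogLift.logVar_eq zero_le_one
    (L := fun t => Complex.log c + 2 * Real.pi * t * Complex.I)]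
  · simp
  · exact ⟨by fun_prop, fun t _ => by simp only [Complex.exp_add, Complex.exp_log hc, circ]⟩

/-! ### Immersed disks -/

/-- The coefficient of `z` in the real-linear map `M`. -/
def holPart (M : ℂ →L[ℝ] ℂ) : ℂ := (M 1 - Complex.I * M Complex.I) / 2

/-- The coefficient of `conj z` in the real-linear map `M`. -/
def antiPart (M : ℂ →L[ℝ] ℂ) : ℂ := (M 1 + Complex.I * M Complex.I) / 2

theorem apply_eq_holPart_add (M : ℂ →L[ℝ] ℂ) (z : ℂ) :
    M z = holPart M * z + antiPart M * (starRingEnd ℂ) z := by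
  have h : M z = (z.re : ℂ) * M 1 + (z.im : ℂ) * M Complex.I := by
    conv_lhs => rw [show z = z.re • (1 : ℂ) + z.im • Complex.I by
      simp [Complex.re_add_im]]
    rw [map_add, map_smul, map_smul, Complex.real_smul, Complex.real_smul]
  have hc : (starRingEnd ℂ) z = z.re - z.im * Complex.I := by
    apply Complex.ext <;> simp
  rw [h, hc, holPart, antiPart]
  conv_rhs => rw [← Complex.re_add_im z]
  simp only [Complex.add_re, Complex.ofReal_re, Complex.mul_re, Complex.I_re, mul_zero,
    Complex.ofReal_im, Complex.I_im, sub_zero, add_zero, Complex.add_im, Complex.mul_im,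
    zero_add, mul_one]
  linear_combination ((z.im : ℂ) * M Complex.I) * Complex.I_mul_I

/-- If the moduli agree and are nonzero, a unit `w` with `w² = -antiPart M / holPart M` satisfies `M
w = 0`, as multiplication by `w` shows. The determinant of `M` is `‖holPart M‖² - ‖antiPart M‖²`, so
comparing the two moduli reads off the orientation. -/
theorem norm_holPart_ne_norm_antiPart {M : ℂ →L[ℝ] ℂ} (hM : Function.Injective M) :
    ‖holPart M‖ ≠ ‖antiPart M‖ := by
  intro h
  obtain ⟨z, hz, hMz⟩ : ∃ z : ℂ, z ≠ 0 ∧ M z = 0 := by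
    by_cases ha : holPart M = 0
    · have hb : antiPart M = 0 := by rwa [ha, norm_zero, eq_comm, norm_eq_zero] at h
      exact ⟨1, one_ne_zero, by rw [apply_eq_holPart_add, ha, hb]; simp⟩
    · obtain ⟨w, hw⟩ := IsSquare.exists_mul_self (-antiPart M / holPart M)
        (IsAlgClosed.exists_eq_mul_self _)
      have hn : ‖w‖ = 1 := by
        have := congrArg norm hw
        rw [norm_div, norm_neg, ← h, div_self (norm_ne_zero_iff.2 ha), norm_mul] at this
        nlinarith [norm_nonneg w]
      have hw0 : w ≠ 0 := by rintro rfl; simp at hn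
      have hcw : (starRingEnd ℂ) w * w = 1 := by
        rw [mul_comm, Complex.mul_conj, Complex.normSq_eq_norm_sq, hn]; simp
      refine ⟨w, hw0, ?_⟩
      rw [apply_eq_holPart_add]
      have h2 : holPart M * (w * w) = -antiPart M := by rw [← hw]; field_simp
      have : (holPart M * w + antiPart M * (starRingEnd ℂ) w) * w = 0 := by
        linear_combination h2 + antiPart M * hcw
      exact (mul_eq_zero.1 this).resolve_right hw0
  exact hz (hM (by rw [hMz, map_zero]))

/-- A continuous, locally injective map of the closed disk that is an orientation preserving local
diffeomorphism of the open disk. -/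
structure IsPositiveDisk (F : ℂ → ℂ) : Prop where
  continuousOn : ContinuousOn F disk
  locallyInjective : ∀ z ∈ disk, ∃ U ∈ 𝓝[disk] z, InjOn F U
  deriv : ∀ z ∈ Metric.ball (0 : ℂ) 1, ∃ M : ℂ →L[ℝ] ℂ, HasStrictFDerivAt F M z ∧
    ‖antiPart M‖ < ‖holPart M‖

theorem isCompact_disk : IsCompact disk := isCompact_closedBall _ _

theorem ball_subset_disk : Metric.ball (0 : ℂ) 1 ⊆ disk := Metric.ball_subset_closedBall

/-- The complex conjugate of a map. -/
def conjMap (F : ℂ → ℂ) : ℂ → ℂ := fun z => (starRingEnd ℂ) (F z)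

theorem IsImmersedDisk.contDiffAt {F : ℂ → ℂ} {C : ℝ → ℂ} (h : IsImmersedDisk F C) {z : ℂ}
    (hz : z ∈ Metric.ball (0 : ℂ) 1) :
    ContDiffAt ℝ 1 F z ∧ Function.Injective (fderiv ℝ F z) := by
  have hmem : disk ∈ 𝓝 z := mem_of_superset (Metric.isOpen_ball.mem_nhds hz) ball_subset_disk
  have hc : z ∉ corners C := by
    rintro ⟨t, rfl, -⟩
    simp [norm_circ] at hz
  obtain ⟨h1, h2⟩ := h.immersion z (ball_subset_disk hz) hc
  rw [fderivWithin_of_mem_nhds hmem] at h2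
  exact ⟨h1.contDiffAt hmem, h2⟩

/-- An immersed disk preserves the orientation or reverses it. -/
theorem IsImmersedDisk.isPositiveDisk_or {F : ℂ → ℂ} {C : ℝ → ℂ} (h : IsImmersedDisk F C) :
    IsPositiveDisk F ∨ IsPositiveDisk (conjMap F) := by
  have hcd : ContDiffOn ℝ 1 F (Metric.ball 0 1) := fun z hz =>
    (h.contDiffAt hz).1.contDiffWithinAt
  have hD : ContinuousOn (fderiv ℝ F) (Metric.ball 0 1) :=
    hcd.continuousOn_fderiv_of_isOpen Metric.isOpen_ball le_rfl
  have happ : ∀ v : ℂ, ContinuousOn (fun z => fderiv ℝ F z v) (Metric.ball 0 1) := fun v =>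
    hD.clm_apply continuousOn_const
  -- This function has the sign of the Jacobian determinant. It is continuous and has no zero on the
  -- connected open disk, so its sign is constant.
  have hφ : ContinuousOn (fun z => ‖holPart (fderiv ℝ F z)‖ - ‖antiPart (fderiv ℝ F z)‖)
      (Metric.ball 0 1) := by
    unfold holPart antiPart
    exact ((((happ 1).sub (continuousOn_const.mul (happ Complex.I))).div_const 2).norm).sub
      ((((happ 1).add (continuousOn_const.mul (happ Complex.I))).div_const 2).norm)
  have hne : ∀ z ∈ Metric.ball (0 : ℂ) 1,
      ‖holPart (fderiv ℝ F z)‖ - ‖antiPart (fderiv ℝ F z)‖ ≠ 0 := fun z hz =>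
    sub_ne_zero.2 (norm_holPart_ne_norm_antiPart (h.contDiffAt hz).2)
  have hpc : IsPreconnected (Metric.ball (0 : ℂ) 1) := (convex_ball 0 1).isPreconnected
  have hstrict : ∀ z ∈ Metric.ball (0 : ℂ) 1, HasStrictFDerivAt F (fderiv ℝ F z) z :=
    fun z hz => (h.contDiffAt hz).1.hasStrictFDerivAt one_ne_zero
  have h0 : (0 : ℂ) ∈ Metric.ball (0 : ℂ) 1 := by simp
  rcases lt_or_gt_of_ne (hne 0 h0) with hneg | hpos
  · right
    have hall : ∀ z ∈ Metric.ball (0 : ℂ) 1,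
        ‖holPart (fderiv ℝ F z)‖ - ‖antiPart (fderiv ℝ F z)‖ < 0 := by
      intro z hz
      by_contra hcon
      obtain ⟨w, hw, hw0⟩ := hpc.intermediate_value h0 hz hφ
        (show (0 : ℝ) ∈ Icc _ _ from ⟨hneg.le, not_lt.1 hcon⟩)
      exact hne w hw hw0
    refine ⟨Complex.continuous_conj.comp_continuousOn h.continuousOn, fun z hz => ?_,
      fun z hz => ⟨(Complex.conjCLE : ℂ →L[ℝ] ℂ).comp (fderiv ℝ F z), ?_, ?_⟩⟩
    · obtain ⟨U, hU, hinj⟩ := h.locallyInjective z hz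
      exact ⟨U, hU, (starRingEnd ℂ).injective.comp_injOn hinj⟩
    · exact (Complex.conjCLE : ℂ →L[ℝ] ℂ).hasStrictFDerivAt.comp z (hstrict z hz)
    -- Conjugation exchanges the two parts, up to conjugating them.
    · have e1 : antiPart ((Complex.conjCLE : ℂ →L[ℝ] ℂ).comp (fderiv ℝ F z)) =
          (starRingEnd ℂ) (holPart (fderiv ℝ F z)) := by
        simp [antiPart, holPart, Complex.conj_ofNat, sub_eq_add_neg]
      have e2 : holPart ((Complex.conjCLE : ℂ →L[ℝ] ℂ).comp (fderiv ℝ F z)) =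
          (starRingEnd ℂ) (antiPart (fderiv ℝ F z)) := by
        simp [antiPart, holPart, Complex.conj_ofNat, sub_eq_add_neg]
      rw [e1, e2, RCLike.norm_conj, RCLike.norm_conj]
      linarith [hall z hz]
  · left
    refine ⟨h.continuousOn, h.locallyInjective, fun z hz => ⟨_, hstrict z hz, ?_⟩⟩
    by_contra hcon
    obtain ⟨w, hw, hw0⟩ := hpc.intermediate_value hz h0 hφ
      (show (0 : ℝ) ∈ Icc _ _ from ⟨by linarith, hpos.le⟩)
    exact hne w hw hw0

/-- Uniform local injectivity. -/
theorem exists_uniform_injectivity {F : ℂ → ℂ}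
    (h : ∀ z ∈ disk, ∃ U ∈ 𝓝[disk] z, InjOn F U) :
    ∃ δ > 0, ∀ z ∈ disk, ∀ w ∈ disk, dist z w < δ → F z = F w → z = w := by
  choose! U hU hinj using h
  have hV : ∀ z ∈ disk, ∃ V, IsOpen V ∧ z ∈ V ∧ V ∩ disk ⊆ U z := fun z hz =>
    mem_nhdsWithin.1 (hU z hz)
  choose! V hVo hzV hVU using hV
  obtain ⟨δ, hδ, hleb⟩ := lebesgue_number_lemma_of_metric (s := disk) (ι := disk)
    (c := fun z => V z) isCompact_disk (fun z => hVo z z.2)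
    (fun z hz => mem_iUnion.2 ⟨⟨z, hz⟩, hzV z hz⟩)
  refine ⟨δ, hδ, fun z hz w hw hzw hF => ?_⟩
  obtain ⟨i, hi⟩ := hleb z hz
  exact hinj i i.2 (hVU i i.2 ⟨hi (Metric.mem_ball_self hδ), hz⟩)
    (hVU i i.2 ⟨hi (by rwa [Metric.mem_ball, dist_comm]), hw⟩) hF

/-- The fibres of a locally injective map of the disk have bounded cardinality. -/
theorem exists_encard_fibre_le {F : ℂ → ℂ} (h : ∀ z ∈ disk, ∃ U ∈ 𝓝[disk] z, InjOn F U) :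
    ∃ m : ℕ, ∀ x, {z ∈ disk | F z = x}.encard ≤ m := by
  obtain ⟨δ, hδ, hinj⟩ := exists_uniform_injectivity h
  obtain ⟨t, htd, htf, hcov⟩ := isCompact_disk.finite_cover_balls (half_pos hδ)
  refine ⟨htf.toFinset.card, fun x => ?_⟩
  have hc : ∀ z ∈ {z ∈ disk | F z = x}, ∃ y ∈ t, z ∈ Metric.ball y (δ / 2) := fun z hz => by
    simpa using hcov hz.1
  choose! c hct hcz using hc
  have : InjOn c {z ∈ disk | F z = x} := by
    intro z hz w hw hzw
    refine hinj z hz.1 w hw.1 ?_ (hz.2.trans hw.2.symm)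
    have h1 := Metric.mem_ball.1 (hcz z hz)
    have h2 := Metric.mem_ball'.1 (hcz w hw)
    rw [hzw] at h1
    linarith [dist_triangle z (c w) w]
  calc {z ∈ disk | F z = x}.encard ≤ t.encard := encard_le_encard_of_injOn hct this
    _ = _ := by rw [← Set.Finite.encard_eq_coe_toFinset_card]

/-! ### Turning of the boundary of a positive disk -/

/-- The chord function of a curve, at scale `h`. -/
def chord (f : ℝ → ℂ) (h : ℝ) (t : ℝ) : ℂ := f (t + h) - f t

/-- The boundary of a positive disk has Whitney index `1`. -/
theorem IsPositiveDisk.logVar_chord {F : ℂ → ℂ} (hF : IsPositiveDisk F) :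
    ∀ᶠ h in 𝓝[>] (0 : ℝ), NonvanishingOn (chord (F ∘ circ) h) 0 1 ∧
      logVar (chord (F ∘ circ) h) 0 1 = 2 * Real.pi * Complex.I := by
  obtain ⟨δ, hδ, hinj⟩ := exists_uniform_injectivity hF.locallyInjective
  obtain ⟨M, hM, hlt⟩ := hF.deriv 0 (by simp)
  have hev : ∀ᶠ h in 𝓝[>] (0 : ℝ), ‖circ h - 1‖ < δ := by
    have : Tendsto (fun h => ‖circ h - 1‖) (𝓝[>] 0) (𝓝 0) := by
      have h1 : Continuous fun h => ‖circ h - 1‖ := by fun_prop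
      have := h1.tendsto 0
      simp only [circ_zero, sub_self, norm_zero] at this
      exact this.mono_left nhdsWithin_le_nhds
    exact this.eventually_lt_const hδ
  have hev1 : ∀ᶠ h in 𝓝[>] (0 : ℝ), 0 < h ∧ h < 1 := by
    filter_upwards [Ioo_mem_nhdsGT (show (0 : ℝ) < 1 by norm_num)] with h hh using hh
  filter_upwards [hev, hev1] with h hh h01
  have hc1 : circ h - 1 ≠ 0 := by
    rw [sub_ne_zero, Ne, circ_eq_one_iff]
    rintro ⟨n, rfl⟩
    have h1 : (0 : ℤ) < n := by exact_mod_cast h01.1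
    have h2 : n < (1 : ℤ) := by exact_mod_cast h01.2
    omega
  have hmem : ∀ r ∈ Icc (0 : ℝ) 1, ∀ t, (r : ℂ) * circ t ∈ disk := fun r hr t => by
    simp [disk, norm_circ, abs_of_nonneg hr.1, hr.2]
  have hdiff : ∀ (r t : ℝ), (r : ℂ) * circ (t + h) - r * circ t = r * (circ h - 1) * circ t := by
    intro r t
    rw [circ_add]; ring
  -- The two points are distinct and at distance `r * ‖circ h - 1‖ < δ`. Uniform local injectivity
  -- thus keeps the chord nonzero at every radius for one fixed scale `h`.
  have hnv : ∀ r ∈ Ioc (0 : ℝ) 1, ∀ t, F (r * circ (t + h)) - F (r * circ t) ≠ 0 := by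
    intro r hr t h0
    have hr' : r ∈ Icc (0 : ℝ) 1 := ⟨hr.1.le, hr.2⟩
    have hd : dist ((r : ℂ) * circ (t + h)) (r * circ t) < δ := by
      rw [dist_eq_norm, hdiff, norm_mul, norm_mul, norm_circ, mul_one, Complex.norm_real,
        Real.norm_of_nonneg hr.1.le]
      calc r * ‖circ h - 1‖ ≤ 1 * ‖circ h - 1‖ := by gcongr; exact hr.2
        _ < δ := by rwa [one_mul]
    have := hinj _ (hmem r hr' _) _ (hmem r hr' _) hd (sub_eq_zero.1 h0)
    rw [← sub_eq_zero, hdiff] at this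
    exact mul_ne_zero (mul_ne_zero (by exact_mod_cast hr.1.ne') hc1) (circ_ne_zero t) this
  have hcontF : ∀ r ∈ Icc (0 : ℝ) 1, ∀ k, Continuous fun t : ℝ => F (r * circ (t + k)) :=
    fun r hr k => hF.continuousOn.comp_continuous (by fun_prop) fun t => hmem r hr _
  have hcontF0 : ∀ r ∈ Icc (0 : ℝ) 1, Continuous fun t : ℝ => F (r * circ t) := fun r hr => by
    simpa using hcontF r hr 0
  refine ⟨⟨?_, fun t _ => ?_⟩, ?_⟩
  · have h1 := (hcontF 1 (by simp) h).sub (hcontF0 1 (by simp))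
    refine h1.continuousOn.congr fun t _ => ?_
    simp [chord]
  · simpa [chord] using hnv 1 (by simp) t
  -- the scale at which the linear approximation at the centre takes over
  obtain ⟨c, hc0, hc⟩ : ∃ c > 0, ‖antiPart M‖ + c < ‖holPart M‖ :=
    ⟨(‖holPart M‖ - ‖antiPart M‖) / 2, by linarith, by linarith⟩
  -- Strict differentiability is what is needed here, since both end points of the chord vary.
  have happ := hM.isLittleO.def hc0
  obtain ⟨ε, hε, hball⟩ := Metric.eventually_nhds_iff.1 happ
  obtain ⟨r, hr0, hr1, hrε⟩ : ∃ r : ℝ, 0 < r ∧ r ≤ 1 ∧ r < ε :=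
    ⟨min 1 (ε / 2), by positivity, min_le_left _ _, (min_le_right _ _).trans_lt (by linarith)⟩
  -- Shrinking the boundary circle to radius `r` does not change the winding of the chord.
  have hhom := logVar_homotopy (K := fun p : ℝ × ℝ =>
      F (p.1 * circ (p.2 + h)) - F (p.1 * circ p.2)) (a := 0) (b := 1) hr1 zero_le_one
    (by
      refine ContinuousOn.sub ?_ ?_
      · exact hF.continuousOn.comp (by fun_prop) fun p hp => hmem _ ⟨hr0.le.trans hp.1.1, hp.1.2⟩ _
      · exact hF.continuousOn.comp (by fun_prop) fun p hp => hmem _ ⟨hr0.le.trans hp.1.1, hp.1.2⟩ _)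
    (fun p hp => hnv _ ⟨hr0.trans_le hp.1.1, hp.1.2⟩ _)
    (fun s _ => by
      rw [show (1 : ℝ) + h = (0 + h) + 1 by ring, circ_add_one, circ_one, circ_zero])
  have hL : (fun t : ℝ => F (((1 : ℝ) : ℂ) * circ (t + h)) - F (((1 : ℝ) : ℂ) * circ t)) =
      chord (F ∘ circ) h := by
    funext t; simp [chord]
  simp only [] at hhom
  rw [hL] at hhom
  rw [hhom]
  have ha : holPart M ≠ 0 := by
    intro h0
    rw [h0, norm_zero] at hc
    linarith [norm_nonneg (antiPart M)]
  have hr' : (r : ℂ) ≠ 0 := by exact_mod_cast hr0.ne'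
  rw [← logVar_const_mul_circ (c := holPart M * (r * (circ h - 1)))
    (mul_ne_zero ha (mul_ne_zero hr' hc1))]
  -- At radius `r` the chord differs from `holPart M * v` by at most `(‖antiPart M‖ + c) * ‖v‖`,
  -- less than the modulus of `holPart M * v`; here `v = r * (circ h - 1) * circ t` winds once.
  refine logVar_eq_of_norm_sub_lt zero_le_one ?_ (by fun_prop) ?_ (by
    simp [circ_one, circ_zero]) fun t _ => ?_
  · exact ((hcontF r ⟨hr0.le, hr1⟩ h).sub (hcontF0 r ⟨hr0.le, hr1⟩)).continuousOn
  · rw [show (1 : ℝ) + h = (0 + h) + 1 by ring, circ_add_one, circ_one, circ_zero]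
  · have hp : dist ((r : ℂ) * circ (t + h), (r : ℂ) * circ t) ((0 : ℂ), (0 : ℂ)) < ε := by
      rw [Prod.dist_eq]
      simp [norm_circ, abs_of_pos hr0, hrε]
    have h1 := hball hp
    set v := (r : ℂ) * circ (t + h) - r * circ t with hv
    have hv0 : 0 < ‖v‖ := by
      rw [norm_pos_iff, hv, hdiff]
      exact mul_ne_zero (mul_ne_zero hr' hc1) (circ_ne_zero t)
    have h1' : ‖F (r * circ (t + h)) - F (r * circ t) - M v‖ ≤ c * ‖v‖ := h1
    rw [apply_eq_holPart_add] at h1'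
    have e : holPart M * (r * (circ h - 1)) * circ t = holPart M * v := by
      rw [hv, hdiff]; ring
    rw [e]
    calc ‖F (r * circ (t + h)) - F (r * circ t) - holPart M * v‖
        = ‖(F (r * circ (t + h)) - F (r * circ t) -
            (holPart M * v + antiPart M * (starRingEnd ℂ) v)) +
            antiPart M * (starRingEnd ℂ) v‖ := by congr 1; ring
      _ ≤ c * ‖v‖ + ‖antiPart M‖ * ‖v‖ := by
          refine (norm_add_le _ _).trans (add_le_add h1' ?_)
          rw [norm_mul, RCLike.norm_conj]
      _ < ‖holPart M * v‖ := by
          rw [norm_mul, ← add_mul]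
          gcongr
          linarith

/-! ### Argument principle for maps that need not be holomorphic -/

/-- A zero of the form `k(w)(z - w)`, `k` continuous and nonzero at `w`. -/
def HasSimpleZero (f : ℂ → ℂ) (w : ℂ) : Prop :=
  ∃ k : ℂ → ℂ, ContinuousAt k w ∧ k w ≠ 0 ∧ ∀ᶠ z in 𝓝 w, f z = k z * (z - w)

/-- A zero near which `f` is closer to `a(z - w)` than to zero. -/
def HasPositiveZero (f : ℂ → ℂ) (w : ℂ) : Prop :=
  ∃ (a : ℂ) (q : ℝ), q < ‖a‖ ∧ ∀ᶠ z in 𝓝 w, ‖f z - a * (z - w)‖ ≤ q * ‖z - w‖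

theorem disk_mem_nhds {w : ℂ} (hw : w ∈ Metric.ball (0 : ℂ) 1) : disk ∈ 𝓝 w :=
  mem_of_superset (Metric.isOpen_ball.mem_nhds hw) ball_subset_disk

/-- Simple zeros can be divided out. -/
theorem exists_eq_mul_prod (S : Finset ℂ) : ∀ f : ℂ → ℂ, ContinuousOn f disk →
    (∀ w ∈ S, w ∈ Metric.ball (0 : ℂ) 1) → (∀ z ∈ disk, f z = 0 ↔ z ∈ S) →
    (∀ w ∈ S, HasSimpleZero f w) →
    ∃ g : ℂ → ℂ, ContinuousOn g disk ∧ (∀ z ∈ disk, g z ≠ 0) ∧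
      ∀ z ∈ disk, f z = g z * ∏ w ∈ S, (z - w) := by
  classical
  induction S using Finset.induction_on with
  | empty => exact fun f hf _ h0 _ => ⟨f, hf, fun z hz => by simp [h0 z hz], by simp⟩
  | insert w S hwS ih =>
    intro f hf hS h0 hz
    obtain ⟨k, hk, hk0, hfk⟩ := hz w (Finset.mem_insert_self _ _)
    -- The value `k w` extends the quotient continuously and is nonzero, so exactly one zero is
    -- removed.
    set f₁ : ℂ → ℂ := fun z => if z = w then k w else f z / (z - w) with hf₁
    have hw : w ∈ Metric.ball (0 : ℂ) 1 := hS w (Finset.mem_insert_self _ _)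
    have hfw : f w = 0 := (h0 w (ball_subset_disk hw)).2 (Finset.mem_insert_self _ _)
    have hnear : f₁ =ᶠ[𝓝 w] k := by
      filter_upwards [hfk] with z hz
      by_cases h : z = w
      · simp [hf₁, h]
      · simp [hf₁, h, hz, mul_div_cancel_right₀ _ (sub_ne_zero.2 h)]
    have hoff : ∀ v, v ≠ w → f₁ =ᶠ[𝓝 v] fun z => f z / (z - w) := fun v hv => by
      filter_upwards [isOpen_ne.mem_nhds hv] with z hz
      simp [hf₁, show z ≠ w from hz]
    have c1 : ContinuousOn f₁ disk := by
      intro z hz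
      by_cases h : z = w
      · subst h
        exact (hk.congr hnear.symm).continuousWithinAt
      · have h1 : ContinuousWithinAt (fun z => f z / (z - w)) disk z :=
          (hf z hz).div (by fun_prop) (sub_ne_zero.2 h)
        exact h1.congr_of_eventuallyEq ((hoff z h).filter_mono nhdsWithin_le_nhds)
          (by simp [hf₁, h])
    have c2 : ∀ z ∈ disk, f₁ z = 0 ↔ z ∈ S := by
      intro z hz
      by_cases h : z = w
      · subst h
        simp [hf₁, hk0, hwS]
      · simp only [hf₁, h, if_false]
        rw [div_eq_zero_iff, h0 z hz]
        simp [h, sub_eq_zero]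
    have c3 : ∀ w ∈ S, HasSimpleZero f₁ w := by
      intro v hv
      have hvw : v ≠ w := fun h => hwS (h ▸ hv)
      obtain ⟨j, hj, hj0, hfj⟩ := hz v (Finset.mem_insert_of_mem hv)
      refine ⟨fun z => j z / (z - w), hj.div (by fun_prop) (sub_ne_zero.2 hvw),
        div_ne_zero hj0 (sub_ne_zero.2 hvw), ?_⟩
      filter_upwards [hfj, hoff v hvw] with z h1 h2
      rw [h2, h1]; ring
    obtain ⟨g, hg, hg0, hfg⟩ := ih f₁ c1 (fun v hv => hS v (Finset.mem_insert_of_mem hv)) c2 c3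
    refine ⟨g, hg, hg0, fun z hz => ?_⟩
    rw [Finset.prod_insert hwS]
    by_cases h : z = w
    · rw [h, hfw, sub_self, zero_mul, mul_zero]
    · have := hfg z hz
      simp only [hf₁, h, if_false] at this
      rw [div_eq_iff (sub_ne_zero.2 h)] at this
      rw [this, mul_right_comm, mul_assoc]

/-- Positive zeros in the open disk can be made simple without changing the boundary values. -/
theorem exists_hasSimpleZero (S : Finset ℂ) {f : ℂ → ℂ} (hf : ContinuousOn f disk)
    (hS : ∀ w ∈ S, w ∈ Metric.ball (0 : ℂ) 1) (h0 : ∀ z ∈ disk, f z = 0 ↔ z ∈ S)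
    (hz : ∀ w ∈ S, HasPositiveZero f w) : ∀ T ⊆ S,
    ∃ g : ℂ → ℂ, ContinuousOn g disk ∧ (∀ z ∈ disk, g z = 0 ↔ z ∈ S) ∧
      (∀ z, ‖z‖ = 1 → g z = f z) ∧ (∀ w ∈ T, HasSimpleZero g w) ∧
      ∀ w ∈ S, w ∉ T → HasPositiveZero g w := by
  classical
  intro T
  induction T using Finset.induction_on with
  | empty => exact fun _ => ⟨f, hf, h0, fun _ _ => rfl, by simp, fun w hw _ => hz w hw⟩
  | insert w T hwT ih =>
    intro hTS
    obtain ⟨g, hg, hg0, hgf, hgT, hgS⟩ := ih fun v hv => hTS (Finset.mem_insert_of_mem hv)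
    have hwS : w ∈ S := hTS (Finset.mem_insert_self _ _)
    have hw := hS w hwS
    obtain ⟨a, q, hqa, hap⟩ := hgS w hwS hwT
    -- For `a = 0` the number `q` would be negative, and the estimate would bound a norm by a
    -- negative number at points close to `w`.
    have ha : a ≠ 0 := by
      rintro rfl
      have hq : q < 0 := by simpa using hqa
      obtain ⟨ε, hε, hb⟩ := Metric.eventually_nhds_iff.1 hap
      have hd : dist (w + (ε / 2 : ℝ)) w < ε := by
        rw [dist_eq_norm, add_sub_cancel_left, Complex.norm_real, Real.norm_of_nonneg (by
            positivity)]
        linarith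
      have h1 := hb hd
      have h2 : 0 < ‖w + (ε / 2 : ℝ) - w‖ := by
        rw [add_sub_cancel_left, Complex.norm_real, Real.norm_of_nonneg (by positivity)]
        positivity
      nlinarith [norm_nonneg (g (w + (ε / 2 : ℝ)) - 0 * (w + (ε / 2 : ℝ) - w))]
    have hSfin : ∀ᶠ z in 𝓝 w, z ∉ S.erase w :=
      ((S.erase w).finite_toSet.isClosed.isOpen_compl.mem_nhds (by simp))
    obtain ⟨ρ, hρ, hball⟩ := Metric.eventually_nhds_iff.1
      ((hap.and hSfin).and (Metric.isOpen_ball.mem_nhds hw))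
    -- A cutoff, equal to `1` within `ρ / 4` of `w` and to `0` beyond `ρ / 2`. It replaces `g` by
    -- the linear function `a * (z - w)` near `w` and leaves the other zeros and the boundary values
    -- alone.
    set ψ : ℂ → ℝ := fun z => max 0 (min 1 (2 - 4 * dist z w / ρ)) with hψ
    have hψc : Continuous ψ := by simp only [hψ]; fun_prop
    have hψ0 : ∀ z, ρ / 2 ≤ dist z w → ψ z = 0 := fun z hzw => by
      have : 2 - 4 * dist z w / ρ ≤ 0 := by
        rw [sub_nonpos, le_div_iff₀ hρ]; linarith
      simp only [hψ]
      rw [max_eq_left ((min_le_right _ _).trans this)]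
    have hψ1 : ∀ z, dist z w ≤ ρ / 4 → ψ z = 1 := fun z hzw => by
      have : 1 ≤ 2 - 4 * dist z w / ρ := by
        rw [le_sub_comm, div_le_iff₀ hρ]; linarith
      simp only [hψ]
      rw [min_eq_left this, max_eq_right zero_le_one]
    have hψI : ∀ z, 0 ≤ ψ z ∧ ψ z ≤ 1 := fun z =>
      ⟨le_max_left _ _, max_le zero_le_one (min_le_left _ _)⟩
    set g₁ : ℂ → ℂ := fun z => g z + ψ z * (a * (z - w) - g z) with hg₁
    have hfar : ∀ z, ρ / 2 ≤ dist z w → g₁ z = g z := fun z hzw => by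
      simp [hg₁, hψ0 z hzw]
    have hfar' : ∀ v, ρ / 2 < dist v w → g₁ =ᶠ[𝓝 v] g := fun v hv => by
      have : ∀ᶠ z in 𝓝 v, ρ / 2 < dist z w :=
        (continuous_id.dist continuous_const).continuousAt.eventually (lt_mem_nhds hv)
      filter_upwards [this] with z hz using hfar z hz.le
    have hSfar : ∀ v ∈ S, v ≠ w → ρ / 2 < dist v w := fun v hv hvw => by
      by_contra hcon
      exact (hball (y := v) (by linarith)).1.2 (Finset.mem_erase.2 ⟨hvw, hv⟩)
    refine ⟨g₁, ?_, fun z hzd => ?_, fun z hz1 => ?_, fun v hv => ?_, fun v hv hvT => ?_⟩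
    · simp only [hg₁]
      exact hg.add ((Complex.continuous_ofReal.comp hψc).continuousOn.mul
        (ContinuousOn.sub (by fun_prop) hg))
    · rcases le_or_gt (ρ / 2) (dist z w) with h | h
      · rw [hfar z h, hg0 z hzd]
      · obtain ⟨⟨h1, h2⟩, -⟩ := hball (y := z) (by linarith)
        -- Interpolation between `g` and `a * (z - w)` keeps the error within `q * ‖z - w‖`, so no
        -- new zero appears.
        have key : (‖a‖ - q) * ‖z - w‖ ≤ ‖g₁ z‖ := by
          have e : g₁ z = a * (z - w) + ((1 - ψ z : ℝ) : ℂ) * (g z - a * (z - w)) := by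
            simp only [hg₁]; push_cast; ring
          have h3 : ‖((1 - ψ z : ℝ) : ℂ) * (g z - a * (z - w))‖ ≤ q * ‖z - w‖ := by
            rw [norm_mul, Complex.norm_real, Real.norm_of_nonneg (by linarith [(hψI z).2])]
            calc (1 - ψ z) * ‖g z - a * (z - w)‖ ≤ 1 * ‖g z - a * (z - w)‖ := by
                  gcongr; linarith [(hψI z).1]
              _ ≤ _ := by rw [one_mul]; exact h1
          have h4 := norm_sub_le (g₁ z) (((1 - ψ z : ℝ) : ℂ) * (g z - a * (z - w)))
          rw [show g₁ z - ((1 - ψ z : ℝ) : ℂ) * (g z - a * (z - w)) = a * (z - w) by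
            rw [e]; ring, norm_mul] at h4
          nlinarith
        constructor
        · intro hgz
          rw [hgz, norm_zero] at key
          have : ‖z - w‖ ≤ 0 := by
            by_contra hcon
            nlinarith
          have : z = w := by
            rw [← sub_eq_zero]; exact norm_le_zero_iff.1 this
          rwa [this]
        · intro hzS
          have hzw : z = w := by
            by_contra hne
            exact h2 (Finset.mem_erase.2 ⟨hne, hzS⟩)
          have : g w = 0 := (hg0 w (ball_subset_disk hw)).2 hwS
          simp [hg₁, hzw, this]
    · rw [hfar z, hgf z hz1]
      by_contra hcon
      have := (hball (y := z) (by linarith)).2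
      have h1 : ‖z‖ < 1 := by simpa using this
      linarith
    · rcases Finset.mem_insert.1 hv with rfl | hvT
      · refine ⟨fun _ => a, continuousAt_const, ha, ?_⟩
        filter_upwards [Metric.closedBall_mem_nhds v (show 0 < ρ / 4 by linarith)] with z hz
        simp [hg₁, hψ1 z hz]
      · obtain ⟨k, hk, hk0, hkg⟩ := hgT v hvT
        refine ⟨k, hk, hk0, ?_⟩
        have := hfar' v (hSfar v (hTS (Finset.mem_insert_of_mem hvT)) fun h => hwT (h ▸ hvT))
        filter_upwards [this, hkg] with z h1 h2
        rw [h1, h2]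
    · rw [Finset.mem_insert, not_or] at hvT
      obtain ⟨b, r, hrb, hbg⟩ := hgS v hv hvT.2
      refine ⟨b, r, hrb, ?_⟩
      filter_upwards [hfar' v (hSfar v hv hvT.1), hbg] with z h1 h2
      rwa [h1]

theorem logVar_circ_sub {w : ℂ} (hw : w ∈ Metric.ball (0 : ℂ) 1) :
    NonvanishingOn (fun t => circ t - w) 0 1 ∧
      logVar (fun t => circ t - w) 0 1 = 2 * Real.pi * Complex.I := by
  have hw1 : ‖w‖ < 1 := by simpa using hw
  refine ⟨⟨by fun_prop, fun t _ h => ?_⟩, ?_⟩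
  · rw [← sub_eq_zero.1 h, norm_circ] at hw1
    exact lt_irrefl _ hw1
  · rw [← logVar_const_mul_circ one_ne_zero]
    refine logVar_eq_of_norm_sub_lt zero_le_one (by fun_prop) (by fun_prop) ?_ ?_ fun t _ => ?_
    · rw [circ_one, circ_zero]
    · rw [circ_one, circ_zero]
    · simpa [norm_circ] using hw1

theorem logVar_prod_circ_sub (S : Finset ℂ) (hS : ∀ w ∈ S, w ∈ Metric.ball (0 : ℂ) 1) :
    NonvanishingOn (fun t => ∏ w ∈ S, (circ t - w)) 0 1 ∧
      logVar (fun t => ∏ w ∈ S, (circ t - w)) 0 1 = 2 * Real.pi * Complex.I * S.card := by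
  classical
  induction S using Finset.induction_on with
  | empty =>
    refine ⟨⟨by simpa using continuousOn_const, by simp⟩, ?_⟩
    simpa using logVar_of_const (f := fun _ => (1 : ℂ)) zero_le_one one_ne_zero fun _ _ => rfl
  | insert w S hw ih =>
    obtain ⟨h1, h2⟩ := ih fun v hv => hS v (Finset.mem_insert_of_mem hv)
    obtain ⟨h3, h4⟩ := logVar_circ_sub (hS w (Finset.mem_insert_self _ _))
    simp only [Finset.prod_insert hw]
    refine ⟨h3.mul h1, ?_⟩
    rw [logVar_mul zero_le_one h3 h1, h2, h4, Finset.card_insert_of_notMem hw]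
    push_cast
    ring

/-- The number of preimages of a point under a map of the disk. -/
def fibreCount (F : ℂ → ℂ) (x : ℂ) : ℕ := {z ∈ disk | F z = x}.ncard

theorem finite_fibre {F : ℂ → ℂ} (h : ∀ z ∈ disk, ∃ U ∈ 𝓝[disk] z, InjOn F U) (x : ℂ) :
    {z ∈ disk | F z = x}.Finite := by
  obtain ⟨m, hm⟩ := exists_encard_fibre_le h
  exact Set.finite_of_encard_le_coe (hm x)

/-- Argument principle for positive disks. -/
theorem IsPositiveDisk.logVar_sub {F : ℂ → ℂ} (hF : IsPositiveDisk F) {x : ℂ}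
    (hx : ∀ t, F (circ t) ≠ x) :
    logVar (fun t => F (circ t) - x) 0 1 = 2 * Real.pi * Complex.I * fibreCount F x := by
  have hfin := finite_fibre hF.locallyInjective x
  set S := hfin.toFinset with hSdef
  have hmemS : ∀ z, z ∈ S ↔ z ∈ disk ∧ F z = x := fun z => by simp [hSdef]
  have hS : ∀ w ∈ S, w ∈ Metric.ball (0 : ℂ) 1 := by
    intro w hw
    obtain ⟨h1, h2⟩ := (hmemS w).1 hw
    have h1' : ‖w‖ ≤ 1 := by simpa [disk] using h1
    rcases h1'.lt_or_eq with h | h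
    · simpa using h
    · obtain ⟨t, -, rfl⟩ := exists_circ_eq h
      exact absurd h2 (hx t)
  have hcont : ContinuousOn (fun z => F z - x) disk := hF.continuousOn.sub continuousOn_const
  have h0 : ∀ z ∈ disk, F z - x = 0 ↔ z ∈ S := fun z hz => by
    rw [sub_eq_zero, hmemS]; simp [hz]
  have hpos : ∀ w ∈ S, HasPositiveZero (fun z => F z - x) w := by
    intro w hw
    obtain ⟨M, hM, hlt⟩ := hF.deriv w (hS w hw)
    obtain ⟨c, hc0, hc⟩ : ∃ c > 0, ‖antiPart M‖ + c < ‖holPart M‖ :=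
      ⟨(‖holPart M‖ - ‖antiPart M‖) / 2, by linarith, by linarith⟩
    refine ⟨holPart M, ‖antiPart M‖ + c, hc, ?_⟩
    have happ := hM.hasFDerivAt.isLittleO.def hc0
    filter_upwards [happ] with z hz
    rw [← ((hmemS w).1 hw).2]
    rw [apply_eq_holPart_add] at hz
    calc ‖F z - F w - holPart M * (z - w)‖
        = ‖(F z - F w - (holPart M * (z - w) + antiPart M * (starRingEnd ℂ) (z - w))) +
            antiPart M * (starRingEnd ℂ) (z - w)‖ := by congr 1; ring
      _ ≤ c * ‖z - w‖ + ‖antiPart M‖ * ‖z - w‖ := by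
          refine (norm_add_le _ _).trans (add_le_add hz ?_)
          rw [norm_mul, RCLike.norm_conj]
      _ = _ := by ring
  -- Every preimage is a positive zero of `F - x`. After these zeros are made simple and divided
  -- out, each linear factor contributes one turn along the circle.
  obtain ⟨f, hf, hf0, hfF, hfS, -⟩ := exists_hasSimpleZero S hcont hS h0 hpos S subset_rfl
  obtain ⟨g, hg, hg0, hgf⟩ := exists_eq_mul_prod S f hf hS hf0 hfS
  obtain ⟨hp1, hp2⟩ := logVar_prod_circ_sub S hS
  have hgc : NonvanishingOn (fun t => g (circ t)) 0 1 :=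
    ⟨hg.comp (by fun_prop) fun t _ => circ_mem_disk t, fun t _ => hg0 _ (circ_mem_disk t)⟩
  -- The remaining factor has no zero, hence has a logarithm on the whole disk and does not wind.
  have hg2 : logVar (fun t => g (circ t)) 0 1 = 0 := by
    obtain ⟨L, hLc, hL⟩ := exists_continuousOn_log (convex_closedBall (0 : ℂ) 1)
      ⟨0, by simp⟩ hg hg0
    rw [IsLogLift.logVar_eq zero_le_one (L := fun t => L (circ t))]
    · rw [circ_one, circ_zero, sub_self]
    · exact ⟨hLc.comp (by fun_prop) fun t _ => circ_mem_disk t,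
        fun t _ => hL _ (circ_mem_disk t)⟩
  have := logVar_mul zero_le_one hgc hp1
  rw [hg2, hp2, zero_add] at this
  rw [fibreCount, Set.ncard_eq_toFinset_card _ hfin, ← hSdef, ← this]
  refine logVar_congr zero_le_one (hgc.mul hp1) fun t _ => ?_
  rw [← hgf _ (circ_mem_disk t), hfF _ (norm_circ t)]

/-! ### Sign and image of an immersed disk -/

theorem fibreCount_conjMap (F : ℂ → ℂ) (x : ℂ) :
    fibreCount (conjMap F) ((starRingEnd ℂ) x) = fibreCount F x := by
  unfold fibreCount conjMap
  congr 1
  ext z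
  simp [(starRingEnd ℂ).injective.eq_iff]

theorem IsImmersedDisk.comp_circ {F : ℂ → ℂ} {C : ℝ → ℂ} (h : IsImmersedDisk F C) :
    F ∘ circ = C := funext h.boundary

theorem IsImmersedDisk.continuous {F : ℂ → ℂ} {C : ℝ → ℂ} (h : IsImmersedDisk F C) :
    Continuous C := by
  rw [← h.comp_circ]
  exact h.continuousOn.comp_continuous continuous_circ circ_mem_disk

/-- The sign of the orientation of an immersed disk determines the Whitney index of its boundary,
and relates the numbers of preimages to winding numbers. -/
theorem IsImmersedDisk.exists_sign {F : ℂ → ℂ} {C : ℝ → ℂ} (h : IsImmersedDisk F C) :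
    ∃ ε : ℤ, (ε = 1 ∨ ε = -1) ∧
      (∀ᶠ r in 𝓝[>] (0 : ℝ), NonvanishingOn (chord C r) 0 1 ∧
        logVar (chord C r) 0 1 = 2 * Real.pi * Complex.I * ε) ∧
      ∀ x, x ∉ range C →
        logVar (fun t => C t - x) 0 1 = 2 * Real.pi * Complex.I * (ε * fibreCount F x) := by
  rcases h.isPositiveDisk_or with hF | hF
  · refine ⟨1, Or.inl rfl, ?_, fun x hx => ?_⟩
    · have := hF.logVar_chord
      rw [h.comp_circ] at this
      simpa using this
    · have := hF.logVar_sub (x := x) fun t ht => hx ⟨t, by rw [← h.boundary, ht]⟩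
      simp only [h.boundary] at this
      simp [this]
  · have hconj : conjMap F ∘ circ = fun t => (starRingEnd ℂ) (C t) := by
      funext t; simp [conjMap, h.boundary]
    refine ⟨-1, Or.inr rfl, ?_, fun x hx => ?_⟩
    · have := hF.logVar_chord
      rw [hconj] at this
      filter_upwards [this] with r hr
      have e : chord C r =
          fun t => (starRingEnd ℂ) (chord (fun t => (starRingEnd ℂ) (C t)) r t) := by
        funext t; simp [chord]
      rw [e]
      refine ⟨hr.1.conj, ?_⟩
      rw [logVar_conj zero_le_one hr.1, hr.2]
      simp [Complex.conj_ofNat]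
    · have h1 := hF.logVar_sub (x := (starRingEnd ℂ) x) fun t ht => hx ⟨t, by
        rw [← h.boundary]; exact (starRingEnd ℂ).injective ht⟩
      rw [fibreCount_conjMap] at h1
      have h2 : (fun t => C t - x) =
          fun t => (starRingEnd ℂ) (conjMap F (circ t) - (starRingEnd ℂ) x) := by
        funext t; simp [conjMap, h.boundary]
      rw [h2, logVar_conj zero_le_one, h1]
      · simp [Complex.conj_ofNat]
      · refine ⟨(Continuous.sub ?_ continuous_const).continuousOn, fun t _ h0 => ?_⟩
        · exact hF.continuousOn.comp_continuous continuous_circ circ_mem_disk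
        · rw [sub_eq_zero] at h0
          exact hx ⟨t, by rw [← h.boundary]; exact (starRingEnd ℂ).injective h0⟩

/-- The derivative at the centre is surjective, so the image of the disk is a neighbourhood of `F
0`. This is the set of positive area that makes the final comparison strict. -/
theorem IsImmersedDisk.exists_isOpen {F : ℂ → ℂ} {C : ℝ → ℂ} (h : IsImmersedDisk F C) :
    ∃ U : Set ℂ, IsOpen U ∧ U.Nonempty ∧ ∀ x ∈ U, 1 ≤ fibreCount F x := by
  have h0 : (0 : ℂ) ∈ Metric.ball (0 : ℂ) 1 := by simp
  obtain ⟨h1, h2⟩ := h.contDiffAt h0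
  have hs : HasStrictFDerivAt F (fderiv ℝ F 0) 0 := h1.hasStrictFDerivAt one_ne_zero
  have hsurj : (fderiv ℝ F 0).range = ⊤ :=
    LinearMap.range_eq_top.2 (LinearMap.injective_iff_surjective.1 h2)
  have himg : F '' disk ∈ 𝓝 (F 0) := by
    rw [← hs.map_nhds_eq_of_surj hsurj]
    exact image_mem_map (disk_mem_nhds h0)
  refine ⟨interior (F '' disk), isOpen_interior, ⟨F 0, mem_interior_iff_mem_nhds.2 himg⟩,
    fun x hx => ?_⟩
  obtain ⟨z, hz, rfl⟩ := interior_subset hx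
  exact (Set.ncard_pos (finite_fibre h.locallyInjective _)).2 ⟨z, hz, rfl⟩

/-! ### Closed subcurves -/

namespace ClosedSubcurve

variable {C : ℝ → ℂ} (γ : ClosedSubcurve C)

/-- The length of the part of the interval `[s,t]` that lies in the gap `g`. -/
def overlap (g : ℝ × ℝ) (s t : ℝ) : ℝ := (min t g.2 - min t g.1) - (min s g.2 - min s g.1)

/-- As a measure the overlap is additive over disjoint gaps, so the gaps together take up at most `t
- s`. This is why `progress` is monotone. -/
theorem overlap_eq_volume {g : ℝ × ℝ} (hg : g.1 < g.2) {s t : ℝ} (hst : s ≤ t) :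
    overlap g s t = volume.real (Ioc s t ∩ Ioc g.1 g.2) := by
  rw [Ioc_inter_Ioc, Real.volume_real_Ioc, overlap]
  rcases le_total s g.1 with h1 | h1 <;> rcases le_total s g.2 with h2 | h2 <;>
    rcases le_total t g.1 with h3 | h3 <;> rcases le_total t g.2 with h4 | h4 <;>
    simp only [min_eq_left, min_eq_right, max_eq_left, max_eq_right, h1, h2, h3, h4] <;>
    first
      | (rw [max_eq_left (by linarith)]; linarith)
      | (rw [max_eq_right (by linarith)]; linarith)

theorem sum_overlap_le {s t : ℝ} (hst : s ≤ t) : ∑ g ∈ γ.gaps, overlap g s t ≤ t - s := by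
  have h1 : ∑ g ∈ γ.gaps, overlap g s t =
      ∑ g ∈ γ.gaps, volume.real (Ioc s t ∩ Ioc g.1 g.2) :=
    Finset.sum_congr rfl fun g hg => overlap_eq_volume (γ.gaps_mem g hg).2.1 hst
  have h2 : volume.real (⋃ g ∈ γ.gaps, Ioc s t ∩ Ioc g.1 g.2) =
      ∑ g ∈ γ.gaps, volume.real (Ioc s t ∩ Ioc g.1 g.2) := by
    refine measureReal_biUnion_finset (fun g hg g' hg' hne => ?_)
      (fun g _ => measurableSet_Ioc.inter measurableSet_Ioc) (fun g _ => ?_)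
    · exact (γ.gaps_disjoint g hg g' hg' hne).mono
        (inter_subset_right.trans Ioc_subset_Icc_self)
        (inter_subset_right.trans Ioc_subset_Icc_self)
    · exact ((measure_mono inter_subset_left).trans_lt measure_Ioc_lt_top).ne
  rw [h1, ← h2]
  calc volume.real (⋃ g ∈ γ.gaps, Ioc s t ∩ Ioc g.1 g.2) ≤ volume.real (Ioc s t) :=
        measureReal_mono (iUnion₂_subset fun _ _ => inter_subset_left) measure_Ioc_lt_top.ne
    _ = t - s := by rw [Real.volume_real_Ioc, max_eq_left (by linarith)]

theorem overlap_eq_zero {g : ℝ × ℝ} (hg : g.1 < g.2) {s t : ℝ} (hst : s ≤ t)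
    (h : t ≤ g.1 ∨ g.2 ≤ s) : overlap g s t = 0 := by
  rcases h with h | h
  · rw [overlap, min_eq_left h, min_eq_left (by linarith), min_eq_left (by linarith),
      min_eq_left (by linarith)]
    ring
  · rw [overlap, min_eq_right h, min_eq_right (by linarith), min_eq_right (by linarith),
      min_eq_right (by linarith)]
    ring

theorem exists_initial : ∃ u ∈ Ioo γ.left γ.right, ∀ g ∈ γ.gaps, u ≤ g.1 := by
  have h : ∀ᶠ u in 𝓝[>] γ.left, ∀ g ∈ γ.gaps, u ≤ g.1 := by
    rw [Filter.eventually_all_finset]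
    intro g hg
    filter_upwards [Ioo_mem_nhdsGT (γ.gaps_mem g hg).1] with u hu using hu.2.le
  obtain ⟨u, h1, h2⟩ := (h.and (Ioo_mem_nhdsGT γ.left_lt_right)).exists
  exact ⟨u, h2, h1⟩

/-- A nontrivial initial stretch precedes all gaps, and the gaps fit into the rest of the interval.
-/
theorem length_pos : 0 < γ.length := by
  obtain ⟨u, hu, hug⟩ := γ.exists_initial
  have h1 := γ.sum_overlap_le hu.2.le
  have h2 : ∑ g ∈ γ.gaps, overlap g u γ.right = ∑ g ∈ γ.gaps, (g.2 - g.1) :=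
    Finset.sum_congr rfl fun g hg => by
      obtain ⟨h3, h4, h5⟩ := γ.gaps_mem g hg
      rw [overlap, min_eq_right h5.le, min_eq_right (h4.le.trans h5.le), min_eq_left (hug g hg),
        min_eq_left ((hug g hg).trans h4.le)]
      ring
  rw [h2] at h1
  rw [length]
  linarith [hu.1]

theorem progress_sub (s t : ℝ) :
    γ.progress t - γ.progress s = (t - s - ∑ g ∈ γ.gaps, overlap g s t) / γ.length := by
  rw [progress, progress, ← sub_div]
  congr 1
  simp only [overlap, Finset.sum_sub_distrib]
  ring

theorem monotone_progress : Monotone γ.progress := fun s t hst => by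
  rw [← sub_nonneg, progress_sub]
  exact div_nonneg (by linarith [γ.sum_overlap_le hst]) γ.length_pos.le

@[fun_prop]
theorem continuous_progress : Continuous γ.progress := by unfold progress; fun_prop

theorem progress_left : γ.progress γ.left = 0 := by
  rw [progress, sub_self, Finset.sum_eq_zero]
  · simp
  · intro g hg
    obtain ⟨h3, h4, h5⟩ := γ.gaps_mem g hg
    rw [min_eq_left h3.le, min_eq_left (h3.le.trans h4.le), sub_self]

theorem progress_right : γ.progress γ.right = 1 := by
  rw [progress, div_eq_one_iff_eq γ.length_pos.ne', length]
  congr 1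
  refine Finset.sum_congr rfl fun g hg => ?_
  obtain ⟨h3, h4, h5⟩ := γ.gaps_mem g hg
  rw [min_eq_right h5.le, min_eq_right (h4.le.trans h5.le)]

theorem progress_sub_of_forall {s t : ℝ} (hst : s ≤ t)
    (h : ∀ g ∈ γ.gaps, t ≤ g.1 ∨ g.2 ≤ s) :
    γ.progress t - γ.progress s = (t - s) / γ.length := by
  rw [progress_sub, Finset.sum_eq_zero, sub_zero]
  exact fun g hg => overlap_eq_zero (γ.gaps_mem g hg).2.1 hst (h g hg)

theorem progress_of_mem_gap {g : ℝ × ℝ} (hg : g ∈ γ.gaps) {t : ℝ} (ht : t ∈ Icc g.1 g.2) :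
    γ.progress t = γ.progress g.1 := by
  have h := (γ.gaps_mem g hg).2.1
  refine le_antisymm ?_ (γ.monotone_progress ht.1)
  rw [← sub_nonpos, progress_sub]
  refine div_nonpos_of_nonpos_of_nonneg ?_ γ.length_pos.le
  have h1 : overlap g g.1 t = t - g.1 := by
    rw [overlap, min_eq_left ht.2, min_eq_right ht.1, min_eq_left h.le, min_self]; ring
  have h2 : overlap g g.1 t ≤ ∑ g' ∈ γ.gaps, overlap g' g.1 t := by
    refine Finset.single_le_sum (f := fun g' => overlap g' g.1 t) (fun g' hg' => ?_) hg
    show 0 ≤ overlap g' g.1 t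
    rw [overlap_eq_volume (γ.gaps_mem g' hg').2.1 ht.1]
    exact measureReal_nonneg
  linarith

theorem left_mem_support : γ.left ∈ γ.support := by
  refine ⟨left_mem_Icc.2 γ.left_lt_right.le, ?_⟩
  simp only [mem_iUnion, not_exists]
  exact fun g hg h => (lt_asymm h.1 (γ.gaps_mem g hg).1)

theorem mem_support_iff {t : ℝ} :
    t ∈ γ.support ↔ t ∈ Icc γ.left γ.right ∧ ∀ g ∈ γ.gaps, t ≤ g.1 ∨ g.2 ≤ t := by
  rw [support, Set.mem_sdiff]
  simp only [mem_iUnion, not_exists, mem_Ioo, not_and, not_lt]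
  refine and_congr_right fun _ => forall₂_congr fun g hg => ?_
  rw [or_iff_not_imp_left, not_le]

theorem fst_mem_support {g : ℝ × ℝ} (hg : g ∈ γ.gaps) : g.1 ∈ γ.support := by
  obtain ⟨h3, h4, h5⟩ := γ.gaps_mem g hg
  refine γ.mem_support_iff.2 ⟨⟨h3.le, (h4.trans h5).le⟩, fun g' hg' => ?_⟩
  by_contra! hcon
  have hne : g ≠ g' := by rintro rfl; exact lt_irrefl _ hcon.1
  exact disjoint_left.1 (γ.gaps_disjoint g hg g' hg' hne) (left_mem_Icc.2 h4.le)
    ⟨hcon.1.le, hcon.2.le⟩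

theorem snd_ne_fst {g g' : ℝ × ℝ} (hg : g ∈ γ.gaps) (hg' : g' ∈ γ.gaps) : g.2 ≠ g'.1 := by
  intro h
  have h4 := (γ.gaps_mem g hg).2.1
  have h4' := (γ.gaps_mem g' hg').2.1
  have hne : g ≠ g' := by
    rintro rfl
    exact absurd h h4.ne'
  exact disjoint_left.1 (γ.gaps_disjoint g hg g' hg' hne) (right_mem_Icc.2 h4.le)
    ⟨h.ge, by rw [h]; exact h4'.le⟩

/-- Progress increases strictly up to a parameter of the support that is not the end of a gap. -/
theorem progress_lt_of_lt {s t : ℝ} (hst : s < t) (ht : t ∈ γ.support)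
    (hgap : ∀ g ∈ γ.gaps, g.2 ≠ t) : γ.progress s < γ.progress t := by
  have h : ∀ᶠ u in 𝓝[<] t, ∀ g ∈ γ.gaps, t ≤ g.1 ∨ g.2 ≤ u := by
    rw [Filter.eventually_all_finset]
    intro g hg
    rcases (γ.mem_support_iff.1 ht).2 g hg with h | h
    · exact Eventually.of_forall fun u => Or.inl h
    · filter_upwards [Ioo_mem_nhdsLT (lt_of_le_of_ne h (hgap g hg))] with u hu using Or.inr hu.1.le
  obtain ⟨u, h1, h2⟩ := (h.and (Ioo_mem_nhdsLT hst)).exists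
  have h3 := γ.progress_sub_of_forall h2.2.le h1
  have h4 : 0 < (t - u) / γ.length := div_pos (by linarith [h2.2]) γ.length_pos
  linarith [γ.monotone_progress h2.1.le]

theorem right_mem_support : γ.right ∈ γ.support :=
  γ.mem_support_iff.2 ⟨right_mem_Icc.2 γ.left_lt_right.le,
    fun g hg => Or.inr (γ.gaps_mem g hg).2.2.le⟩

theorem progress_lt_one {t : ℝ} (ht : t < γ.right) : γ.progress t < 1 := by
  rw [← γ.progress_right]
  exact γ.progress_lt_of_lt ht γ.right_mem_support fun g hg => (γ.gaps_mem g hg).2.2.ne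

theorem progress_pos {t : ℝ} (ht : γ.left < t) : 0 < γ.progress t := by
  obtain ⟨u, hu, hug⟩ := γ.exists_initial
  have h : 0 < γ.progress (min u t) - γ.progress γ.left := by
    rw [γ.progress_sub_of_forall (le_min hu.1.le ht.le)
      fun g hg => Or.inl ((min_le_left _ _).trans (hug g hg))]
    exact div_pos (by linarith [lt_min hu.1 ht]) γ.length_pos
  rw [γ.progress_left, sub_zero] at h
  exact h.trans_le (γ.monotone_progress (min_le_right _ _))

theorem progress_mem_Icc {t : ℝ} (ht : t ∈ Icc γ.left γ.right) : γ.progress t ∈ Icc (0 : ℝ) 1 :=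
  ⟨by rw [← γ.progress_left]; exact γ.monotone_progress ht.1,
    by rw [← γ.progress_right]; exact γ.monotone_progress ht.2⟩

/-- Progress is strictly smaller before `t`, so the infimum in `time` is `t` itself. The excluded
parameters are those that `curve` replaces by others: `time` sends the end of a gap to its
beginning, and `Int.fract` sends `1` to `0`. -/
theorem curve_progress_aux {t : ℝ} (ht : t ∈ γ.support) (htr : t < γ.right)
    (hgap : ∀ g ∈ γ.gaps, g.2 ≠ t) : γ.curve (γ.progress t) = C t := by
  have htI := (γ.mem_support_iff.1 ht).1
  have hleast : IsLeast {s | s ∈ Icc γ.left γ.right ∧ γ.progress t ≤ γ.progress s} t :=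
    ⟨⟨htI, le_rfl⟩, fun s hs => by
      by_contra! hcon
      exact absurd hs.2 (not_le.2 (γ.progress_lt_of_lt hcon ht hgap))⟩
  rw [curve, Int.fract_eq_self.2 ⟨(γ.progress_mem_Icc htI).1, γ.progress_lt_one htr⟩, time,
    hleast.csInf_eq]

/-- The curve `γ`, as a function of the parameter of `C`. -/
theorem curve_progress {t : ℝ} (ht : t ∈ γ.support) : γ.curve (γ.progress t) = C t := by
  rcases (γ.mem_support_iff.1 ht).1.2.lt_or_eq with h | h
  · by_cases hg : ∃ g ∈ γ.gaps, g.2 = t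
    -- At the end of a gap the curve is evaluated at its beginning, where `C` has the same value.
    · obtain ⟨g, hg, rfl⟩ := hg
      have h4 := γ.gaps_mem g hg
      rw [γ.progress_of_mem_gap hg (right_mem_Icc.2 h4.2.1.le),
        γ.curve_progress_aux (γ.fst_mem_support hg) (h4.2.1.trans h4.2.2)
          fun g' hg' => γ.snd_ne_fst hg' hg, γ.gaps_closed g hg]
    · push Not at hg
      exact γ.curve_progress_aux ht h hg
  -- At `right` the progress is `1`, whose fractional part is `0`, so the value is the one at
  -- `left`.
  · have h0 := γ.curve_progress_aux γ.left_mem_support γ.left_lt_right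
      fun g hg => ((γ.gaps_mem g hg).1.trans (γ.gaps_mem g hg).2.1).ne'
    rw [γ.progress_left] at h0
    rw [h, γ.progress_right, ← γ.closed, ← h0]
    simp [curve]

theorem curve_progress_of_mem_gap {g : ℝ × ℝ} (hg : g ∈ γ.gaps) {t : ℝ} (ht : t ∈ Icc g.1 g.2) :
    γ.curve (γ.progress t) = C g.1 := by
  rw [γ.progress_of_mem_gap hg ht, γ.curve_progress (γ.fst_mem_support hg)]

theorem curve_periodic (x : ℝ) (n : ℤ) : γ.curve (x + n) = γ.curve x := by
  rw [curve, curve, Int.fract_add_intCast]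

theorem curve_zero : γ.curve 0 = γ.root := by
  rw [← γ.progress_left, γ.curve_progress γ.left_mem_support, root]

/-- Every point of the curve is on the trace. -/
theorem exists_support_or_gap {t : ℝ} (ht : t ∈ Icc γ.left γ.right) :
    t ∈ γ.support ∨ ∃ g ∈ γ.gaps, t ∈ Ioo g.1 g.2 := by
  by_cases h : t ∈ γ.support
  · exact Or.inl h
  · right
    rw [support, Set.mem_sdiff, not_and, not_not] at h
    obtain ⟨g, hg, h⟩ := mem_iUnion₂.1 (h ht)
    exact ⟨g, hg, h⟩

/-- `progress`, made constant before `left` and after `right`. -/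
def clampProgress (t : ℝ) : ℝ := γ.progress (max γ.left (min γ.right t))

@[fun_prop]
theorem continuous_clampProgress : Continuous γ.clampProgress := by
  unfold clampProgress; fun_prop

theorem clampProgress_of_mem {t : ℝ} (ht : t ∈ Icc γ.left γ.right) :
    γ.clampProgress t = γ.progress t := by
  rw [clampProgress, min_eq_right ht.2, max_eq_right ht.1]

theorem clampProgress_mem (t : ℝ) : γ.clampProgress t ∈ Icc (0 : ℝ) 1 :=
  γ.progress_mem_Icc ⟨le_max_left _ _, max_le γ.left_lt_right.le (min_le_left _ _)⟩

theorem clampProgress_of_le {t : ℝ} (ht : t ≤ γ.left) : γ.clampProgress t = 0 := by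
  rw [clampProgress, min_eq_right (ht.trans γ.left_lt_right.le), max_eq_left ht, γ.progress_left]

theorem clampProgress_of_ge {t : ℝ} (ht : γ.right ≤ t) : γ.clampProgress t = 1 := by
  rw [clampProgress, min_eq_left ht, max_eq_right γ.left_lt_right.le, γ.progress_right]

theorem exists_curve_eq (x : ℝ) : ∃ t ∈ γ.support, γ.curve x = C t := by
  obtain ⟨t, ht, hx⟩ : ∃ t ∈ Icc γ.left γ.right, γ.progress t = Int.fract x := by
    have := intermediate_value_Icc γ.left_lt_right.le γ.continuous_progress.continuousOn
    rw [γ.progress_left, γ.progress_right] at this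
    exact this ⟨Int.fract_nonneg _, (Int.fract_lt_one _).le⟩
  have hc : γ.curve x = γ.curve (γ.progress t) := by
    rw [hx]; simp [curve]
  rw [hc]
  rcases γ.exists_support_or_gap ht with h | ⟨g, hg, h⟩
  · exact ⟨t, h, γ.curve_progress h⟩
  · exact ⟨g.1, γ.fst_mem_support hg, γ.curve_progress_of_mem_gap hg (Ioo_subset_Icc_self h)⟩

end ClosedSubcurve

/-! ### Systems of pieces -/

/-- The combinatorics of a decomposition: the parameter interval is divided into `N` edges, each
piece `i` runs from the vertex `lft i` to the vertex `rgt i` and omits the gaps, the end points of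
pieces and gaps are matched by `pr`, and every edge belongs to exactly one piece. -/
structure PieceSystem (ι : Type*) (N : ℕ) where
  lft : ι → ℕ
  rgt : ι → ℕ
  gap : ι → ℕ → ℕ → Prop
  pr : ℕ → ℕ → Prop
  own : ℕ → ι
  lft_lt : ∀ i, lft i < rgt i
  rgt_le : ∀ i, rgt i ≤ N
  gap_mem : ∀ {i c d}, gap i c d → lft i < c ∧ c < d ∧ d < rgt i
  gap_disj : ∀ {i c d c' d'}, gap i c d → gap i c' d' → (c = c' ∧ d = d') ∨ d < c' ∨ d' < c
  pr_ends : ∀ i, pr (lft i) (rgt i)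
  pr_gap : ∀ {i c d}, gap i c d → pr c d
  pr_right : ∀ {c d d'}, pr c d → pr c d' → d = d'
  pr_left : ∀ {c c' d}, pr c d → pr c' d → c = c'
  pr_chain : ∀ {c d e}, pr c d → ¬ pr d e
  own_iff : ∀ {i k}, k < N →
    (own k = i ↔ lft i ≤ k ∧ k < rgt i ∧ ∀ c d, gap i c d → k < c ∨ d ≤ k)

namespace PieceSystem

variable {ι : Type*} {N : ℕ} (S : PieceSystem ι N)

theorem own_spec {k : ℕ} (hk : k < N) : S.lft (S.own k) ≤ k ∧ k < S.rgt (S.own k) ∧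
    ∀ c d, S.gap (S.own k) c d → k < c ∨ d ≤ k := (S.own_iff hk).1 rfl

theorem own_lft (i : ι) : S.own (S.lft i) = i := by
  have h1 := S.lft_lt i
  have h2 := S.rgt_le i
  refine (S.own_iff (by omega)).2 ⟨le_rfl, h1, fun c d h => ?_⟩
  have := S.gap_mem h
  omega

theorem own_of_rgt {i : ι} {k : ℕ} (h : S.rgt i = k + 1) : S.own k = i := by
  have h1 := S.lft_lt i
  have h2 := S.rgt_le i
  refine (S.own_iff (by omega)).2 ⟨by omega, by omega, fun c d h => ?_⟩
  have := S.gap_mem h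
  omega

theorem own_of_gap_left {i : ι} {k d : ℕ} (h : S.gap i (k + 1) d) : S.own k = i := by
  have h1 := S.gap_mem h
  have h2 := S.rgt_le i
  refine (S.own_iff (by omega)).2 ⟨by omega, by omega, fun c' d' h' => ?_⟩
  have := S.gap_disj h h'
  have := S.gap_mem h'
  omega

theorem own_of_gap_right {i : ι} {c d : ℕ} (h : S.gap i c d) : S.own d = i := by
  have h1 := S.gap_mem h
  have h2 := S.rgt_le i
  refine (S.own_iff (by omega)).2 ⟨by omega, by omega, fun c' d' h' => ?_⟩
  have := S.gap_disj h h'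
  have := S.gap_mem h'
  omega

/-- At a vertex where the piece changes, one of the two pieces lies in a gap of the other. -/
theorem own_step {k : ℕ} (hk : k + 1 < N) (hne : S.own k ≠ S.own (k + 1)) :
    S.gap (S.own k) (k + 1) (S.rgt (S.own (k + 1))) ∧ S.lft (S.own (k + 1)) = k + 1 ∨
    S.gap (S.own (k + 1)) (S.lft (S.own k)) (k + 1) ∧ S.rgt (S.own k) = k + 1 := by
  have hA := S.own_spec (k := k) (by omega)
  have hB := S.own_spec hk
  -- A piece that owns edge `k` but not edge `k + 1` ends at the vertex in between or enters a gap
  -- there; dually for the owner of edge `k + 1`.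
  have hA' : S.rgt (S.own k) = k + 1 ∨ ∃ d, S.gap (S.own k) (k + 1) d := by
    by_contra! hcon
    refine hne ((S.own_iff hk).2 ⟨by omega, by omega, fun c d h => ?_⟩).symm
    have h1 := hA.2.2 c d h
    have : c ≠ k + 1 := by rintro rfl; exact hcon.2 d h
    omega
  have hB' : S.lft (S.own (k + 1)) = k + 1 ∨ ∃ c, S.gap (S.own (k + 1)) c (k + 1) := by
    by_contra! hcon
    refine hne ((S.own_iff (by omega)).2 ⟨by omega, by omega, fun c d h => ?_⟩)
    have h1 := hB.2.2 c d h
    have : d ≠ k + 1 := by rintro rfl; exact hcon.2 c h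
    omega
  have eA := S.pr_ends (S.own k)
  have eB := S.pr_ends (S.own (k + 1))
  -- A vertex cannot be the later end of one matched pair and the earlier end of another, which
  -- excludes two cases. In the other two, uniqueness of the partner identifies the gap of one piece
  -- with the span of the other.
  rcases hA' with hA' | ⟨d, hd⟩ <;> rcases hB' with hB' | ⟨c, hc⟩
  · rw [hA'] at eA; rw [hB'] at eB
    exact absurd eB (S.pr_chain eA)
  · rw [hA'] at eA
    obtain rfl := S.pr_left eA (S.pr_gap hc)
    exact Or.inr ⟨hc, hA'⟩
  · rw [hB'] at eB
    obtain rfl := S.pr_right eB (S.pr_gap hd)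
    exact Or.inl ⟨hd, hB'⟩
  · exact absurd (S.pr_gap hd) (S.pr_chain (S.pr_gap hc))

/-- The edge with which the piece continues after the edge `k`. -/
theorem exists_next {k : ℕ} (hk : k < N) : ∃ n, n < N ∧ S.own n = S.own k ∧
    (n = k + 1 ∨ S.gap (S.own k) (k + 1) n ∨ k + 1 = S.rgt (S.own k) ∧ n = S.lft (S.own k)) := by
  have hA := S.own_spec hk
  have hN := S.rgt_le (S.own k)
  by_cases h1 : k + 1 = S.rgt (S.own k)
  · exact ⟨_, by omega, S.own_lft _, Or.inr (Or.inr ⟨h1, rfl⟩)⟩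
  by_cases h2 : ∃ d, S.gap (S.own k) (k + 1) d
  · obtain ⟨d, hd⟩ := h2
    have := S.gap_mem hd
    exact ⟨d, by omega, S.own_of_gap_right hd, Or.inr (Or.inl hd)⟩
  · push Not at h2
    refine ⟨k + 1, by omega, (S.own_iff (by omega)).2 ⟨by omega, by omega, fun c d h => ?_⟩,
      Or.inl rfl⟩
    have h3 := hA.2.2 c d h
    have : c ≠ k + 1 := by rintro rfl; exact h2 d h
    omega

theorem next_injective {k k' n : ℕ} (hk : k < N) (hk' : k' < N) (ho : S.own n = S.own k)
    (ho' : S.own n = S.own k')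
    (h : n = k + 1 ∨ S.gap (S.own k) (k + 1) n ∨ k + 1 = S.rgt (S.own k) ∧ n = S.lft (S.own k))
    (h' : n = k' + 1 ∨ S.gap (S.own k') (k' + 1) n ∨
      k' + 1 = S.rgt (S.own k') ∧ n = S.lft (S.own k')) : k = k' := by
  have hA := S.own_spec hk
  have hA' := S.own_spec hk'
  rw [← ho] at h hA
  rw [← ho'] at h' hA'
  rcases h with h | h | h <;> rcases h' with h' | h' | h'
  · omega
  · have := hA.2.2 _ _ h'
    have := S.gap_mem h'
    omega
  · omega
  · have := hA'.2.2 _ _ h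
    have := S.gap_mem h
    omega
  · have := S.gap_mem h
    have := S.gap_mem h'
    have := S.gap_disj h h'
    omega
  · have := S.gap_mem h
    omega
  · omega
  · have := S.gap_mem h'
    omega
  · omega

/-- Following the pieces permutes the edges. -/
theorem exists_next_equiv : ∃ σ : Equiv.Perm (Fin N), ∀ k : Fin N, S.own (σ k) = S.own k ∧
    ((σ k : ℕ) = k + 1 ∨ S.gap (S.own k) (k + 1) (σ k) ∨
      (k : ℕ) + 1 = S.rgt (S.own k) ∧ (σ k : ℕ) = S.lft (S.own k)) := by
  choose n hn ho h using fun k : Fin N => S.exists_next k.2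
  have hinj : Function.Injective fun k => (⟨n k, hn k⟩ : Fin N) := fun k k' e => by
    have e' : n k = n k' := congrArg Fin.val e
    refine Fin.ext (S.next_injective k.2 k'.2 (ho k) (e' ▸ ho k') (h k) ?_)
    rw [e']; exact h k'
  exact ⟨Equiv.ofBijective _ (Finite.injective_iff_bijective.1 hinj), fun k => ⟨ho k, h k⟩⟩

/-- Walking along the edges shows that the pieces over an edge other than its owner are
contracted after the owner, and that at the time when a piece is contracted, its gaps have been
contracted as a whole. -/
theorem walk {rank : ι → ℕ} (hinj : Function.Injective rank)
    (hrank : ∀ {i j c d}, S.gap i c d → S.lft j = c → rank i < rank j) (k : ℕ) (hk : k < N) :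
    (∀ j, S.lft j ≤ k → k < S.rgt j → rank j ≤ rank (S.own k)) ∧
    ∀ i c d, S.gap i c d → c ≤ k → k < d → ∃ m, S.lft m = c ∧ S.rgt m = d ∧ rank i < rank m ∧
      ∀ j, S.lft j ≤ k → k < S.rgt j → rank i < rank j → rank m ≤ rank j := by
  induction k with
  | zero =>
    refine ⟨fun j h1 _ => ?_, fun i c d h h1 _ => ?_⟩
    · have h2 := S.own_lft j
      rw [Nat.le_zero.1 h1] at h2
      rw [h2]
    · have := S.gap_mem h
      omega
  | succ k ih =>
    obtain ⟨hA, hB⟩ := ih (by omega)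
    have sA := S.own_spec (k := k) (by omega)
    have sB := S.own_spec hk
    have hlft : ∀ j, S.lft j = k + 1 → S.own (k + 1) = j := fun j h => h ▸ S.own_lft j
    by_cases hne : S.own k = S.own (k + 1)
    -- Same owner: a piece starting at `k + 1` would own edge `k + 1`, so no piece and no gap starts
    -- here, and both claims carry over.
    · have h1 : ∀ j, S.lft j ≤ k + 1 → k + 1 < S.rgt j → S.lft j ≤ k ∧ k < S.rgt j := by
        intro j hj hj'
        refine ⟨?_, by omega⟩
        by_contra hcon
        have := hlft j (by omega)
        rw [← hne] at this
        rw [this] at sA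
        omega
      rw [← hne]
      refine ⟨fun j hj hj' => hA j (h1 j hj hj').1 (h1 j hj hj').2, fun i c d h hc hd => ?_⟩
      have hck : c ≤ k := by
        by_contra hcon
        obtain rfl : c = k + 1 := by omega
        have := S.own_of_gap_left h
        rw [hne] at this
        rw [this] at sB
        have := sB.2.2 _ _ h
        omega
      obtain ⟨m, hm1, hm2, hm3, hm4⟩ := hB i c d h hck (by omega)
      exact ⟨m, hm1, hm2, hm3, fun j hj hj' => hm4 j (h1 j hj hj').1 (h1 j hj hj').2⟩
    · rcases S.own_step hk hne with ⟨hg, hl⟩ | ⟨hg, hr⟩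
      -- A new piece starts in a gap of the old owner. Its rank exceeds that of the old owner, hence
      -- of everything else over the edge.
      · have hAB : rank (S.own k) < rank (S.own (k + 1)) := hrank hg hl
        have h1 : ∀ j, S.lft j ≤ k + 1 → k + 1 < S.rgt j → j ≠ S.own (k + 1) →
            S.lft j ≤ k ∧ k < S.rgt j := by
          intro j hj hj' hne'
          refine ⟨?_, by omega⟩
          by_contra hcon
          exact hne' (hlft j (by omega)).symm
        refine ⟨fun j hj hj' => ?_, fun i c d h hc hd => ?_⟩
        · by_cases hj1 : j = S.own (k + 1)
          · rw [hj1]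
          · exact (hA j (h1 j hj hj' hj1).1 (h1 j hj hj' hj1).2).trans hAB.le
        · by_cases hi : i = S.own k
          · subst hi
            have h2 : c = k + 1 ∧ d = S.rgt (S.own (k + 1)) := by
              have := S.gap_disj h hg
              have := S.gap_mem hg
              omega
            refine ⟨S.own (k + 1), by rw [hl, h2.1], h2.2.symm, hAB, fun j hj hj' hr => ?_⟩
            by_cases hj1 : j = S.own (k + 1)
            · rw [hj1]
            · have := hA j (h1 j hj hj' hj1).1 (h1 j hj hj' hj1).2
              omega
          · have hck : c ≤ k := by
              by_contra hcon
              obtain rfl : c = k + 1 := by omega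
              exact hi (S.own_of_gap_left h).symm
            obtain ⟨m, hm1, hm2, hm3, hm4⟩ := hB i c d h hck (by omega)
            refine ⟨m, hm1, hm2, hm3, fun j hj hj' hr => ?_⟩
            by_cases hj1 : j = S.own (k + 1)
            -- For an older gap the old owner already had rank at least that of `m`, and the new
            -- piece ranks higher still.
            · subst hj1
              have hiA : rank i ≤ rank (S.own k) := by
                have := S.gap_mem h
                exact hA i (by omega) (by omega)
              have : rank i ≠ rank (S.own k) := fun e => hi (hinj e)
              exact (hm4 _ sA.1 sA.2.1 (by omega)).trans hAB.le
            · exact hm4 j (h1 j hj hj' hj1).1 (h1 j hj hj' hj1).2 hr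
      · have gB := S.gap_mem hg
        have h1 : ∀ j, S.lft j ≤ k + 1 → k + 1 < S.rgt j → S.lft j ≤ k ∧ k < S.rgt j := by
          intro j hj hj'
          refine ⟨?_, by omega⟩
          by_contra hcon
          have := hlft j (by omega)
          subst this
          omega
        -- The old owner ends and the walk returns to the piece around it. The piece `m` filling
        -- that gap is the old owner, so it has both the least rank above the new owner and the
        -- greatest rank over edge `k`: once it ends, nothing above the new owner is left.
        obtain ⟨m, hm1, hm2, hm3, hm4⟩ := hB _ _ _ hg sA.1 (by omega)
        have hmA : m = S.own k := by
          rw [← S.own_lft m, hm1, S.own_lft]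
        subst hmA
        refine ⟨fun j hj hj' => ?_, fun i c d h hc hd => ?_⟩
        · obtain ⟨h2, h3⟩ := h1 j hj hj'
          by_contra! hcon
          have h4 := hm4 j h2 h3 hcon
          have h5 := hA j h2 h3
          have : j = S.own k := hinj (by omega)
          subst this
          omega
        · have hck : c ≤ k := by
            by_contra hcon
            obtain rfl : c = k + 1 := by omega
            have h2 := S.own_of_gap_left h
            subst h2
            have := S.gap_mem h
            omega
          obtain ⟨m, hm1, hm2, hm3, hm4⟩ := hB i c d h hck (by omega)
          exact ⟨m, hm1, hm2, hm3, fun j hj hj' => hm4 j (h1 j hj hj').1 (h1 j hj hj').2⟩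

/-- A piece that does not start at `0` starts at a gap of another piece. -/
theorem exists_gap_of_lft_ne_zero {i : ι} (hi : S.lft i ≠ 0) : ∃ j, S.gap j (S.lft i)
    (S.rgt i) := by
  have h1 := S.lft_lt i
  have h2 := S.rgt_le i
  obtain ⟨k, hk⟩ := Nat.exists_eq_succ_of_ne_zero hi
  have ho : S.own (k + 1) = i := by rw [← S.own_lft i, hk]
  have hA := S.own_spec (k := k) (by omega)
  have hne : S.own k ≠ S.own (k + 1) := by
    rw [ho]
    intro h
    rw [h] at hA
    omega
  rcases S.own_step (by omega) hne with ⟨hg, -⟩ | ⟨hg, hr⟩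
  · rw [ho] at hg
    exact ⟨_, by rw [hk]; exact hg⟩
  · rw [ho] at hg
    have := S.gap_mem hg
    omega

end PieceSystem

/-! ### Normal curves and their edges -/

namespace IsNormalCurve

variable {C : ℝ → ℂ}

theorem apply_one (hC : IsNormalCurve C) : C 1 = C 0 := by simpa using hC.periodic 0

theorem eq_ends_or (hC : IsNormalCurve C) {s t : ℝ} (hs : 0 ≤ s) (hst : s < t) (ht : t ≤ 1)
    (h : C s = C t) :
    (s = 0 ∧ t = 1) ∨ (0 < s ∧ t < 1) := by
  rcases hs.eq_or_lt with rfl | hs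
  · rcases ht.eq_or_lt with rfl | ht
    · exact Or.inl ⟨rfl, rfl⟩
    · exact absurd h.symm (hC.base_simple t ⟨hst, ht⟩)
  · rcases ht.eq_or_lt with rfl | ht
    · rw [hC.apply_one] at h
      exact absurd h (hC.base_simple s ⟨hs, hst⟩)
    · exact Or.inr ⟨hs, ht⟩

theorem mem_vertices (hC : IsNormalCurve C) {s t : ℝ} (hs : 0 ≤ s) (hst : s < t) (ht : t ≤ 1)
    (h : C s = C t) :
    C s ∈ vertices C := by
  rcases hC.eq_ends_or hs hst ht h with ⟨rfl, -⟩ | ⟨h1, h2⟩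
  · exact mem_insert _ _
  · exact Or.inr ⟨s, ⟨hs, hst.trans h2⟩, t, ⟨hs.trans hst.le, h2⟩, hst.ne, rfl, h.symm⟩

theorem third_param (hC : IsNormalCurve C) {s t u : ℝ} (hs : s ∈ Ioo (0 : ℝ) 1) (ht : t ∈ Ioo
    (0 : ℝ) 1)
    (hu : u ∈ Ioo (0 : ℝ) 1) (hst : s ≠ t) (h : C s = C t) (h' : C s = C u) : u = s ∨ u = t := by
  obtain ⟨t₁, t₂, -, hset, -⟩ := hC.simple_crossings (C s)
    ⟨s, ⟨hs.1.le, hs.2⟩, t, ⟨ht.1.le, ht.2⟩, hst, rfl, h.symm⟩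
  have h1 : s ∈ ({t₁, t₂} : Set ℝ) := by rw [← hset]; exact ⟨⟨hs.1.le, hs.2⟩, rfl⟩
  have h2 : t ∈ ({t₁, t₂} : Set ℝ) := by rw [← hset]; exact ⟨⟨ht.1.le, ht.2⟩, h.symm⟩
  have h3 : u ∈ ({t₁, t₂} : Set ℝ) := by rw [← hset]; exact ⟨⟨hu.1.le, hu.2⟩, h'.symm⟩
  rcases h1 with rfl | rfl <;> rcases h2 with rfl | rfl <;> rcases h3 with rfl | rfl <;> simp_all

theorem eq_right (hC : IsNormalCurve C) {s t u : ℝ} (hs : 0 ≤ s) (hst : s < t) (ht : t ≤ 1)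
    (hsu : s < u) (hu : u ≤ 1)
    (h : C s = C t) (h' : C s = C u) : t = u := by
  rcases hC.eq_ends_or hs hst ht h with ⟨h1, h2⟩ | ⟨h1, h2⟩ <;>
    rcases hC.eq_ends_or hs hsu hu h' with ⟨h3, h4⟩ | ⟨h3, h4⟩
  · rw [h2, h4]
  · linarith
  · linarith
  · rcases hC.third_param ⟨h1, hst.trans h2⟩ ⟨h1.trans hst, h2⟩ ⟨h1.trans hsu, h4⟩ hst.ne h h'
      with e | e
    · exact absurd e hsu.ne'
    · exact e.symm

theorem eq_left (hC : IsNormalCurve C) {s t u : ℝ} (hs : 0 ≤ s) (hsu : s < u) (ht : 0 ≤ t)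
    (htu : t < u) (hu : u ≤ 1)
    (h : C s = C u) (h' : C t = C u) : s = t := by
  rcases hC.eq_ends_or hs hsu hu h with ⟨h1, h2⟩ | ⟨h1, h2⟩ <;>
    rcases hC.eq_ends_or ht htu hu h' with ⟨h3, h4⟩ | ⟨h3, h4⟩
  · rw [h1, h3]
  · linarith
  · linarith
  · rcases hC.third_param ⟨h1, hsu.trans h2⟩ ⟨h1.trans hsu, h2⟩ ⟨h3, htu.trans h4⟩ hsu.ne h
      (h.trans h'.symm) with e | e
    · exact e.symm
    · exact absurd e htu.ne

theorem not_chain (hC : IsNormalCurve C) {s t u : ℝ} (hs : 0 ≤ s) (hst : s < t) (htu : t < u)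
    (hu : u ≤ 1)
    (h : C s = C t) (h' : C t = C u) : False := by
  have := hC.eq_right hs hst (htu.le.trans hu) (hst.trans htu) hu h (h.trans h')
  exact htu.ne this

theorem finite_params (hC : IsNormalCurve C) : {t | t ∈ Icc
    (0 : ℝ) 1 ∧ C t ∈ vertices C}.Finite := by
  have h1 : (⋃ p ∈ intersectionPoints C, {t | t ∈ Ico (0 : ℝ) 1 ∧ C t = p}).Finite := by
    refine hC.finite_intersections.biUnion fun p hp => ?_
    obtain ⟨t₁, t₂, -, hset, -⟩ := hC.simple_crossings p hp
    rw [hset]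
    exact toFinite _
  refine (h1.union (toFinite {0, 1})).subset ?_
  rintro t ⟨ht, hv⟩
  rcases ht.1.eq_or_lt with rfl | h0
  · right; simp
  rcases ht.2.eq_or_lt with rfl | h1
  · right; simp
  rcases hv with hv | hv
  · exact absurd hv (hC.base_simple t ⟨h0, h1⟩)
  · left
    exact mem_iUnion₂.2 ⟨C t, hv, ⟨ht.1, h1⟩, rfl⟩

end IsNormalCurve

/-! ### From a decomposition to its combinatorial system of pieces -/

/-- The points `0 = b 0 < b 1 < ⋯ < b N = 1` are the parameters of the vertices of `C`. -/
structure IsSubdivision (C : ℝ → ℂ) (N : ℕ) (b : ℕ → ℝ) : Prop where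
  strictMono : StrictMono b
  zero : b 0 = 0
  last : b N = 1
  mem_iff : ∀ t ∈ Icc (0 : ℝ) 1, C t ∈ vertices C ↔ ∃ k ≤ N, b k = t

theorem exists_strictMono_eq (V : Finset ℝ) (h0 : 0 ∈ V) (h1 : 1 ∈ V) (hV : ∀ t ∈ V, t ∈ Icc
    (0 : ℝ) 1) :
    ∃ (N : ℕ) (b : ℕ → ℝ), StrictMono b ∧ b 0 = 0 ∧ b N = 1 ∧ ∀ t, t ∈ V ↔ ∃ k ≤ N, b k = t := by
  obtain ⟨N, hN⟩ : ∃ N, V.card = N + 1 :=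
    Nat.exists_eq_succ_of_ne_zero (Finset.card_ne_zero_of_mem h0)
  set e := V.orderEmbOfFin hN with he
  have hmem : ∀ k, e k ∈ V := fun k => V.orderEmbOfFin_mem hN k
  have hsurj : ∀ t ∈ V, ∃ k, e k = t := fun t ht => by
    have : t ∈ Set.range e := by rw [V.range_orderEmbOfFin hN]; exact ht
    exact this
  have he0 : e 0 = 0 := by
    obtain ⟨k, hk⟩ := hsurj 0 h0
    refine le_antisymm ?_ (hV _ (hmem 0)).1
    rw [← hk]
    exact e.monotone (Fin.zero_le k)
  have he1 : e (Fin.last N) = 1 := by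
    obtain ⟨k, hk⟩ := hsurj 1 h1
    refine le_antisymm (hV _ (hmem _)).2 ?_
    rw [← hk]
    exact e.monotone (Fin.le_last k)
  -- The values beyond `N` only serve to make the sequence strictly increasing on all of `ℕ`.
  set b : ℕ → ℝ := fun k => if h : k < N + 1 then e ⟨k, h⟩ else 1 + k with hb
  have hbk : ∀ k (h : k < N + 1), b k = e ⟨k, h⟩ := fun k h => dif_pos h
  refine ⟨N, b, strictMono_nat_of_lt_succ fun k => ?_, ?_, ?_, fun t => ⟨fun ht => ?_, ?_⟩⟩
  · by_cases h : k + 1 < N + 1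
    · rw [hbk k (by omega), hbk (k + 1) h]
      exact e.strictMono (by simp [Fin.lt_def])
    · have h2 : b (k + 1) = 1 + (k + 1 : ℕ) := dif_neg h
      rw [h2]
      by_cases h' : k < N + 1
      · rw [hbk k h']
        have := (hV _ (hmem ⟨k, h'⟩)).2
        push_cast
        linarith [Nat.cast_nonneg (α := ℝ) k]
      · have : b k = 1 + k := dif_neg h'
        rw [this]; push_cast; linarith
  · rw [hbk 0 (by omega)]; exact he0
  · rw [hbk N (by omega)]; exact he1
  · obtain ⟨k, hk⟩ := hsurj t ht
    exact ⟨k, by omega, by rw [hbk k k.2]; exact hk⟩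
  · rintro ⟨k, hk, rfl⟩
    rw [hbk k (by omega)]
    exact hmem _

theorem IsNormalCurve.exists_isSubdivision {C : ℝ → ℂ} (hC : IsNormalCurve C) :
    ∃ N b, IsSubdivision C N b := by
  obtain ⟨N, b, h1, h2, h3, h4⟩ := exists_strictMono_eq hC.finite_params.toFinset
    (by simp [vertices]) (by simp [vertices, hC.apply_one]) (fun t ht => by simp at ht; exact ht.1)
  refine ⟨N, b, h1, h2, h3, fun t ht => ?_⟩
  rw [← h4]
  rw [Finite.mem_toFinset]
  exact ⟨fun h => ⟨ht, h⟩, fun h => h.2⟩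

/-- The piece system `S` describes the pieces of a decomposition. -/
structure Fits {C : ℝ → ℂ} {l N : ℕ} (S : PieceSystem (Fin l) N)
    (γ : Fin l → ClosedSubcurve C) (b : ℕ → ℝ) : Prop where
  lft : ∀ i, b (S.lft i) = (γ i).left
  rgt : ∀ i, b (S.rgt i) = (γ i).right
  gap : ∀ i c d, S.gap i c d ↔ (b c, b d) ∈ (γ i).gaps
  exists_gap : ∀ i, ∀ g ∈ (γ i).gaps, ∃ c d, g = (b c, b d)

theorem IsSubdivision.mem_Icc {C : ℝ → ℂ} {N : ℕ} {b : ℕ → ℝ} (hb : IsSubdivision C N b) {k : ℕ}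
    (hk : k ≤ N) : b k ∈ Icc (0 : ℝ) 1 :=
  ⟨by rw [← hb.zero]; exact hb.strictMono.monotone k.zero_le,
    by rw [← hb.last]; exact hb.strictMono.monotone hk⟩

theorem IsSubdivision.exists_edge {C : ℝ → ℂ} {N : ℕ} {b : ℕ → ℝ} (hb : IsSubdivision C N b)
    {t : ℝ} (ht : t ∈ Ico (0 : ℝ) 1) : ∃ k < N, t ∈ Ico (b k) (b (k + 1)) := by
  have : ∀ n, t < b n → ∃ k < n, t ∈ Ico (b k) (b (k + 1)) := by
    intro n
    induction n with
    | zero => intro h; rw [hb.zero] at h; exact absurd ht.1 (not_le.2 h)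
    | succ n ih =>
      intro h
      rcases lt_or_ge t (b n) with h' | h'
      · obtain ⟨k, hk, h⟩ := ih h'
        exact ⟨k, by omega, h⟩
      · exact ⟨n, by omega, h', h⟩
  exact this N (by rw [hb.last]; exact ht.2)

/-- Coinciding values of `C` occur only at vertices, so pieces and gaps begin and end at points of
the subdivision. An edge has a unique owner because the traces cover the curve and meet only at
vertices, and the axioms on matched ends hold because `C` passes each point at most twice (the ends
`0` and `1` being matched only with each other). -/
theorem Decomposition.exists_fits {C : ℝ → ℂ} (hC : IsNormalCurve C) {N : ℕ} {b : ℕ → ℝ}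
    (hb : IsSubdivision C N b) {l : ℕ} (Γ : Decomposition C l) :
    ∃ S : PieceSystem (Fin l) N, Fits S Γ.piece b := by
  have hmono := hb.strictMono
  have hV : ∀ s t : ℝ, 0 ≤ s → s < t → t ≤ 1 → C s = C t →
      (∃ k ≤ N, b k = s) ∧ ∃ k ≤ N, b k = t := fun s t hs hst ht h => by
    have h1 := hC.mem_vertices hs hst ht h
    refine ⟨(hb.mem_iff s ⟨hs, hst.le.trans ht⟩).1 h1, (hb.mem_iff t ⟨hs.trans hst.le, ht⟩).1 ?_⟩
    rwa [← h]
  have hends := fun i => hV _ _ (Γ.piece i).left_nonneg (Γ.piece i).left_lt_right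
    (Γ.piece i).right_le_one (Γ.piece i).closed
  choose lft hlftN hlft using fun i => (hends i).1
  choose rgt hrgtN hrgt using fun i => (hends i).2
  have hgaps : ∀ i, ∀ g ∈ (Γ.piece i).gaps, ∃ c d, g = (b c, b d) := fun i g hg => by
    obtain ⟨h1, h2, h3⟩ := (Γ.piece i).gaps_mem g hg
    obtain ⟨⟨c, -, hc⟩, ⟨d, -, hd⟩⟩ := hV g.1 g.2 ((Γ.piece i).left_nonneg.trans h1.le) h2
      (h3.le.trans (Γ.piece i).right_le_one) ((Γ.piece i).gaps_closed g hg)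
    exact ⟨c, d, by rw [hc, hd]⟩
  have hgm : ∀ {i c d}, (b c, b d) ∈ (Γ.piece i).gaps → lft i < c ∧ c < d ∧ d < rgt i := by
    intro i c d h
    obtain ⟨h1, h2, h3⟩ := (Γ.piece i).gaps_mem _ h
    rw [← hlft] at h1
    rw [← hrgt] at h3
    exact ⟨hmono.lt_iff_lt.1 h1, hmono.lt_iff_lt.1 h2, hmono.lt_iff_lt.1 h3⟩
  have hown : ∀ k, k < N → ∃! i, lft i ≤ k ∧ k < rgt i ∧
      ∀ c d, (b c, b d) ∈ (Γ.piece i).gaps → k < c ∨ d ≤ k := by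
    intro k hk
    -- An inner point of the edge detects ownership. As `C t` is not a vertex, `t` is the only
    -- parameter of `[0,1]` over it, so lying on a trace and lying in a support mean the same.
    obtain ⟨t, ht⟩ := nonempty_Ioo.2 (hmono (Nat.lt_succ_self k))
    have htI : t ∈ Icc (0 : ℝ) 1 :=
      ⟨(hb.mem_Icc hk.le).1.trans ht.1.le, ht.2.le.trans (hb.mem_Icc hk).2⟩
    have htv : C t ∉ vertices C := by
      rw [hb.mem_iff t htI]
      rintro ⟨m, -, rfl⟩
      have h1 := hmono.lt_iff_lt.1 ht.1
      have h2 := hmono.lt_iff_lt.1 ht.2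
      omega
    have key : ∀ i, t ∈ (Γ.piece i).support ↔ lft i ≤ k ∧ k < rgt i ∧
        ∀ c d, (b c, b d) ∈ (Γ.piece i).gaps → k < c ∨ d ≤ k := by
      intro i
      rw [ClosedSubcurve.mem_support_iff, ← hlft, ← hrgt]
      have e1 : ∀ m, b m ≤ t ↔ m ≤ k := fun m => by
        constructor
        · intro h
          have := hmono.lt_iff_lt.1 (h.trans_lt ht.2)
          omega
        · intro h
          exact (hmono.monotone h).trans ht.1.le
      have e2 : ∀ m, t ≤ b m ↔ k < m := fun m => by
        constructor
        · intro h
          exact hmono.lt_iff_lt.1 (ht.1.trans_le h)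
        · intro h
          exact ht.2.le.trans (hmono.monotone h)
      rw [mem_Icc, e1, e2, and_assoc]
      refine and_congr_right fun _ => and_congr_right fun _ => ⟨fun h c d hcd => ?_, fun h g hg =>
          ?_⟩
      · rw [← e1, ← e2]; exact h _ hcd
      · obtain ⟨c, d, rfl⟩ := hgaps i g hg
        simp only [e1, e2]
        exact h c d hg
    obtain ⟨i, hi⟩ : ∃ i, C t ∈ (Γ.piece i).trace := by
      have : C t ∈ ⋃ i, (Γ.piece i).trace := by rw [Γ.iUnion_trace]; exact mem_range_self t
      simpa using this
    refine ⟨i, (key i).1 ?_, fun j hj => ?_⟩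
    · obtain ⟨s, hs, hst⟩ := hi
      have hsI : s ∈ Icc (0 : ℝ) 1 := by
        have := ((Γ.piece i).mem_support_iff.1 hs).1
        exact ⟨(Γ.piece i).left_nonneg.trans this.1, this.2.trans (Γ.piece i).right_le_one⟩
      rcases lt_trichotomy s t with h | rfl | h
      · exact absurd (hst ▸ hC.mem_vertices hsI.1 h htI.2 hst) htv
      · exact hs
      · exact absurd (hC.mem_vertices htI.1 h hsI.2 hst.symm) htv
    · by_contra hne
      exact htv (Γ.inter_subset j i hne ⟨mem_image_of_mem _ ((key j).2 hj), hi⟩)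
  have : Nonempty (Fin l) := by
    have : C 0 ∈ ⋃ i, (Γ.piece i).trace := by rw [Γ.iUnion_trace]; exact mem_range_self 0
    obtain ⟨i, -⟩ := mem_iUnion.1 this
    exact ⟨i⟩
  choose! own hown1 hown2 using hown
  let pr : ℕ → ℕ → Prop := fun c d => c < d ∧ d ≤ N ∧ C (b c) = C (b d)
  refine ⟨⟨lft, rgt, fun i c d => (b c, b d) ∈ (Γ.piece i).gaps, pr, own, fun i => ?_, hrgtN,
    hgm, ?_, fun i => ⟨?_, hrgtN i, ?_⟩, ?_, ?_, ?_, ?_, ?_⟩, hlft, hrgt, fun _ _ _ => Iff.rfl,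
    hgaps⟩
  · rw [← hmono.lt_iff_lt, hlft, hrgt]; exact (Γ.piece i).left_lt_right
  · intro i c d c' d' h h'
    by_cases he : (b c, b d) = (b c', b d')
    · rw [Prod.mk.injEq] at he
      exact Or.inl ⟨hmono.injective he.1, hmono.injective he.2⟩
    · right
      have hd := (Γ.piece i).gaps_disjoint _ h _ h' he
      have h1 := hgm h
      have h2 := hgm h'
      by_contra! hcon
      rcases le_total c c' with hcc | hcc
      · exact disjoint_left.1 hd
          ⟨hmono.monotone hcc, hmono.monotone hcon.1⟩ ⟨le_rfl, hmono.monotone h2.2.1.le⟩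
      · exact disjoint_left.1 hd ⟨le_rfl, hmono.monotone h1.2.1.le⟩
          ⟨hmono.monotone hcc, hmono.monotone hcon.2⟩
  · rw [← hmono.lt_iff_lt, hlft, hrgt]; exact (Γ.piece i).left_lt_right
  · rw [hlft, hrgt]; exact (Γ.piece i).closed
  · intro i c d h
    have h1 := hgm h
    have h2 := hrgtN i
    exact ⟨h1.2.1, by omega, (Γ.piece i).gaps_closed _ h⟩
  · rintro c d d' ⟨h1, h2, h3⟩ ⟨h1', h2', h3'⟩
    exact hmono.injective (hC.eq_right (hb.mem_Icc (by omega)).1 (hmono h1) (hb.mem_Icc h2).2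
      (hmono h1') (hb.mem_Icc h2').2 h3 h3')
  · rintro c c' d ⟨h1, h2, h3⟩ ⟨h1', h2', h3'⟩
    exact hmono.injective (hC.eq_left (hb.mem_Icc (by omega)).1 (hmono h1)
      (hb.mem_Icc (by omega)).1 (hmono h1') (hb.mem_Icc h2').2 h3 h3')
  · rintro c d e ⟨h1, h2, h3⟩ ⟨h1', h2', h3'⟩
    exact hC.not_chain (hb.mem_Icc (by omega)).1 (hmono h1) (hmono h1') (hb.mem_Icc h2').2 h3 h3'
  · intro i k hk
    exact ⟨fun h => h ▸ hown1 k hk, fun h => (hown2 k hk i h).symm⟩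

section Fits

variable {C : ℝ → ℂ} {l N : ℕ} {S : PieceSystem (Fin l) N} {γ : Fin l → ClosedSubcurve C}
  {b : ℕ → ℝ}

theorem Fits.edge_gap (hS : Fits S γ b) (hb : StrictMono b) {k : ℕ} (hk : k < N) :
    ∀ g ∈ (γ (S.own k)).gaps, b (k + 1) ≤ g.1 ∨ g.2 ≤ b k := by
  intro g hg
  obtain ⟨c, d, rfl⟩ := hS.exists_gap _ g hg
  rcases (S.own_spec hk).2.2 c d ((hS.gap _ _ _).2 hg) with h | h
  · exact Or.inl (hb.monotone h)
  · exact Or.inr (hb.monotone h)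

theorem Fits.edge_subset (hS : Fits S γ b) (hb : StrictMono b) {k : ℕ} (hk : k < N) {t : ℝ}
    (ht : t ∈ Icc (b k) (b (k + 1))) : t ∈ (γ (S.own k)).support := by
  obtain ⟨h1, h2, -⟩ := S.own_spec hk
  rw [ClosedSubcurve.mem_support_iff, ← hS.lft, ← hS.rgt]
  refine ⟨⟨(hb.monotone h1).trans ht.1, ht.2.trans (hb.monotone h2)⟩, fun g hg => ?_⟩
  exact (hS.edge_gap hb hk g hg).imp ht.2.trans fun h => h.trans ht.1

/-- The clamped progress of a piece is constant along the edges that the piece does not own. -/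
theorem Fits.clampProgress_eq (hS : Fits S γ b) (hb : StrictMono b) {k : ℕ} (hk : k < N)
    {i : Fin l} (hi : S.own k ≠ i) {t : ℝ} (ht : t ∈ Icc (b k) (b (k + 1))) :
    (γ i).clampProgress t = (γ i).clampProgress (b k) := by
  have h := mt (S.own_iff hk).2 hi
  by_cases h1 : S.lft i ≤ k
  · by_cases h2 : k < S.rgt i
    · push Not at h
      obtain ⟨c, d, hcd, hck, hkd⟩ := h h1 h2
      have hg := (hS.gap _ _ _).1 hcd
      have hI : ∀ u ∈ Icc (b k) (b (k + 1)), (γ i).clampProgress u = (γ i).progress (b c) := by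
        intro u hu
        have huI : u ∈ Icc (b c) (b d) :=
          ⟨(hb.monotone hck).trans hu.1, hu.2.trans (hb.monotone hkd)⟩
        obtain ⟨g1, g2, g3⟩ := (γ i).gaps_mem _ hg
        rw [ClosedSubcurve.clampProgress_of_mem _ ⟨g1.le.trans huI.1, huI.2.trans g3.le⟩,
          (γ i).progress_of_mem_gap hg huI]
      rw [hI t ht, hI (b k) ⟨le_rfl, hb.monotone k.le_succ⟩]
    · have hr : (γ i).right ≤ b k := by rw [← hS.rgt]; exact hb.monotone (not_lt.1 h2)
      rw [ClosedSubcurve.clampProgress_of_ge _ hr,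
        ClosedSubcurve.clampProgress_of_ge _ (hr.trans ht.1)]
  · have hl : b (k + 1) ≤ (γ i).left := by rw [← hS.lft]; exact hb.monotone (not_le.1 h1)
    rw [ClosedSubcurve.clampProgress_of_le _ (ht.2.trans hl),
      ClosedSubcurve.clampProgress_of_le _ ((hb.monotone k.le_succ).trans hl)]

/-- The variations of the logarithm along the pieces add up over the edges. -/
theorem Fits.sum_logVar (hS : Fits S γ b) (hb : StrictMono b) (hb0 : b 0 = 0) (hb1 : b N = 1)
    {G : Fin l → ℝ → ℂ} (hG : ∀ i, NonvanishingOn (G i) 0 1)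
    (hle : ∀ i, 0 ≤ (γ i).left ∧ (γ i).right ≤ 1) :
    ∑ i, logVar (G i) 0 1 = ∑ k ∈ Finset.range N,
      logVar (fun t => G (S.own k) ((γ (S.own k)).clampProgress t)) (b k) (b (k + 1)) := by
  have hcl0 : ∀ i, (γ i).clampProgress 0 = 0 := fun i =>
    ClosedSubcurve.clampProgress_of_le _ (hle i).1
  have hcl1 : ∀ i, (γ i).clampProgress 1 = 1 := fun i =>
    ClosedSubcurve.clampProgress_of_ge _ (hle i).2
  have hnv : ∀ i, NonvanishingOn (fun t => G i ((γ i).clampProgress t)) (b 0) (b N) := fun i =>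
    ⟨(hG i).1.comp (by fun_prop) fun t _ => ClosedSubcurve.clampProgress_mem _ t,
      fun t _ => (hG i).2 _ (ClosedSubcurve.clampProgress_mem _ t)⟩
  have h1 : ∀ i, logVar (G i) 0 1 = ∑ k ∈ Finset.range N,
      logVar (fun t => G i ((γ i).clampProgress t)) (b k) (b (k + 1)) := by
    intro i
    rw [MinHomotopy.sum_logVar hb.monotone N (hnv i), hb0, hb1]
    have := logVar_comp (f := G i) (φ := (γ i).clampProgress) zero_le_one (by fun_prop)
      (by rw [hcl0, hcl1]; exact fun t _ => ClosedSubcurve.clampProgress_mem _ t)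
      (by rw [hcl0, hcl1]; exact hG i)
    rw [hcl0, hcl1] at this
    exact this.symm
  rw [Finset.sum_congr rfl fun i _ => h1 i, Finset.sum_comm]
  refine Finset.sum_congr rfl fun k hk => ?_
  have hk' := Finset.mem_range.1 hk
  -- Along an edge only the owner moves; the clamped progress of every other piece is constant and
  -- contributes nothing.
  refine Finset.sum_eq_single_of_mem (S.own k) (Finset.mem_univ _) fun i _ hi => ?_
  refine logVar_of_const (c := G i ((γ i).clampProgress (b k))) (hb.monotone k.le_succ)
    ((hG i).2 _ ((γ i).clampProgress_mem (b k))) fun t ht => ?_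
  rw [hS.clampProgress_eq hb hk' (Ne.symm hi) ht]

end Fits

/-- Winding numbers are additive under decomposition. -/
theorem Decomposition.sum_logVar_sub {C : ℝ → ℂ} (hC : IsNormalCurve C) {l : ℕ}
    (Γ : Decomposition C l) {x : ℂ} (hx : x ∉ range C) :
    ∑ i, logVar (fun t => (Γ.piece i).curve t - x) 0 1 = logVar (fun t => C t - x) 0 1 := by
  obtain ⟨N, b, hb⟩ := hC.exists_isSubdivision
  obtain ⟨S, hS⟩ := Γ.exists_fits hC hb
  have hcont : ∀ i, Continuous (Γ.piece i).curve := fun i => by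
    obtain ⟨F, hF⟩ := Γ.selfOverlapping i
    exact hF.continuous
  have hnvC : NonvanishingOn (fun t => C t - x) (b 0) (b N) :=
    ⟨(hC.continuous.sub continuous_const).continuousOn,
      fun t _ h => hx ⟨t, sub_eq_zero.1 h⟩⟩
  rw [hS.sum_logVar hb.strictMono hb.zero hb.last (G := fun i t => (Γ.piece i).curve t - x)
    (fun i => ⟨((hcont i).sub continuous_const).continuousOn, fun t _ h => ?_⟩)
    (fun i => ⟨(Γ.piece i).left_nonneg, (Γ.piece i).right_le_one⟩)]
  · rw [← hb.zero, ← hb.last, ← sum_logVar hb.strictMono.monotone N hnvC]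
    refine Finset.sum_congr rfl fun k hk => ?_
    have hk' := Finset.mem_range.1 hk
    refine logVar_congr (hb.strictMono.monotone k.le_succ)
      (hnvC.mono (hb.strictMono.monotone k.zero_le) (hb.strictMono.monotone hk')) fun t ht => ?_
    have hs := hS.edge_subset hb.strictMono hk' ht
    rw [ClosedSubcurve.clampProgress_of_mem _ ((ClosedSubcurve.mem_support_iff _).1 hs).1,
      ClosedSubcurve.curve_progress _ hs]
  · obtain ⟨s, -, hs⟩ := (Γ.piece i).exists_curve_eq t
    exact hx ⟨s, by rw [← hs]; exact sub_eq_zero.1 h⟩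

/-! ### Additivity of the Whitney index -/

/-- At the parameter `s` the curve moves into the half plane `{z | 0 < Re (z / u)}`. -/
def MovesAlong (C : ℝ → ℂ) (u : ℂ) (s : ℝ) : Prop :=
  ∀ᶠ x in 𝓝[>] (0 : ℝ), 0 < ((C (s + x) - C s) / u).re ∧ 0 < ((C s - C (s - x)) / u).re

theorem movesAlong_of_deriv {C : ℝ → ℂ} {u : ℂ} {s : ℝ} (hC : DifferentiableAt ℝ C s)
    (h : 0 < (deriv C s / u).re) : MovesAlong C u s := by
  have hd : HasDerivAt (fun x => (C x / u).re) (deriv C s / u).re s :=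
    Complex.reCLM.hasFDerivAt.comp_hasDerivAt s (hC.hasDerivAt.div_const u)
  have hslope := (hasDerivAt_iff_tendsto_slope.1 hd).eventually (lt_mem_nhds h)
  have e1 : Tendsto (fun x : ℝ => s + x) (𝓝[>] 0) (𝓝[≠] s) := by
    refine tendsto_nhdsWithin_iff.2 ⟨?_, ?_⟩
    · have : Continuous fun x : ℝ => s + x := by fun_prop
      have h1 := this.tendsto 0
      rw [add_zero] at h1
      exact h1.mono_left nhdsWithin_le_nhds
    · filter_upwards [self_mem_nhdsWithin] with x hx
      have : 0 < x := hx
      simp [this.ne']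
  have e2 : Tendsto (fun x : ℝ => s - x) (𝓝[>] 0) (𝓝[≠] s) := by
    refine tendsto_nhdsWithin_iff.2 ⟨?_, ?_⟩
    · have : Continuous fun x : ℝ => s - x := by fun_prop
      have h1 := this.tendsto 0
      rw [sub_zero] at h1
      exact h1.mono_left nhdsWithin_le_nhds
    · filter_upwards [self_mem_nhdsWithin] with x hx
      have : 0 < x := hx
      simp [this.ne']
  filter_upwards [e1.eventually hslope, e2.eventually hslope, self_mem_nhdsWithin] with x h1 h2 hx
  have hx : 0 < x := hx
  rw [slope_def_field] at h1 h2
  rw [add_sub_cancel_left] at h1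
  rw [sub_sub_cancel_left, div_neg, ← neg_div, neg_sub] at h2
  rw [sub_div, Complex.sub_re, sub_div, Complex.sub_re]
  exact ⟨(div_pos_iff_of_pos_right hx).1 h1, (div_pos_iff_of_pos_right hx).1 h2⟩

/-- A quarter turn of `v - w` has the same inner product with `v` and with `w`, namely their
determinant `D`; the factor `D` in `u` makes it `D²`. Hence both branches at a crossing move into
one half plane, and changing branch there cannot add a turn. -/
theorem exists_common_halfPlane {v w : ℂ} (h : LinearIndependent ℝ ![v, w]) :
    ∃ u : ℂ, 0 < (v / u).re ∧ 0 < (w / u).re := by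
  have hD : v.re * w.im - v.im * w.re ≠ 0 := by
    intro hD
    rw [LinearIndependent.pair_iff] at h
    by_cases hw : w = 0
    · exact one_ne_zero (h 0 1 (by simp [hw])).2
    · have h1 := h w.re (-v.re) (by
        apply Complex.ext
        · simp; ring
        · simp; linarith)
      have h2 := h w.im (-v.im) (by
        apply Complex.ext
        · simp; linarith
        · simp; ring)
      exact hw (Complex.ext h1.1 h2.1)
  set D := v.re * w.im - v.im * w.re with hDdef
  set u : ℂ := D * (Complex.I * (v - w)) with hu
  have hre : u.re = D * (w.im - v.im) := by simp [hu]
  have him : u.im = D * (v.re - w.re) := by simp [hu]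
  have hu0 : u ≠ 0 := by
    intro h0
    rw [h0] at hre him
    have h1 : w.im - v.im = 0 := by
      have := hre.symm; simp only [Complex.zero_re, mul_eq_zero] at this; exact this.resolve_left hD
    have h2 : v.re - w.re = 0 := by
      have := him.symm; simp only [Complex.zero_im, mul_eq_zero] at this; exact this.resolve_left hD
    apply hD
    rw [hDdef]
    linear_combination v.re * h1 + v.im * h2
  have hn : 0 < Complex.normSq u := Complex.normSq_pos.2 hu0
  have hpos : 0 < D * D := mul_self_pos.2 hD
  have key : ∀ z : ℂ, (z / u).re = (z.re * u.re + z.im * u.im) / Complex.normSq u := fun z => by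
    rw [Complex.div_re]; ring
  refine ⟨u, ?_, ?_⟩
  · rw [key]
    refine div_pos ?_ hn
    rw [hre, him]
    have : v.re * (D * (w.im - v.im)) + v.im * (D * (v.re - w.re)) = D * D := by
      rw [hDdef]; ring
    rwa [this]
  · rw [key]
    refine div_pos ?_ hn
    rw [hre, him]
    have : w.re * (D * (w.im - v.im)) + w.im * (D * (v.re - w.re)) = D * D := by
      rw [hDdef]; ring
    rwa [this]

theorem IsNormalCurve.exists_movesAlong {C : ℝ → ℂ} (hC : IsNormalCurve C) {p : ℂ}
    (hp : p ∈ intersectionPoints C) : ∃ u, ∀ s ∈ Ico (0 : ℝ) 1, C s = p → MovesAlong C u s := by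
  obtain ⟨t₁, t₂, -, hset, hd1, hd2, hli⟩ := hC.simple_crossings p hp
  obtain ⟨u, h1, h2⟩ := exists_common_halfPlane hli
  refine ⟨u, fun s hs hsp => ?_⟩
  have : s ∈ ({t₁, t₂} : Set ℝ) := by rw [← hset]; exact ⟨hs, hsp⟩
  rcases this with rfl | rfl
  · exact movesAlong_of_deriv hd1 h1
  · exact movesAlong_of_deriv hd2 h2

/-- The chords of a curve that arrives along `C` at the parameter `e` and leaves along `C` from the
parameter `n` stay in the half plane of the crossing. -/
theorem re_chord_pos {C : ℝ → ℂ} {u : ℂ} {e n h : ℝ} (hen : C n = C e)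
    (hn : ∀ x ∈ Ioc 0 h, 0 < ((C (n + x) - C n) / u).re)
    (he : ∀ x ∈ Ioc 0 h, 0 < ((C e - C (e - x)) / u).re) (hh : 0 < h) {t : ℝ}
    (ht : t ∈ Icc (e - h) e) : 0 < ((C (n + (t + h - e)) - C t) / u).re := by
  -- The chord is broken at the crossing into an arriving and a departing part; one of them may be
  -- zero, but not both.
  have hsplit : (C (n + (t + h - e)) - C t) / u =
      (C (n + (t + h - e)) - C n) / u + (C e - C (e - (e - t))) / u := by
    rw [hen, sub_sub_cancel]; ring
  rw [hsplit, Complex.add_re]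
  rcases ht.1.eq_or_lt with h1 | h1
  · have h2 := he (e - t) ⟨by linarith, by linarith⟩
    have h3 : n + (t + h - e) = n := by linarith
    rw [h3, sub_self, zero_div, Complex.zero_re]
    linarith
  · have h2 := hn (t + h - e) ⟨by linarith, by linarith [ht.2]⟩
    rcases ht.2.eq_or_lt with h3 | h3
    · have h4 : e - (e - t) = e := by linarith
      rw [h4, sub_self, zero_div, Complex.zero_re]
      linarith
    · have := he (e - t) ⟨by linarith, by linarith⟩
      linarith

theorem eventually_Ioc {p : ℝ → Prop} (h : ∀ᶠ x in 𝓝[>] (0 : ℝ), p x) :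
    ∀ᶠ r in 𝓝[>] (0 : ℝ), ∀ x ∈ Ioc 0 r, p x := by
  obtain ⟨ε, hε, hsub⟩ := mem_nhdsGT_iff_exists_Ioc_subset.1 h
  filter_upwards [Ioc_mem_nhdsGT hε] with r hr x hx using hsub ⟨hx.1, hx.2.trans hr.2⟩

/-- The chord of a piece along an edge, as a chord of `C`. -/
theorem Fits.chord_eq {C : ℝ → ℂ} {l N : ℕ} {S : PieceSystem (Fin l) N}
    {γ : Fin l → ClosedSubcurve C} {b : ℕ → ℝ} (hS : Fits S γ b) (hb : StrictMono b) {k m : ℕ}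
    (hk : k < N) (hm : m < N) (ho : S.own m = S.own k)
    (hnext : m = k + 1 ∨ S.gap (S.own k) (k + 1) m ∨ k + 1 = S.rgt (S.own k) ∧ m = S.lft (S.own k))
    {h : ℝ} (hh : 0 < h) (hhm : h < b (m + 1) - b m) {t : ℝ} (ht : t ∈ Icc (b k) (b (k + 1))) :
    (t ≤ b (k + 1) - h → chord (γ (S.own k)).curve (h / (γ (S.own k)).length)
      ((γ (S.own k)).clampProgress t) = C (t + h) - C t) ∧
    (b (k + 1) - h ≤ t → chord (γ (S.own k)).curve (h / (γ (S.own k)).length)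
      ((γ (S.own k)).clampProgress t) = C (b m + (t + h - b (k + 1))) - C t) := by
  set δ := γ (S.own k) with hδ
  have hsupp : ∀ u ∈ Icc (b k) (b (k + 1)), u ∈ δ.support := fun u hu => hS.edge_subset hb hk hu
  have hsuppm : ∀ u ∈ Icc (b m) (b (m + 1)), u ∈ δ.support := fun u hu => by
    rw [hδ, ← ho]; exact hS.edge_subset hb hm hu
  have hdiff : ∀ u v, b k ≤ u → u ≤ v → v ≤ b (k + 1) →
      δ.progress v - δ.progress u = (v - u) / δ.length := fun u v hu huv hv =>
    δ.progress_sub_of_forall huv fun g hg =>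
      (hS.edge_gap hb hk g hg).imp hv.trans fun h => h.trans hu
  have hdiffm : ∀ u v, b m ≤ u → u ≤ v → v ≤ b (m + 1) →
      δ.progress v - δ.progress u = (v - u) / δ.length := fun u v hu huv hv =>
    δ.progress_sub_of_forall huv fun g hg => by
      have := hS.edge_gap hb hm
      rw [ho] at this
      exact (this g hg).imp hv.trans fun h => h.trans hu
  have htp : δ.clampProgress t = δ.progress t :=
    δ.clampProgress_of_mem ((δ.mem_support_iff).1 (hsupp t ht)).1
  rw [chord, htp, δ.curve_progress (hsupp t ht)]
  refine ⟨fun h1 => ?_, fun h1 => ?_⟩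
  · have h2 := hdiff t (t + h) ht.1 (by linarith) (by linarith)
    rw [add_sub_cancel_left] at h2
    rw [← h2, add_sub_cancel, δ.curve_progress (hsupp _ ⟨by linarith [ht.1], by linarith⟩)]
  -- The progress at the end of an edge and at the start of the next edge of the piece agree, except
  -- where the piece closes up from `1` to `0`; periodicity absorbs that integer.
  · obtain ⟨z, hz⟩ : ∃ z : ℤ, δ.progress (b (k + 1)) = δ.progress (b m) + z := by
      rcases hnext with rfl | hg | ⟨h3, h4⟩
      · exact ⟨0, by simp⟩
      · refine ⟨0, ?_⟩
        have hg' := (hS.gap _ _ _).1 hg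
        have := δ.progress_of_mem_gap hg' (right_mem_Icc.2 (δ.gaps_mem _ hg').2.1.le)
        simp only [] at this
        rw [this]; simp
      · refine ⟨1, ?_⟩
        rw [h3, h4, hS.rgt, hS.lft, δ.progress_right, δ.progress_left]
        simp
    have h2 := hdiff t (b (k + 1)) ht.1 ht.2 le_rfl
    have h3 := hdiffm (b m) (b m + (t + h - b (k + 1))) le_rfl (by linarith) (by linarith [ht.2])
    have h4 : δ.progress t + h / δ.length = δ.progress (b m + (t + h - b (k + 1))) + z := by
      have : h / δ.length = (b (k + 1) - t) / δ.length +
          (b m + (t + h - b (k + 1)) - b m) / δ.length := by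
        rw [← add_div]; congr 1; ring
      rw [this, ← h2, ← h3, hz]; ring
    rw [h4, δ.curve_periodic, δ.curve_progress
      (hsuppm _ ⟨by linarith, by linarith [ht.2]⟩)]

theorem nonvanishingOn_of_edges {f : ℝ → ℂ} {b : ℕ → ℝ} (hb : StrictMono b) (N : ℕ) (hN : 0 < N)
    (h : ∀ k < N, NonvanishingOn f (b k) (b (k + 1))) : NonvanishingOn f (b 0) (b N) := by
  induction N with
  | zero => omega
  | succ n ih =>
    rcases n.eq_zero_or_pos with rfl | hn
    · exact h 0 hN
    · exact (ih hn fun k hk => h k (by omega)).union (h n (by omega)) (hb.monotone n.zero_le)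
        (hb.monotone n.le_succ)

/-- The Whitney indices of the pieces add up to the Whitney index of the curve. -/
theorem Decomposition.sum_logVar_chord {C : ℝ → ℂ} (hC : IsNormalCurve C) {l : ℕ}
    (Γ : Decomposition C l)
    (hnv : ∀ i, ∀ᶠ r in 𝓝[>] (0 : ℝ), NonvanishingOn (chord (Γ.piece i).curve r) 0 1) :
    ∀ᶠ h in 𝓝[>] (0 : ℝ),
      ∑ i, logVar (chord (Γ.piece i).curve (h / (Γ.piece i).length)) 0 1 =
        logVar (chord C h) 0 1 := by
  classical
  obtain ⟨N, b, hb⟩ := hC.exists_isSubdivision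
  obtain ⟨S, hS⟩ := Γ.exists_fits hC hb
  obtain ⟨σ, hσ⟩ := S.exists_next_equiv
  have hmono := hb.strictMono
  have hNpos : 0 < N := by
    rcases N.eq_zero_or_pos with rfl | h
    · have := hb.last; rw [hb.zero] at this; norm_num at this
    · exact h
  choose! u hu using fun p (hp : p ∈ intersectionPoints C) => hC.exists_movesAlong hp
  -- A piece is reparametrized by its total length, so scale `h` on `C` is scale `h / length` on the
  -- piece.
  have ev1 : ∀ᶠ h in 𝓝[>] (0 : ℝ), ∀ i,
      NonvanishingOn (chord (Γ.piece i).curve (h / (Γ.piece i).length)) 0 1 := by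
    rw [eventually_all]
    intro i
    have hL := (Γ.piece i).length_pos
    have : Tendsto (fun h => h / (Γ.piece i).length) (𝓝[>] 0) (𝓝[>] 0) := by
      refine tendsto_nhdsWithin_iff.2 ⟨?_, ?_⟩
      · have h1 : Continuous fun h => h / (Γ.piece i).length := by fun_prop
        have h2 := h1.tendsto 0
        rw [zero_div] at h2
        exact h2.mono_left nhdsWithin_le_nhds
      · filter_upwards [self_mem_nhdsWithin] with x hx
        exact div_pos hx hL
    exact this.eventually (hnv i)
  have ev2 : ∀ᶠ h in 𝓝[>] (0 : ℝ), ∀ k : Fin N, h < b (k + 1) - b k := by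
    rw [eventually_all]
    intro k
    filter_upwards [Ioo_mem_nhdsGT (sub_pos.2 (hmono (Nat.lt_succ_self k)))] with h hh using hh.2
  have hint : ∀ j : ℕ, 0 < j → j < N → C (b j) ∈ intersectionPoints C := fun j h0 hj => by
    have h1 := (hb.mem_iff (b j) (hb.mem_Icc hj.le)).2 ⟨j, hj.le, rfl⟩
    rcases h1 with h1 | h1
    · refine absurd h1 (hC.base_simple _ ⟨?_, ?_⟩)
      · rw [← hb.zero]; exact hmono h0
      · rw [← hb.last]; exact hmono hj
    · exact h1
  have hIco : ∀ j : ℕ, j < N → b j ∈ Ico (0 : ℝ) 1 := fun j hj =>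
    ⟨(hb.mem_Icc hj.le).1, by rw [← hb.last]; exact hmono hj⟩
  have ev3 : ∀ᶠ h in 𝓝[>] (0 : ℝ), ∀ j : Fin N, 0 < (j : ℕ) → ∀ x ∈ Ioc 0 h,
      0 < ((C (b j + x) - C (b j)) / u (C (b j))).re ∧
      0 < ((C (b j) - C (b j - x)) / u (C (b j))).re := by
    rw [eventually_all]
    intro j
    by_cases hj : 0 < (j : ℕ)
    · filter_upwards [eventually_Ioc (hu _ (hint j hj j.2) _ (hIco j j.2) rfl)] with h hh _
      exact hh
    · exact Eventually.of_forall fun h h' => absurd h' hj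
  filter_upwards [ev1, ev2, ev3, self_mem_nhdsWithin] with h hG hlen hpos hh
  have hh : 0 < h := hh
  -- The logarithm of the chord leaving vertex `j`, relative to the half plane chosen there. It is
  -- set to `0` at both ends, since there is no half plane at the base point, which may be a corner.
  set φ : ℕ → ℂ := fun j => if 0 < j ∧ j < N then
    Complex.log ((C (b j + h) - C (b j)) / u (C (b j))) else 0 with hφ
  set G : Fin l → ℝ → ℂ := fun i => chord (Γ.piece i).curve (h / (Γ.piece i).length) with hGdef
  set E : ℕ → ℝ → ℂ := fun k t => G (S.own k) ((Γ.piece (S.own k)).clampProgress t) with hE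
  have hcontf : Continuous (chord C h) := by
    unfold chord
    exact (hC.continuous.comp (by fun_prop)).sub hC.continuous
  have key : ∀ k : Fin N, NonvanishingOn (chord C h) (b k) (b (k + 1)) ∧
      logVar (E k) (b k) (b (k + 1)) =
        logVar (chord C h) (b k) (b (k + 1)) + (φ (σ k) - φ (k + 1)) := by
    intro k
    obtain ⟨ho, hnext⟩ := hσ k
    have hle : b k ≤ b (k + 1) := hmono.monotone (Nat.le_succ k)
    have hEnv : NonvanishingOn (E k) (b k) (b (k + 1)) :=
      ⟨(hG _).1.comp (by fun_prop) fun t _ => ClosedSubcurve.clampProgress_mem _ t,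
        fun t _ => (hG _).2 _ (ClosedSubcurve.clampProgress_mem _ t)⟩
    have hEeq := fun (t : ℝ) (ht : t ∈ Icc (b k) (b (k + 1))) =>
      hS.chord_eq hmono k.2 (σ k).2 ho hnext hh (hlen (σ k)) ht
    -- This covers continuation along the next edge and, by periodicity, passage through the base
    -- point: the chords of the piece are then chords of `C`.
    by_cases hA : ∀ y, C (b (σ k) + y) = C (b (k + 1) + y)
    · have heq : EqOn (E k) (chord C h) (Icc (b k) (b (k + 1))) := by
        intro t ht
        rcases le_total t (b (k + 1) - h) with h1 | h1
        · exact (hEeq t ht).1 h1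
        · refine ((hEeq t ht).2 h1).trans ?_
          rw [hA, add_sub_cancel]; rfl
      have hf : NonvanishingOn (chord C h) (b k) (b (k + 1)) := hEnv.congr heq.symm
      refine ⟨hf, ?_⟩
      rw [logVar_congr hle hf heq]
      have hφeq : φ (σ k) = φ (k + 1) := by
        have h0 := hA 0
        rw [add_zero, add_zero] at h0
        have hiff : (0 < (σ k : ℕ) ∧ (σ k : ℕ) < N) ↔ (0 < (k : ℕ) + 1 ∧ (k : ℕ) + 1 < N) := by
          rcases hnext with h1 | h1 | ⟨h1, h2⟩
          · rw [h1]
          · have := S.gap_mem h1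
            have := S.rgt_le (S.own k)
            omega
          · have h3 := S.lft_lt (S.own k)
            rcases hC.eq_ends_or (hb.mem_Icc (σ k).2.le).1 (hmono (by omega))
              (hb.mem_Icc (Nat.succ_le_of_lt k.2)).2 h0 with ⟨h4, h5⟩ | ⟨h4, h5⟩
            · have h6 : (σ k : ℕ) = 0 := hmono.injective (by rw [h4, hb.zero])
              have h7 : (k : ℕ) + 1 = N := hmono.injective (by rw [hb.last]; exact h5)
              omega
            · rw [← hb.zero, hmono.lt_iff_lt] at h4
              rw [← hb.last] at h5
              have h5 := hmono.lt_iff_lt.1 h5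
              omega
        simp only [hφ, hiff, hA, h0]
      rw [hφeq]; ring
    · -- a genuine change of branch at a crossing
      have hne : (σ k : ℕ) ≠ k + 1 := fun h1 => hA fun y => by rw [h1]
      have hCe : C (b (σ k)) = C (b (k + 1)) := by
        rcases hnext with h1 | h1 | ⟨h1, h2⟩
        · exact absurd h1 hne
        · exact ((Γ.piece (S.own k)).gaps_closed _ ((hS.gap _ _ _).1 h1)).symm
        · rw [h1, h2, hS.lft, hS.rgt]; exact (Γ.piece (S.own k)).closed
      have hin : (0 < (σ k : ℕ)) ∧ (k : ℕ) + 1 < N := by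
        rcases hnext with h1 | h1 | ⟨h1, h2⟩
        · exact absurd h1 hne
        · have := S.gap_mem h1
          have := S.rgt_le (S.own k)
          omega
        · have h3 := S.lft_lt (S.own k)
          rcases hC.eq_ends_or (hb.mem_Icc (σ k).2.le).1 (hmono (by omega))
            (hb.mem_Icc (Nat.succ_le_of_lt k.2)).2 hCe with ⟨h4, h5⟩ | ⟨h4, h5⟩
          · refine absurd (fun y => ?_) hA
            have h5' : b (k + 1) = 1 := h5
            rw [h4, h5', zero_add, add_comm, hC.periodic]
          · rw [← hb.zero, hmono.lt_iff_lt] at h4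
            rw [← hb.last] at h5
            exact ⟨h4, hmono.lt_iff_lt.1 h5⟩
      set e := b (k + 1) with he
      set n := b (σ k) with hn
      have pn := hpos (σ k) hin.1
      have pe := hpos ⟨k + 1, hin.2⟩ (Nat.succ_pos _)
      simp only [← he, ← hn] at pn pe
      rw [hCe] at pn
      have hke : b k ≤ e - h := by
        have := hlen k
        linarith
      have heh : e - h ≤ e := by linarith
      -- Only chords starting in the window `[e - h, e]` see the crossing. There the chords of `C`
      -- and of the piece lie in the same half plane and start equal, so their variations differ by
      -- the difference of the final principal logarithms.
      have hfwin : ∀ t ∈ Icc (e - h) e, 0 < (chord C h t / u (C e)).re := fun t ht => by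
        have := re_chord_pos (C := C) (u := u (C e)) rfl (fun x hx => (pe x hx).1)
          (fun x hx => (pe x hx).2) hh ht
        rwa [add_sub_cancel] at this
      have hEwin : ∀ t ∈ Icc (e - h) e, E k t = C (n + (t + h - e)) - C t := fun t ht =>
        (hEeq t ⟨hke.trans ht.1, ht.2⟩).2 ht.1
      have hEwin' : ∀ t ∈ Icc (e - h) e, 0 < (E k t / u (C e)).re := fun t ht => by
        rw [hEwin t ht]
        exact re_chord_pos hCe (fun x hx => by rw [hCe]; exact (pn x hx).1)
          (fun x hx => (pe x hx).2) hh ht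
      have hEfirst : EqOn (E k) (chord C h) (Icc (b k) (e - h)) := fun t ht =>
        (hEeq t ⟨ht.1, ht.2.trans heh⟩).1 ht.2
      have hf1 : NonvanishingOn (chord C h) (b k) (e - h) :=
        (hEnv.mono le_rfl heh).congr hEfirst.symm
      have hf2 : NonvanishingOn (chord C h) (e - h) e :=
        ⟨hcontf.continuousOn, fun t ht h0 => by
          have := hfwin t ht
          rw [h0, zero_div, Complex.zero_re] at this
          exact lt_irrefl _ this⟩
      have hf := hf1.union hf2 hke heh
      refine ⟨hf, ?_⟩
      rw [← logVar_add hke heh hEnv, ← logVar_add hke heh hf, logVar_congr hke hf1 hEfirst,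
        logVar_halfPlane heh (hEnv.mono hke le_rfl).1 hEwin',
        logVar_halfPlane heh hf2.1 hfwin]
      have h1 : φ (σ k) = Complex.log (E k e / u (C e)) := by
        simp only [hφ, hin.1, (σ k).2, and_self, if_true]
        rw [hEwin e ⟨heh, le_rfl⟩, add_sub_cancel_left, ← hn, hCe]
      have h2 : φ (k + 1) = Complex.log (chord C h e / u (C e)) := by
        simp only [hφ, hin.2, Nat.succ_pos, and_self, if_true]
        rw [chord]
      rw [h1, h2, hEfirst ⟨hke, le_rfl⟩]
      ring
  -- That the chords of `C` do not vanish is deduced from the pieces and the crossings, edge by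
  -- edge.
  have hfall : NonvanishingOn (chord C h) (b 0) (b N) :=
    nonvanishingOn_of_edges hmono N hNpos fun k hk => (key ⟨k, hk⟩).1
  rw [hS.sum_logVar hmono hb.zero hb.last hG
    (fun i => ⟨(Γ.piece i).left_nonneg, (Γ.piece i).right_le_one⟩), ← hb.zero, ← hb.last,
    ← sum_logVar hmono.monotone N hfall, ← Fin.sum_univ_eq_sum_range, ← Fin.sum_univ_eq_sum_range]
  rw [Finset.sum_congr rfl fun k _ => (key k).2, Finset.sum_add_distrib, Finset.sum_sub_distrib]
  -- The corrections cancel: `σ` permutes the edges, and the shift by one is harmless because `φ`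
  -- vanishes at `0` and `N`.
  have e1 : ∑ k : Fin N, φ (σ k) = ∑ k : Fin N, φ k := Equiv.sum_comp σ fun k : Fin N => φ k
  have e2 : ∑ k : Fin N, φ (k + 1) = ∑ k : Fin N, φ k := by
    rw [Fin.sum_univ_eq_sum_range (fun k => φ (k + 1)), Fin.sum_univ_eq_sum_range]
    have h1 := Finset.sum_range_succ φ N
    have h2 := Finset.sum_range_succ' φ N
    have h3 : φ 0 = 0 := by simp [hφ]
    have h4 : φ N = 0 := by simp [hφ]
    rw [h4, add_zero] at h1
    rw [h3, add_zero] at h2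
    rw [← h2, h1]
  rw [e1, e2, sub_self, add_zero]

/-! ### Contracting the pieces of a list -/

section Contract

variable {C : ℝ → ℂ}

/-- The list of pieces can be contracted one after the other, starting from the curve `D`: when its
turn comes, each piece is a part of the current curve. -/
def IsContractible : List (ClosedSubcurve C × (ℂ → ℂ)) → (ℝ → ℂ) → Prop
  | [], D => Continuous D
  | x :: L, D => Continuous D ∧ ContinuousOn x.2 disk ∧ x.2 1 = x.1.root ∧
      (∀ t ∈ Icc x.1.left x.1.right, D t = x.2 (circ (x.1.progress t))) ∧
      IsContractible L (afterContraction x.1 D)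

/-- The curve that is left when all the pieces of the list have been contracted. -/
def afterList : List (ClosedSubcurve C × (ℂ → ℂ)) → (ℝ → ℂ) → ℝ → ℂ
  | [], D => D
  | x :: L, D => afterList L (afterContraction x.1 D)

theorem IsContractible.continuous {L : List (ClosedSubcurve C × (ℂ → ℂ))} {D : ℝ → ℂ}
    (h : IsContractible L D) : Continuous D := by
  cases L with
  | nil => exact h
  | cons x L => exact h.1

theorem retract_mem_disk {s : ℝ} (hs : s ∈ Icc (0 : ℝ) 1) {z : ℂ} (hz : ‖z‖ = 1) :
    (1 - s : ℂ) * z + s ∈ disk := by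
  have e : (1 - s : ℂ) = ((1 - s : ℝ) : ℂ) := by push_cast; rfl
  rw [disk, mem_closedBall_zero_iff]
  refine (norm_add_le _ _).trans ?_
  rw [norm_mul, hz, e, Complex.norm_real, Complex.norm_real, Real.norm_of_nonneg hs.1,
    Real.norm_of_nonneg (by linarith [hs.2])]
  linarith

section Piece

variable {γ : ClosedSubcurve C} {F : ℂ → ℂ} {D : ℝ → ℂ}

theorem contractPiece_of_mem {s t : ℝ} (ht : t ∈ Icc γ.left γ.right) :
    contractPiece γ F D (s, t) = F ((1 - s : ℂ) * circ (γ.progress t) + s) := by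
  rw [contractPiece, if_pos ht]

theorem contractPiece_of_notMem {s t : ℝ} (ht : t ∉ Icc γ.left γ.right) :
    contractPiece γ F D (s, t) = D t := by
  rw [contractPiece, if_neg ht]

theorem contractPiece_zero (h : ∀ t ∈ Icc γ.left γ.right, D t = F (circ (γ.progress t))) (t : ℝ) :
    contractPiece γ F D (0, t) = D t := by
  by_cases ht : t ∈ Icc γ.left γ.right
  · rw [contractPiece_of_mem ht, h t ht]; simp
  · exact contractPiece_of_notMem ht

theorem contractPiece_one (h1 : F 1 = γ.root) (t : ℝ) :
    contractPiece γ F D (1, t) = afterContraction γ D t := by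
  by_cases ht : t ∈ Icc γ.left γ.right
  · rw [contractPiece_of_mem ht, afterContraction, if_pos ht]; simp [h1]
  · rw [contractPiece_of_notMem ht, afterContraction, if_neg ht]

theorem contractPiece_of_notMem_Ioo (h : ∀ t ∈ Icc γ.left γ.right, D t = F (circ (γ.progress t)))
    {t : ℝ} (ht : t ∉ Ioo γ.left γ.right) (s : ℝ) : contractPiece γ F D (s, t) = D t := by
  by_cases htI : t ∈ Icc γ.left γ.right
  · rw [contractPiece_of_mem htI, h t htI]
    have : circ (γ.progress t) = 1 := by
      rcases htI.1.eq_or_lt with rfl | h1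
      · rw [γ.progress_left, circ_zero]
      · rcases htI.2.eq_or_lt with rfl | h2
        · rw [γ.progress_right, circ_one]
        · exact absurd ⟨h1, h2⟩ ht
    rw [this]; congr 1; ring
  · exact contractPiece_of_notMem htI

theorem continuousOn_contractPiece (hD : Continuous D) (hF : ContinuousOn F disk)
    (h : ∀ t ∈ Icc γ.left γ.right, D t = F (circ (γ.progress t))) :
    ContinuousOn (contractPiece γ F D) (Icc 0 1 ×ˢ univ) := by
  classical
  have hcl : IsClosed {p : ℝ × ℝ | p.2 ∈ Icc γ.left γ.right} := isClosed_Icc.preimage continuous_snd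
  have : contractPiece γ F D = fun p : ℝ × ℝ => if p.2 ∈ Icc γ.left γ.right then
      F ((1 - p.1 : ℂ) * circ (γ.progress p.2) + p.1) else D p.2 := by
    funext p
    by_cases hp : p.2 ∈ Icc γ.left γ.right
    · rw [contractPiece, if_pos hp]
    · rw [contractPiece, if_neg hp]
  rw [this]
  refine ContinuousOn.if ?_ ?_ ?_
  · rintro ⟨s, t⟩ ⟨hs, hfr⟩
    have h1 := continuous_snd.frontier_preimage_subset (Icc γ.left γ.right) hfr
    rw [frontier_Icc γ.left_lt_right.le] at h1
    have htI : t ∈ Icc γ.left γ.right := by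
      rcases h1 with h1 | h1
      · exact ⟨h1.ge, h1.le.trans γ.left_lt_right.le⟩
      · exact ⟨γ.left_lt_right.le.trans h1.ge, h1.le⟩
    refine (contractPiece_of_mem (D := D) htI).symm.trans
      (contractPiece_of_notMem_Ioo h (fun hI => ?_) s)
    obtain ⟨h2, h3⟩ := hI
    rcases h1 with h1 | h1
    · exact h2.ne h1.symm
    · exact h3.ne h1
  · rw [hcl.closure_eq]
    refine hF.comp (by fun_prop) ?_
    rintro ⟨s, t⟩ ⟨⟨hs, -⟩, -⟩
    exact retract_mem_disk hs (norm_circ _)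
  · fun_prop

theorem continuous_afterContraction (hD : Continuous D)
    (hl : D γ.left = γ.root) (hr : D γ.right = γ.root) :
    Continuous (afterContraction γ D) := by
  classical
  have : afterContraction γ D = fun t => if t ∈ Icc γ.left γ.right then γ.root else D t := by
    funext t
    by_cases ht : t ∈ Icc γ.left γ.right
    · rw [afterContraction, if_pos ht]
    · rw [afterContraction, if_neg ht]
  rw [this]
  refine Continuous.if (fun t ht => ?_) continuous_const hD
  have h1 : t ∈ frontier (Icc γ.left γ.right) := ht
  rw [frontier_Icc γ.left_lt_right.le] at h1
  rcases h1 with rfl | rfl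
  · exact hl.symm
  · exact hr.symm

end Piece

theorem concat_of_le {H₁ H₂ : ℝ × ℝ → ℂ} {s t : ℝ} (hs : s ≤ 1 / 2) :
    concat H₁ H₂ (s, t) = H₁ (2 * s, t) := by
  rw [concat, if_pos hs]

theorem concat_of_ge {H₁ H₂ : ℝ × ℝ → ℂ} (h : ∀ t, H₁ (1, t) = H₂ (0, t)) {s t : ℝ}
    (hs : 1 / 2 ≤ s) : concat H₁ H₂ (s, t) = H₂ (2 * s - 1, t) := by
  rcases hs.eq_or_lt with rfl | hs
  · rw [concat_of_le le_rfl]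
    norm_num [h]
  · rw [concat, if_neg (not_le.2 hs)]

theorem continuousOn_concat {H₁ H₂ : ℝ × ℝ → ℂ} (h₁ : ContinuousOn H₁ (Icc 0 1 ×ˢ univ))
    (h₂ : ContinuousOn H₂ (Icc 0 1 ×ˢ univ)) (h : ∀ t, H₁ (1, t) = H₂ (0, t)) :
    ContinuousOn (concat H₁ H₂) (Icc 0 1 ×ˢ univ) := by
  have e : (Icc 0 1 ×ˢ univ : Set (ℝ × ℝ)) = Icc 0 (1 / 2) ×ˢ univ ∪ Icc (1 / 2) 1 ×ˢ univ := by
    rw [← union_prod, Icc_union_Icc_eq_Icc (by norm_num) (by norm_num)]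
  rw [e]
  refine ContinuousOn.union_of_isClosed ?_ ?_ (isClosed_Icc.prod isClosed_univ)
    (isClosed_Icc.prod isClosed_univ)
  · refine (h₁.comp (f := fun p : ℝ × ℝ => (2 * p.1, p.2)) (by fun_prop) ?_).congr ?_
    · rintro ⟨s, t⟩ ⟨hs, -⟩
      exact ⟨⟨by linarith [hs.1], by linarith [hs.2]⟩, mem_univ _⟩
    · rintro ⟨s, t⟩ ⟨hs, -⟩
      exact concat_of_le hs.2
  · refine (h₂.comp (f := fun p : ℝ × ℝ => (2 * p.1 - 1, p.2)) (by fun_prop) ?_).congr ?_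
    · rintro ⟨s, t⟩ ⟨hs, -⟩
      exact ⟨⟨by linarith [hs.1], by linarith [hs.2]⟩, mem_univ _⟩
    · rintro ⟨s, t⟩ ⟨hs, -⟩
      exact concat_of_ge h hs.1

theorem contractList_zero {L : List (ClosedSubcurve C × (ℂ → ℂ))} {D : ℝ → ℂ}
    (h : IsContractible L D) (t : ℝ) : contractList L D (0, t) = D t := by
  match L, h with
  | [], _ => rfl
  | [x], h => exact contractPiece_zero h.2.2.2.1 t
  | x :: y :: L, h =>
    rw [contractList, concat_of_le (by norm_num), mul_zero]
    exact contractPiece_zero h.2.2.2.1 t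

theorem contractPiece_one_eq {x y : ClosedSubcurve C × (ℂ → ℂ)}
    {L : List (ClosedSubcurve C × (ℂ → ℂ))} {D : ℝ → ℂ} (h : IsContractible (x :: y :: L) D)
    (t : ℝ) : contractPiece x.1 x.2 D (1, t) =
      contractList (y :: L) (afterContraction x.1 D) (0, t) := by
  rw [contractPiece_one h.2.2.1, contractList_zero h.2.2.2.2]

theorem contractList_one {L : List (ClosedSubcurve C × (ℂ → ℂ))} {D : ℝ → ℂ}
    (h : IsContractible L D) (t : ℝ) : contractList L D (1, t) = afterList L D t := by
  match L, h with
  | [], _ => rfl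
  | [x], h => exact contractPiece_one h.2.2.1 t
  | x :: y :: L, h =>
    rw [contractList, concat_of_ge (contractPiece_one_eq h) (by norm_num)]
    norm_num
    exact contractList_one h.2.2.2.2 t

theorem continuousOn_contractList {L : List (ClosedSubcurve C × (ℂ → ℂ))} {D : ℝ → ℂ}
    (h : IsContractible L D) : ContinuousOn (contractList L D) (Icc 0 1 ×ˢ univ) := by
  match L, h with
  | [], h => exact (h.continuous.comp continuous_snd).continuousOn
  | [x], h => exact continuousOn_contractPiece h.1 h.2.1 h.2.2.2.1
  | x :: y :: L, h =>
    exact continuousOn_concat (continuousOn_contractPiece h.1 h.2.1 h.2.2.2.1)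
      (continuousOn_contractList h.2.2.2.2) (contractPiece_one_eq h)

theorem contractList_of_notMem {L : List (ClosedSubcurve C × (ℂ → ℂ))} {D : ℝ → ℂ}
    (h : IsContractible L D) {t : ℝ} (ht : ∀ x ∈ L, t ∉ Ioo x.1.left x.1.right) {s : ℝ} :
    contractList L D (s, t) = D t := by
  match L, h with
  | [], h => rfl
  | [x], h => exact contractPiece_of_notMem_Ioo h.2.2.2.1 (ht x (by simp)) s
  | x :: y :: L, h =>
    have h1 := fun s => contractPiece_of_notMem_Ioo h.2.2.2.1 (ht x (by simp)) s
    rcases le_total s (1 / 2) with hs | hs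
    · rw [contractList, concat_of_le hs, h1]
    · rw [contractList, concat_of_ge (contractPiece_one_eq h) hs, contractList_of_notMem h.2.2.2.2
        fun z hz => ht z (List.mem_cons_of_mem _ hz), ← contractPiece_one h.2.2.1, h1]

end Contract

/-! ### The order of the contractions -/

section Order

variable {C : ℝ → ℂ} {l : ℕ}

/-- The pieces in the order `P 0, P 1, …`, from the last of the first `m` to the first. -/
def reverseList (P : ℕ → ClosedSubcurve C × (ℂ → ℂ)) (m : ℕ) :
    List (ClosedSubcurve C × (ℂ → ℂ)) := ((List.range m).map P).reverse

theorem reverseList_succ (P : ℕ → ClosedSubcurve C × (ℂ → ℂ)) (m : ℕ) :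
    reverseList P (m + 1) = P m :: reverseList P m := by
  simp [reverseList, List.range_succ]

open Classical in
/-- The current curve when the pieces `P j`, `m ≤ j < l`, have been contracted. -/
def currentCurve (P : ℕ → ClosedSubcurve C × (ℂ → ℂ)) (l m : ℕ) (t : ℝ) : ℂ :=
  -- Contraction goes from the last piece to the first, so the least such index belongs to the most
  -- recent contraction over `t`, which fixes the position.
  if h : ∃ j, m ≤ j ∧ j < l ∧ t ∈ Icc (P j).1.left (P j).1.right then
    (P (Nat.find h)).1.root else C t

theorem currentCurve_eq_root {P : ℕ → ClosedSubcurve C × (ℂ → ℂ)} {m j : ℕ} {t : ℝ}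
    (hmj : m ≤ j) (hjl : j < l) (ht : t ∈ Icc (P j).1.left (P j).1.right)
    (hmin : ∀ i, m ≤ i → i < l → t ∈ Icc (P i).1.left (P i).1.right → j ≤ i) :
    currentCurve P l m t = (P j).1.root := by
  classical
  have h : ∃ j, m ≤ j ∧ j < l ∧ t ∈ Icc (P j).1.left (P j).1.right := ⟨j, hmj, hjl, ht⟩
  have hf : Nat.find h = j := by
    obtain ⟨h1, h2, h3⟩ := Nat.find_spec h
    exact le_antisymm (Nat.find_min' h ⟨hmj, hjl, ht⟩) (hmin _ h1 h2 h3)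
  rw [currentCurve, dif_pos h, hf]

theorem currentCurve_eq_self {P : ℕ → ClosedSubcurve C × (ℂ → ℂ)} {m : ℕ} {t : ℝ}
    (h : ∀ j, m ≤ j → j < l → t ∉ Icc (P j).1.left (P j).1.right) :
    currentCurve P l m t = C t := by
  rw [currentCurve, dif_neg]
  rintro ⟨j, h1, h2, h3⟩
  exact h j h1 h2 h3

theorem currentCurve_last (P : ℕ → ClosedSubcurve C × (ℂ → ℂ)) : currentCurve P l l = C := by
  funext t
  exact currentCurve_eq_self fun j h1 h2 => absurd h2 (not_lt.2 h1)

theorem afterContraction_currentCurve (P : ℕ → ClosedSubcurve C × (ℂ → ℂ)) {m : ℕ} (hm : m < l) :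
    afterContraction (P m).1 (currentCurve P l (m + 1)) = currentCurve P l m := by
  classical
  funext t
  by_cases ht : t ∈ Icc (P m).1.left (P m).1.right
  · rw [afterContraction, if_pos ht, currentCurve_eq_root le_rfl hm ht fun i h _ _ => h]
  · rw [afterContraction, if_neg ht]
    by_cases h : ∃ j, m + 1 ≤ j ∧ j < l ∧ t ∈ Icc (P j).1.left (P j).1.right
    · obtain ⟨h1, h2, h3⟩ := Nat.find_spec h
      rw [currentCurve_eq_root h1 h2 h3 fun i hi hil hit => Nat.find_min' h ⟨hi, hil, hit⟩,
        currentCurve_eq_root (Nat.le_of_succ_le h1) h2 h3 fun i hi hil hit => ?_]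
      rcases hi.eq_or_lt with rfl | hi
      · exact absurd hit ht
      · exact Nat.find_min' h ⟨hi, hil, hit⟩
    · push Not at h
      rw [currentCurve_eq_self fun j h1 h2 => h j h1 h2, currentCurve_eq_self fun j h1 h2 => ?_]
      rcases h1.eq_or_lt with rfl | h1
      · exact ht
      · exact h j h1 h2

theorem afterList_reverseList (P : ℕ → ClosedSubcurve C × (ℂ → ℂ)) (m : ℕ) (hm : m ≤ l) :
    afterList (reverseList P m) (currentCurve P l m) = currentCurve P l 0 := by
  induction m with
  | zero => rfl
  | succ m ih =>
    rw [reverseList_succ, afterList, afterContraction_currentCurve P (by omega), ih (by omega)]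

/-- The data of an induced homotopy: the pieces in an admissible order, with the disks that they
bound. -/
structure IsOrdered (Γ : Decomposition C l) (P : ℕ → ClosedSubcurve C × (ℂ → ℂ))
    (e : Equiv.Perm (Fin l)) : Prop where
  piece : ∀ i : Fin l, (P i).1 = Γ.piece (e i)
  root : ∀ i j, i < j → (Γ.piece (e i)).root ∉ (Γ.piece (e j)).trace
  disk : ∀ i : Fin l, IsImmersedDisk (P i).2 (P i).1.curve

variable {Γ : Decomposition C l} {P : ℕ → ClosedSubcurve C × (ℂ → ℂ)} {e : Equiv.Perm (Fin l)}

/-- A piece that starts where a gap of another starts has its root on that other piece, which must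
therefore come earlier. This is the hypothesis on ranks in `PieceSystem.walk`. -/
theorem IsOrdered.rank_lt (h : IsOrdered Γ P e) {N : ℕ} {b : ℕ → ℝ} {S : PieceSystem (Fin l) N}
    (hS : Fits S Γ.piece b) {i j : Fin l} {c d : ℕ} (hg : S.gap i c d) (hj : S.lft j = c) :
    (e.symm i : ℕ) < e.symm j := by
  by_contra hcon
  rcases (not_lt.1 hcon).eq_or_lt with h1 | h1
  · have hij : j = i := e.symm.injective (Fin.ext h1)
    have := S.gap_mem hg
    rw [hij] at hj
    omega
  · have h2 := h.root (e.symm j) (e.symm i) h1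
    rw [e.apply_symm_apply, e.apply_symm_apply] at h2
    refine h2 ⟨b c, (Γ.piece i).fst_mem_support ((hS.gap _ _ _).1 hg), ?_⟩
    rw [ClosedSubcurve.root, ← hS.lft, hj]

/-- When its turn comes, a piece is a part of the current curve. -/
theorem IsOrdered.currentCurve_eq (hC : IsNormalCurve C) (h : IsOrdered Γ P e) {m : ℕ} (hm : m < l)
    (hcont : Continuous (currentCurve P l (m + 1))) {t : ℝ}
    (ht : t ∈ Icc (P m).1.left (P m).1.right) :
    currentCurve P l (m + 1) t = (P m).2 (circ ((P m).1.progress t)) := by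
  obtain ⟨N, b, hb⟩ := hC.exists_isSubdivision
  obtain ⟨S, hS⟩ := Γ.exists_fits hC hb
  have hmono := hb.strictMono
  rw [(h.disk ⟨m, hm⟩).boundary]
  set i := e ⟨m, hm⟩ with hi
  have hPm : (P m).1 = Γ.piece i := h.piece ⟨m, hm⟩
  have hrank : e.symm i = ⟨m, hm⟩ := e.symm_apply_apply _
  have hPr : ∀ j : Fin l, (P (e.symm j)).1 = Γ.piece j := fun j => by
    rw [h.piece, e.apply_symm_apply]
  simp only [hPm] at ht ⊢
  have hedge : ∀ k, S.lft i ≤ k → k < S.rgt i → EqOn (currentCurve P l (m + 1))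
      (fun t => (Γ.piece i).curve ((Γ.piece i).progress t)) (Ioo (b k) (b (k + 1))) := by
    intro k hk1 hk2 t ht
    have hkN : k < N := hk2.trans_le (S.rgt_le i)
    have hmem : ∀ j : ℕ, ∀ hj : j < l, t ∈ Icc (P j).1.left (P j).1.right ↔
        S.lft (e ⟨j, hj⟩) ≤ k ∧ k < S.rgt (e ⟨j, hj⟩) := by
      intro j hj
      rw [show (P j).1 = Γ.piece (e ⟨j, hj⟩) from h.piece ⟨j, hj⟩, ← hS.lft, ← hS.rgt]
      constructor
      · rintro ⟨h1, h2⟩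
        have h3 := hmono.lt_iff_lt.1 (h1.trans_lt ht.2)
        have h4 := hmono.lt_iff_lt.1 (ht.1.trans_le h2)
        omega
      · rintro ⟨h1, h2⟩
        exact ⟨(hmono.monotone h1).trans ht.1.le, ht.2.le.trans (hmono.monotone h2)⟩
    obtain ⟨hA, hB⟩ := S.walk (rank := fun i => (e.symm i : ℕ))
      (fun i j hij => e.symm.injective (Fin.ext hij)) (fun hg hj => h.rank_lt hS hg hj) k hkN
    -- On an edge owned by piece `i` the owner has the greatest rank, so nothing over it has been
    -- contracted and the current curve is still `C`.
    by_cases ho : S.own k = i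
    · have hs := hS.edge_subset hmono hkN (Ioo_subset_Icc_self ht)
      rw [ho] at hs
      simp only []
      rw [(Γ.piece i).curve_progress hs]
      refine currentCurve_eq_self fun j hmj hjl hjt => ?_
      obtain ⟨h1, h2⟩ := (hmem j hjl).1 hjt
      have := hA _ h1 h2
      rw [ho, hrank, e.symm_apply_apply] at this
      simp only [] at this
      omega
    -- Over a gap of piece `i`, the contracted piece of least rank fills the whole gap, and its root
    -- is the point at which `i` pauses.
    · have hgap : ∃ c d, S.gap i c d ∧ c ≤ k ∧ k < d := by
        by_contra! hcon
        refine ho ((S.own_iff hkN).2 ⟨hk1, hk2, fun c d hcd => ?_⟩)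
        by_contra! h3
        exact absurd (hcon c d hcd h3.1) (by omega)
      obtain ⟨c, d, hcd, hck, hkd⟩ := hgap
      obtain ⟨n, hn1, hn2, hn3, hn4⟩ := hB i c d hcd hck hkd
      have hg := (hS.gap _ _ _).1 hcd
      simp only []
      rw [(Γ.piece i).curve_progress_of_mem_gap hg
        ⟨(hmono.monotone hck).trans ht.1.le, ht.2.le.trans (hmono.monotone hkd)⟩]
      rw [hrank] at hn3 hn4
      rw [currentCurve_eq_root (j := e.symm n) hn3 (e.symm n).2
        ((hmem _ (e.symm n).2).2 (by
          rw [Fin.eta, e.apply_symm_apply, hn1, hn2]; exact ⟨hck, hkd⟩)) fun j hmj hjl hjt => ?_,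
        hPr, ClosedSubcurve.root, ← hS.lft, hn1]
      obtain ⟨h1, h2⟩ := (hmem j hjl).1 hjt
      have := hn4 _ h1 h2
      rw [e.symm_apply_apply] at this
      exact this hmj
  have hcurve : Continuous fun t => (Γ.piece i).curve ((Γ.piece i).progress t) := by
    have h1 := (h.disk ⟨m, hm⟩).continuous
    simp only [hPm] at h1
    exact h1.comp (by fun_prop)
  -- Open edges suffice: both sides are continuous, so equality extends to the vertices.
  have hclosed : ∀ k, S.lft i ≤ k → k < S.rgt i → ∀ t ∈ Icc (b k) (b (k + 1)),
      currentCurve P l (m + 1) t = (Γ.piece i).curve ((Γ.piece i).progress t) := by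
    intro k hk1 hk2 t ht
    have := (hedge k hk1 hk2).closure hcont hcurve
    rw [closure_Ioo (hmono (Nat.lt_succ_self k)).ne] at this
    exact this ht
  rcases ht.2.eq_or_lt with htr | htr
  · have h1 := S.lft_lt i
    refine hclosed (S.rgt i - 1) (by omega) (by omega) t ?_
    rw [Nat.sub_add_cancel (by omega), hS.rgt, htr]
    exact ⟨by rw [← hS.rgt]; exact hmono.monotone (by omega), le_rfl⟩
  · obtain ⟨k, hkN, hk⟩ := hb.exists_edge (t := t)
      ⟨(Γ.piece i).left_nonneg.trans ht.1, htr.trans_le (Γ.piece i).right_le_one⟩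
    refine hclosed k ?_ ?_ t (Ico_subset_Icc_self hk)
    · have h1 := ht.1.trans_lt hk.2
      rw [← hS.lft, hmono.lt_iff_lt] at h1
      omega
    · have h1 := hk.1.trans_lt htr
      rwa [← hS.rgt, hmono.lt_iff_lt] at h1

theorem IsOrdered.apply_one (h : IsOrdered Γ P e) {m : ℕ} (hm : m < l) :
    (P m).2 1 = (P m).1.root := by
  rw [← circ_zero, (h.disk ⟨m, hm⟩).boundary]
  exact (P m).1.curve_zero

/-- Downward induction on `m`: continuity at one stage identifies the next piece as part of the
current curve, so the contracted part joins the rest at its two ends. -/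
theorem IsOrdered.continuous_currentCurve (hC : IsNormalCurve C) (h : IsOrdered Γ P e) {m : ℕ}
    (hm : m ≤ l) : Continuous (currentCurve P l m) := by
  induction hm using Nat.decreasingInduction with
  | self => rw [currentCurve_last]; exact hC.continuous
  | of_succ m hm ih =>
    rw [← afterContraction_currentCurve P hm]
    refine continuous_afterContraction ih ?_ ?_
    · rw [h.currentCurve_eq hC hm ih (left_mem_Icc.2 (P m).1.left_lt_right.le),
        (P m).1.progress_left, circ_zero, h.apply_one hm]
    · rw [h.currentCurve_eq hC hm ih (right_mem_Icc.2 (P m).1.left_lt_right.le),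
        (P m).1.progress_right, circ_one, h.apply_one hm]

theorem IsOrdered.isContractible (hC : IsNormalCurve C) (h : IsOrdered Γ P e) :
    IsContractible (reverseList P l) C := by
  have key : ∀ m ≤ l, IsContractible (reverseList P m) (currentCurve P l m) := by
    intro m
    induction m with
    | zero => exact fun _ => h.continuous_currentCurve hC (Nat.zero_le l)
    | succ m ih =>
      intro hm
      rw [reverseList_succ]
      refine ⟨h.continuous_currentCurve hC hm, (h.disk ⟨m, hm⟩).continuousOn, h.apply_one hm,
        fun t ht => h.currentCurve_eq hC hm (h.continuous_currentCurve hC hm) ht, ?_⟩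
      rw [afterContraction_currentCurve P hm]
      exact ih (by omega)
  have := key l le_rfl
  rwa [currentCurve_last] at this

/-- The first piece in the order is the one through the base point. -/
theorem IsOrdered.first (hC : IsNormalCurve C) (h : IsOrdered Γ P e) (hl : 0 < l) :
    (P 0).1.left = 0 ∧ (P 0).1.right = 1 := by
  obtain ⟨N, b, hb⟩ := hC.exists_isSubdivision
  obtain ⟨S, hS⟩ := Γ.exists_fits hC hb
  rw [show (P 0).1 = Γ.piece (e ⟨0, hl⟩) from h.piece ⟨0, hl⟩]
  set i := e ⟨0, hl⟩ with hi
  have h0 : S.lft i = 0 := by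
    by_contra hne
    obtain ⟨j, hj⟩ := S.exists_gap_of_lft_ne_zero hne
    have := h.rank_lt hS hj rfl
    rw [hi, e.symm_apply_apply] at this
    exact Nat.not_lt_zero _ this
  have h1 : (Γ.piece i).left = 0 := by rw [← hS.lft, h0, hb.zero]
  refine ⟨h1, ?_⟩
  rcases hC.eq_ends_or (Γ.piece i).left_nonneg (Γ.piece i).left_lt_right
    (Γ.piece i).right_le_one (Γ.piece i).closed with ⟨-, h2⟩ | ⟨h2, -⟩
  · exact h2
  · linarith

theorem Decomposition.pos (Γ : Decomposition C l) : 0 < l := by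
  have : C 0 ∈ ⋃ i, (Γ.piece i).trace := by rw [Γ.iUnion_trace]; exact mem_range_self 0
  obtain ⟨i, -⟩ := mem_iUnion.1 this
  exact i.pos

theorem mem_reverseList {x : ClosedSubcurve C × (ℂ → ℂ)} {m : ℕ} :
    x ∈ reverseList P m ↔ ∃ j < m, P j = x := by
  simp [reverseList]

/-- The first piece spans all of `[0,1]` with root the base point and is contracted last. The base
point never moves, because `0` and `1` are interior to no piece. -/
theorem IsOrdered.isNullHomotopy (hC : IsNormalCurve C) (h : IsOrdered Γ P e) :
    IsNullHomotopy C (contractList (reverseList P l) C) := by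
  have hc := h.isContractible hC
  have hends : ∀ t, (t = 0 ∨ t = 1) → ∀ x ∈ reverseList P l, t ∉ Ioo x.1.left x.1.right := by
    rintro t ht x - ⟨h1, h2⟩
    have := x.1.left_nonneg
    have := x.1.right_le_one
    rcases ht with rfl | rfl <;> linarith
  refine ⟨(continuousOn_contractList hc).mono (prod_mono subset_rfl (subset_univ _)),
    fun t _ => contractList_zero hc t, fun t ht => ?_,
    fun s _ => contractList_of_notMem hc (hends 0 (Or.inl rfl)),
    fun s _ => (contractList_of_notMem hc (hends 1 (Or.inr rfl))).trans hC.apply_one⟩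
  rw [contractList_one hc]
  have h1 := afterList_reverseList P l le_rfl
  rw [currentCurve_last] at h1
  obtain ⟨h2, h3⟩ := h.first hC Γ.pos
  rw [h1, currentCurve_eq_root (j := 0) le_rfl Γ.pos (by rw [h2, h3]; exact ht)
    fun i _ _ _ => Nat.zero_le i, ClosedSubcurve.root, h2]

end Order

/-! ### The components of the fibres of a contraction -/

/-- `S` is the union of `n` disjoint closed connected sets. -/
def HasComponents (S : Set (ℝ × ℝ)) (n : ℕ) : Prop :=
  ∃ (ι : Type) (_ : Fintype ι) (f : ι → Set (ℝ × ℝ)), (∀ i, IsClosed (f i)) ∧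
    (∀ i, IsConnected (f i)) ∧ (∀ i j, i ≠ j → Disjoint (f i) (f j)) ∧ ⋃ i, f i = S ∧
    Fintype.card ι = n

/-- Finitely many disjoint closed sets are open in their union, so the index is a continuous map to
a discrete space; connectedness makes it injective on components. -/
theorem HasComponents.card_eq {S : Set (ℝ × ℝ)} {n : ℕ} (h : HasComponents S n) :
    ENat.card (ConnectedComponents S) = n := by
  classical
  obtain ⟨ι, _, f, hcl, hconn, hdisj, hU, rfl⟩ := h
  let _ : TopologicalSpace ι := ⊥
  have : DiscreteTopology ι := ⟨rfl⟩
  have hex : ∀ p : S, ∃ i, (p : ℝ × ℝ) ∈ f i := fun p =>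
    mem_iUnion.1 (hU.symm.subset p.2)
  choose g hg using hex
  have huniq : ∀ (p : S) i, (p : ℝ × ℝ) ∈ f i → g p = i := fun p i hi => by
    by_contra hne
    exact disjoint_left.1 (hdisj _ _ hne) (hg p) hi
  have hpre : ∀ i, g ⁻¹' {i} = Subtype.val ⁻¹' f i := fun i => by
    ext p
    exact ⟨fun h => by rw [← (h : g p = i)]; exact hg p, fun h => huniq p i h⟩
  have hcont : Continuous g := by
    refine continuous_discrete_rng.2 fun i => ?_
    rw [← isClosed_compl_iff]
    have : (g ⁻¹' {i})ᶜ = ⋃ j ∈ {j | j ≠ i}, g ⁻¹' {j} := by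
      ext p
      simp
    rw [this]
    refine (toFinite _).isClosed_biUnion fun j _ => ?_
    rw [hpre]
    exact (hcl j).preimage continuous_subtype_val
  have hsub : ∀ i, f i ⊆ S := fun i => by rw [← hU]; exact subset_iUnion f i
  have hbij : Function.Bijective hcont.connectedComponentsLift := by
    constructor
    · intro a b hab
      obtain ⟨p, rfl⟩ := ConnectedComponents.surjective_coe a
      obtain ⟨q, rfl⟩ := ConnectedComponents.surjective_coe b
      have hab' : g p = g q := hab
      rw [ConnectedComponents.coe_eq_coe']
      have hpc : IsPreconnected (Subtype.val ⁻¹' f (g q) : Set S) := by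
        rw [← Topology.IsInducing.subtypeVal.isPreconnected_image, Subtype.image_preimage_coe,
          inter_eq_right.2 (hsub _)]
        exact (hconn _).isPreconnected
      exact hpc.subset_connectedComponent (hg q) (by rw [← hab']; exact hg p)
    · intro i
      obtain ⟨p, hp⟩ := (hconn i).nonempty
      exact ⟨((⟨p, hsub i hp⟩ : S) : ConnectedComponents S), huniq ⟨p, hsub i hp⟩ i hp⟩
  rw [ENat.card_congr (Equiv.ofBijective _ hbij), ENat.card_eq_coe_fintype_card]

theorem HasComponents.union {S S' : Set (ℝ × ℝ)} {n n' : ℕ} (h : HasComponents S n)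
    (h' : HasComponents S' n') (hd : Disjoint S S') : HasComponents (S ∪ S') (n + n') := by
  obtain ⟨ι, _, f, hcl, hconn, hdisj, rfl, rfl⟩ := h
  obtain ⟨ι', _, f', hcl', hconn', hdisj', rfl, rfl⟩ := h'
  refine ⟨ι ⊕ ι', inferInstance, Sum.elim f f', ?_, ?_, ?_, ?_, Fintype.card_sum⟩
  · rintro (i | i)
    exacts [hcl i, hcl' i]
  · rintro (i | i)
    exacts [hconn i, hconn' i]
  · rintro (i | i) (j | j) hij
    · exact hdisj i j fun h => hij (by rw [h])
    · exact hd.mono (subset_iUnion f i) (subset_iUnion f' j)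
    · exact hd.symm.mono (subset_iUnion f' i) (subset_iUnion f j)
    · exact hdisj' i j fun h => hij (by rw [h])
  · rw [iUnion_sum]
    rfl

theorem HasComponents.image {S : Set (ℝ × ℝ)} {n : ℕ} (h : HasComponents S n)
    (φ : (ℝ × ℝ) ≃ₜ (ℝ × ℝ)) : HasComponents (φ '' S) n := by
  obtain ⟨ι, _, f, hcl, hconn, hdisj, rfl, rfl⟩ := h
  exact ⟨ι, inferInstance, fun i => φ '' f i, fun i => φ.isClosed_image.2 (hcl i),
    fun i => (hconn i).image _ φ.continuous.continuousOn,
    fun i j hij => (disjoint_image_iff φ.injective).2 (hdisj i j hij), by rw [image_iUnion], rfl⟩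

/-- A point of the open disk is reached at exactly one time, on exactly one ray. -/
theorem exists_unique_retract {w : ℂ} (hw : ‖w‖ < 1) : ∃ s ∈ Icc (0 : ℝ) 1, ∃ y ∈ Ioo (0 : ℝ) 1,
    ∀ s' ∈ Icc (0 : ℝ) 1, ∀ y' ∈ Icc (0 : ℝ) 1,
      (1 - s' : ℂ) * circ y' + s' = w ↔ s' = s ∧ y' = y := by
  have hw1 : w.re < 1 := (Complex.re_le_norm w).trans_lt hw
  have hsq : w.re ^ 2 + w.im ^ 2 = ‖w‖ ^ 2 := by
    rw [← Complex.normSq_eq_norm_sq, Complex.normSq_apply]; ring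
  have hw2 : ‖w‖ ^ 2 < 1 := by nlinarith [norm_nonneg w]
  have hden : 0 < 2 - 2 * w.re := by linarith
  -- At time `s` the unit circle has become the circle of radius `1 - s` about `s`; this is the
  -- solution of `‖w - s‖ = 1 - s`.
  set s := (1 - ‖w‖ ^ 2) / (2 - 2 * w.re) with hs
  have hs0 : 0 < s := div_pos (by linarith) hden
  have hs1 : s < 1 := by
    rw [hs, div_lt_one hden]
    nlinarith [sq_nonneg w.im, sq_pos_of_pos (sub_pos.2 hw1)]
  have hsmul : s * (2 - 2 * w.re) = 1 - ‖w‖ ^ 2 := div_mul_cancel₀ _ hden.ne'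
  have hnorm : ∀ r : ℝ, ‖w - r‖ ^ 2 = ‖w‖ ^ 2 - 2 * r * w.re + r ^ 2 := fun r => by
    rw [← Complex.normSq_eq_norm_sq, Complex.normSq_apply, ← hsq]
    simp; ring
  have h1s : (1 - s : ℂ) = ((1 - s : ℝ) : ℂ) := by push_cast; rfl
  have h1s0 : (1 - s : ℂ) ≠ 0 := by
    rw [h1s]; exact_mod_cast (sub_pos.2 hs1).ne'
  have hunit : ‖(w - s) / (1 - s : ℂ)‖ = 1 := by
    rw [norm_div, h1s, Complex.norm_real, Real.norm_of_nonneg (by linarith),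
      div_eq_one_iff_eq (by linarith)]
    have h2 : ‖w - s‖ ^ 2 = (1 - s) ^ 2 := by rw [hnorm]; nlinarith
    exact (pow_left_inj₀ (norm_nonneg _) (by linarith) two_ne_zero).1 h2
  obtain ⟨y, hy, hyw⟩ := exists_circ_eq hunit
  have hsol : (1 - s : ℂ) * circ y + s = w := by
    rw [hyw]; field_simp; ring
  have hy0 : 0 < y := by
    rcases hy.1.eq_or_lt with rfl | h
    · rw [circ_zero] at hsol
      have : w = 1 := by rw [← hsol]; ring
      rw [this, norm_one] at hw
      exact absurd hw (lt_irrefl _)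
    · exact h
  refine ⟨s, ⟨hs0.le, hs1.le⟩, y, ⟨hy0, hy.2⟩, fun s' hs' y' hy' => ⟨fun h => ?_, ?_⟩⟩
  · have h1 : ‖w - s'‖ = 1 - s' := by
      rw [← h, add_sub_cancel_right, norm_mul, norm_circ, mul_one,
        show (1 - s' : ℂ) = ((1 - s' : ℝ) : ℂ) by push_cast; rfl, Complex.norm_real,
        Real.norm_of_nonneg (by linarith [hs'.2])]
    have h2 := hnorm s'
    rw [h1] at h2
    have h3 : s' = s := by
      rw [hs, eq_div_iff hden.ne']; nlinarith
    refine ⟨h3, ?_⟩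
    rw [h3] at h
    have h4 : circ y' = circ y := by
      have : (1 - s : ℂ) * circ y' = (1 - s) * circ y := by linear_combination h - hsol
      exact mul_left_cancel₀ h1s0 this
    obtain ⟨n, hn⟩ := circ_eq_circ_iff.1 h4
    have h5 : (-1 : ℤ) < n := by
      have : (-1 : ℝ) < n := by rw [← hn]; linarith [hy'.1, hy.2]
      exact_mod_cast this
    have h6 : n < (1 : ℤ) := by
      have : (n : ℝ) < 1 := by rw [← hn]; linarith [hy'.2, hy0]
      exact_mod_cast this
    have h7 : n = 0 := by omega
    rw [h7] at hn
    simpa [sub_eq_zero] using hn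
  · rintro ⟨rfl, rfl⟩
    exact hsol

section Fibres

variable {C : ℝ → ℂ}

/-- A point of the fibre of `F` is interior to the disk, since `x` is off the curve. It is met at
one time and at one value of the progress, and a level set of the monotone progress is an interval,
possibly a whole gap. -/
theorem hasComponents_contractPiece {γ : ClosedSubcurve C} {F : ℂ → ℂ} {D : ℝ → ℂ}
    (hF : IsImmersedDisk F γ.curve) {x : ℂ} (hx : x ∉ range C) (hD : ∀ t, D t ≠ x) :
    HasComponents {p | p ∈ square ∧ contractPiece γ F D p = x} (fibreCount F x) := by
  have hfin := finite_fibre hF.locallyInjective x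
  have : Fintype {z ∈ disk | F z = x} := hfin.fintype
  set f : {z ∈ disk | F z = x} → Set (ℝ × ℝ) := fun w =>
    {p | p ∈ Icc (0 : ℝ) 1 ×ˢ Icc γ.left γ.right ∧ (1 - p.1 : ℂ) * circ (γ.progress p.2) + p.1 = w}
    with hf
  have hsq : ∀ t ∈ Icc γ.left γ.right, t ∈ Icc (0 : ℝ) 1 := fun t ht =>
    ⟨γ.left_nonneg.trans ht.1, ht.2.trans γ.right_le_one⟩
  refine ⟨_, inferInstance, f, fun w => ?_, fun w => ?_, fun w w' hne => ?_, ?_, ?_⟩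
  · have e : f w = (Icc (0 : ℝ) 1 ×ˢ Icc γ.left γ.right) ∩
        (fun p : ℝ × ℝ => (1 - p.1 : ℂ) * circ (γ.progress p.2) + p.1) ⁻¹' {(w : ℂ)} := rfl
    rw [e]
    exact (isClosed_Icc.prod isClosed_Icc).inter (isClosed_singleton.preimage (by fun_prop))
  · have hw1 : ‖(w : ℂ)‖ < 1 := by
      have h1 : ‖(w : ℂ)‖ ≤ 1 := by simpa [disk] using w.2.1
      refine lt_of_le_of_ne h1 fun h => ?_
      obtain ⟨t, -, ht⟩ := exists_circ_eq h
      have h2 := w.2.2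
      rw [← ht, hF.boundary] at h2
      obtain ⟨u, -, hu⟩ := γ.exists_curve_eq t
      exact hx ⟨u, by rw [← hu, h2]⟩
    obtain ⟨s, hs, y, hy, hiff⟩ := exists_unique_retract hw1
    have e : f w = {s} ×ˢ (Icc γ.left γ.right ∩ γ.progress ⁻¹' {y}) := by
      ext ⟨s', t⟩
      constructor
      · rintro ⟨⟨h1, h2⟩, h3⟩
        obtain ⟨h4, h5⟩ := (hiff s' h1 _ (γ.progress_mem_Icc h2)).1 h3
        exact ⟨h4, h2, h5⟩
      · rintro ⟨h1, h2, h3⟩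
        have h1 : s' = s := h1
        have h3 : γ.progress t = y := h3
        refine ⟨⟨by rw [h1]; exact hs, h2⟩, ?_⟩
        exact (hiff s' (by rw [h1]; exact hs) _ (γ.progress_mem_Icc h2)).2 ⟨h1, h3⟩
    rw [e]
    refine isConnected_singleton.prod ⟨?_, ?_⟩
    · have := intermediate_value_Icc γ.left_lt_right.le γ.continuous_progress.continuousOn
      rw [γ.progress_left, γ.progress_right] at this
      obtain ⟨t, ht, hty⟩ := this (Ioo_subset_Icc_self hy)
      exact ⟨t, ht, hty⟩
    · exact (ordConnected_Icc.inter
        (ordConnected_singleton.preimage_mono γ.monotone_progress)).isPreconnected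
  · refine disjoint_left.2 fun p hp hp' => hne (Subtype.ext ?_)
    exact hp.2.symm.trans hp'.2
  · ext ⟨s, t⟩
    simp only [mem_iUnion]
    constructor
    · rintro ⟨w, ⟨h1, h2⟩, h3⟩
      refine ⟨⟨h1, hsq t h2⟩, ?_⟩
      rw [contractPiece_of_mem h2]
      have h3 : (1 - s : ℂ) * circ (γ.progress t) + s = w := h3
      rw [h3]
      exact w.2.2
    · rintro ⟨⟨h1, -⟩, h2⟩
      have ht : t ∈ Icc γ.left γ.right := by
        by_contra ht
        rw [contractPiece_of_notMem ht] at h2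
        exact hD t h2
      rw [contractPiece_of_mem ht] at h2
      exact ⟨⟨_, retract_mem_disk h1 (norm_circ _), h2⟩, ⟨h1, ht⟩, rfl⟩
  · rw [fibreCount, ← Nat.card_coe_set_eq, Nat.card_eq_fintype_card]

/-- The first half of a concatenation. -/
def firstHalf : (ℝ × ℝ) ≃ₜ (ℝ × ℝ) where
  toFun p := (p.1 / 2, p.2)
  invFun p := (2 * p.1, p.2)
  left_inv p := by ext <;> simp; ring
  right_inv p := by ext <;> simp
  continuous_toFun := by fun_prop
  continuous_invFun := by fun_prop

/-- The second half of a concatenation. -/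
def secondHalf : (ℝ × ℝ) ≃ₜ (ℝ × ℝ) where
  toFun p := ((p.1 + 1) / 2, p.2)
  invFun p := (2 * p.1 - 1, p.2)
  left_inv p := by ext <;> simp; ring
  right_inv p := by ext <;> simp
  continuous_toFun := by fun_prop
  continuous_invFun := by fun_prop

/-- The halves share only the intermediate curve, which avoids `x`, so no component of one half
meets one of the other. -/
theorem hasComponents_concat {H₁ H₂ : ℝ × ℝ → ℂ} {x : ℂ} {n₁ n₂ : ℕ}
    (h : ∀ t, H₁ (1, t) = H₂ (0, t)) (hx : ∀ t, H₂ (0, t) ≠ x)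
    (h₁ : HasComponents {p | p ∈ square ∧ H₁ p = x} n₁)
    (h₂ : HasComponents {p | p ∈ square ∧ H₂ p = x} n₂) :
    HasComponents {p | p ∈ square ∧ concat H₁ H₂ p = x} (n₁ + n₂) := by
  have e : {p | p ∈ square ∧ concat H₁ H₂ p = x} =
      firstHalf '' {p | p ∈ square ∧ H₁ p = x} ∪ secondHalf '' {p | p ∈ square ∧ H₂ p = x} := by
    ext ⟨s, t⟩
    constructor
    · rintro ⟨⟨hs, ht⟩, hp⟩
      have hs : s ∈ Icc (0 : ℝ) 1 := hs
      rcases le_total s (1 / 2) with h1 | h1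
      · rw [concat_of_le h1] at hp
        exact Or.inl ⟨(2 * s, t), ⟨⟨⟨by linarith [hs.1], by linarith⟩, ht⟩, hp⟩,
          firstHalf.apply_symm_apply (s, t)⟩
      · rw [concat_of_ge h h1] at hp
        exact Or.inr ⟨(2 * s - 1, t), ⟨⟨⟨by linarith, by linarith [hs.2]⟩, ht⟩, hp⟩,
          secondHalf.apply_symm_apply (s, t)⟩
    · rintro (⟨⟨s', t'⟩, ⟨⟨hs, ht⟩, hp⟩, he⟩ | ⟨⟨s', t'⟩, ⟨⟨hs, ht⟩, hp⟩, he⟩)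
      · have hs : s' ∈ Icc (0 : ℝ) 1 := hs
        obtain ⟨rfl, rfl⟩ := Prod.mk.inj he
        refine ⟨⟨⟨by linarith [hs.1], by linarith [hs.2]⟩, ht⟩, ?_⟩
        rw [concat_of_le (by linarith [hs.2])]
        convert hp using 2
        ext <;> simp; ring
      · have hs : s' ∈ Icc (0 : ℝ) 1 := hs
        obtain ⟨rfl, rfl⟩ := Prod.mk.inj he
        refine ⟨⟨⟨by linarith [hs.1], by linarith [hs.2]⟩, ht⟩, ?_⟩
        rw [concat_of_ge h (by linarith [hs.1])]
        convert hp using 2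
        ext <;> simp; ring
  rw [e]
  refine (h₁.image _).union (h₂.image _) (disjoint_left.2 ?_)
  rintro _ ⟨⟨s, t⟩, ⟨⟨hs, ht⟩, hp⟩, rfl⟩ ⟨⟨s', t'⟩, ⟨⟨hs', ht'⟩, hp'⟩, he⟩
  have hs : s ∈ Icc (0 : ℝ) 1 := hs
  have hs' : s' ∈ Icc (0 : ℝ) 1 := hs'
  obtain ⟨h1, h2⟩ := Prod.mk.inj he
  simp only [] at h1 h2
  have h3 : s' = 0 := by linarith [hs.2, hs'.1]
  rw [h3] at hp'
  exact hx _ hp'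

theorem hasComponents_contractList {x : ℂ} (hx : x ∉ range C) :
    ∀ (L : List (ClosedSubcurve C × (ℂ → ℂ))) {D : ℝ → ℂ}, L ≠ [] → IsContractible L D →
      (∀ y ∈ L, IsImmersedDisk y.2 y.1.curve) → (∀ t, D t ≠ x) →
      HasComponents {p | p ∈ square ∧ contractList L D p = x}
        (L.map fun y => fibreCount y.2 x).sum
  | [], _, h, _, _, _ => absurd rfl h
  | [y], D, _, _, hF, hD => by
    rw [List.map_singleton, List.sum_singleton]
    exact hasComponents_contractPiece (hF y (by simp)) hx hD
  | y :: z :: L, D, _, h, hF, hD => by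
    have hD' : ∀ t, afterContraction y.1 D t ≠ x := fun t => by
      by_cases ht : t ∈ Icc y.1.left y.1.right
      · rw [afterContraction, if_pos ht]
        exact fun h => hx ⟨_, h⟩
      · rw [afterContraction, if_neg ht]; exact hD t
    rw [List.map_cons, List.sum_cons]
    refine hasComponents_concat (contractPiece_one_eq h) (fun t => ?_)
      (hasComponents_contractPiece (hF y (by simp)) hx hD)
      (hasComponents_contractList hx (z :: L) (by simp) h.2.2.2.2
        (fun y hy => hF y (List.mem_cons_of_mem _ hy)) hD')
    rw [contractList_zero h.2.2.2.2]
    exact hD' t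

end Fibres

theorem IsOrdered.sweepCount_eq {C : ℝ → ℂ} {l : ℕ} {Γ : Decomposition C l}
    {P : ℕ → ClosedSubcurve C × (ℂ → ℂ)} {e : Equiv.Perm (Fin l)} (hC : IsNormalCurve C)
    (h : IsOrdered Γ P e) {x : ℂ} (hx : x ∉ range C) :
    sweepCount (contractList (reverseList P l) C) x =
      ((∑ i : Fin l, fibreCount (P i).2 x : ℕ) : ℕ∞) := by
  have hne : reverseList P l ≠ [] := by
    have := Γ.pos
    simp [reverseList]; omega
  have h1 := hasComponents_contractList hx (reverseList P l) hne (h.isContractible hC)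
    (fun y hy => by
      obtain ⟨j, hj, rfl⟩ := mem_reverseList.1 hy
      exact h.disk ⟨j, hj⟩) (fun t ht => hx ⟨t, ht⟩)
  have h2 : ((reverseList P l).map fun y => fibreCount y.2 x).sum =
      ∑ i : Fin l, fibreCount (P i).2 x := by
    rw [Fin.sum_univ_eq_sum_range (fun i => fibreCount (P i).2 x), reverseList, List.map_reverse,
      List.sum_reverse, List.map_map, Finset.sum_range]
    rw [← List.sum_ofFn]
    congr 1
    apply List.ext_getElem <;> simp
  rw [h2] at h1
  exact h1.card_eq

/-! ### Piecewise differentiability -/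

/-- `H` is `C¹` off the lines of a grid, and along all horizontal and vertical lines up to points of
the grid. -/
structure IsGridSmooth (H : ℝ × ℝ → ℂ) (A B : Set ℝ) : Prop where
  finite_times : A.Finite
  finite_params : B.Finite
  interior : ContDiffOn ℝ 1 H ((Ioo 0 1 \ A) ×ˢ (Ioo 0 1 \ B))
  time : ∀ s ∈ Icc (0 : ℝ) 1, ContDiffOn ℝ 1 (fun t => H (s, t)) (Ioo 0 1 \ B)
  param : ∀ t, ContDiffOn ℝ 1 (fun s => H (s, t)) (Ioo 0 1 \ A)

theorem IsGridSmooth.isPiecewiseDifferentiable {H : ℝ × ℝ → ℂ} {A B : Set ℝ}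
    (h : IsGridSmooth H A B) : IsPiecewiseDifferentiable H := by
  classical
  set A' := (h.finite_times.inter_of_left (Icc (0 : ℝ) 1)).toFinset with hA'
  set B' := (h.finite_params.inter_of_left (Icc (0 : ℝ) 1)).toFinset with hB'
  have hl : ∀ s u : ℝ, AffineMap.lineMap ((s, 0) : ℝ × ℝ) (s, 1) u = (s, u) := fun s u => by
    simp [AffineMap.lineMap_apply]
  have hr : ∀ t u : ℝ, AffineMap.lineMap ((0, t) : ℝ × ℝ) (1, t) u = (u, t) := fun t u => by
    simp [AffineMap.lineMap_apply]
  refine ⟨A'.image (fun s => ((s, 0), (s, 1))) ∪ B'.image (fun t => ((0, t), (1, t))), ?_, ?_, ?_⟩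
  · intro e he
    rcases Finset.mem_union.1 he with he | he
    · obtain ⟨s, hs, rfl⟩ := Finset.mem_image.1 he
      have : s ∈ Icc (0 : ℝ) 1 := ((Finite.mem_toFinset _).1 hs).2
      exact ⟨⟨this, by simp⟩, ⟨this, by simp⟩⟩
    · obtain ⟨t, ht, rfl⟩ := Finset.mem_image.1 he
      have : t ∈ Icc (0 : ℝ) 1 := ((Finite.mem_toFinset _).1 ht).2
      exact ⟨⟨by simp, this⟩, ⟨by simp, this⟩⟩
  · refine h.interior.mono ?_
    rintro ⟨s, t⟩ ⟨⟨hs, ht⟩, hn⟩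
    have hs : s ∈ Ioo (0 : ℝ) 1 := hs
    have ht : t ∈ Ioo (0 : ℝ) 1 := ht
    refine ⟨⟨hs, fun hsA => hn ?_⟩, ⟨ht, fun htB => hn ?_⟩⟩
    · refine mem_iUnion₂.2 ⟨((s, 0), (s, 1)), Finset.mem_union_left _ (Finset.mem_image.2
        ⟨s, (Finite.mem_toFinset _).2 ⟨hsA, Ioo_subset_Icc_self hs⟩, rfl⟩), ?_⟩
      rw [segment_eq_image_lineMap]
      exact ⟨t, Ioo_subset_Icc_self ht, hl s t⟩
    · refine mem_iUnion₂.2 ⟨((0, t), (1, t)), Finset.mem_union_right _ (Finset.mem_image.2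
        ⟨t, (Finite.mem_toFinset _).2 ⟨htB, Ioo_subset_Icc_self ht⟩, rfl⟩), ?_⟩
      rw [segment_eq_image_lineMap]
      exact ⟨s, Ioo_subset_Icc_self hs, hr t s⟩
  · intro e he
    rcases Finset.mem_union.1 he with he | he
    · obtain ⟨s, hs, rfl⟩ := Finset.mem_image.1 he
      have : s ∈ Icc (0 : ℝ) 1 := ((Finite.mem_toFinset _).1 hs).2
      refine ⟨B, h.finite_params, ?_⟩
      simp only [hl]
      exact h.time s this
    · obtain ⟨t, ht, rfl⟩ := Finset.mem_image.1 he
      refine ⟨A, h.finite_times, ?_⟩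
      simp only [hr]
      exact h.param t

/-! ### Smoothness of the contractions off a grid -/

theorem contDiff_circ : ContDiff ℝ 1 circ := by
  have h : ContDiff ℝ 1 fun t : ℝ => (2 * Real.pi * t * Complex.I : ℂ) :=
    (contDiff_const.mul Complex.ofRealCLM.contDiff).mul contDiff_const
  exact h.cexp

/-- Strict convexity of the disk. It matters because the immersion may fail to be differentiable at
corners on the circle. -/
theorem retract_mem_ball {s : ℝ} (hs : s ∈ Ioo (0 : ℝ) 1) {z : ℂ} (hz : ‖z‖ = 1) (hz1 : z ≠ 1) :
    (1 - s : ℂ) * z + s ∈ Metric.ball (0 : ℂ) 1 := by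
  have hsq : z.re ^ 2 + z.im ^ 2 = 1 := by
    have : z.re ^ 2 + z.im ^ 2 = ‖z‖ ^ 2 := by
      rw [← Complex.normSq_eq_norm_sq, Complex.normSq_apply]; ring
    rw [this, hz, one_pow]
  have hre : z.re < 1 := by
    by_contra! hcon
    have h1 : z.re = 1 := by nlinarith [sq_nonneg z.im]
    have h2 : z.im = 0 := by
      rw [h1] at hsq
      nlinarith [sq_nonneg z.im]
    exact hz1 (Complex.ext h1 h2)
  rw [mem_ball_zero_iff]
  have h1 : ‖(1 - s : ℂ) * z + s‖ ^ 2 = (1 - s) ^ 2 + s ^ 2 + 2 * s * (1 - s) * z.re := by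
    rw [← Complex.normSq_eq_norm_sq, Complex.normSq_apply]
    simp
    linear_combination (1 - s) ^ 2 * hsq
  have h2 : 0 < s * (1 - s) := mul_pos hs.1 (by linarith [hs.2])
  have h3 : ‖(1 - s : ℂ) * z + s‖ ^ 2 < 1 := by rw [h1]; nlinarith
  nlinarith [norm_nonneg ((1 - s : ℂ) * z + s)]

section Smooth

variable {C : ℝ → ℂ}

theorem contDiffAt_min_const {t c : ℝ} (h : t ≠ c) : ContDiffAt ℝ 1 (fun u => min u c) t := by
  rcases lt_or_gt_of_ne h with h | h
  · refine contDiffAt_id.congr_of_eventuallyEq ?_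
    filter_upwards [gt_mem_nhds h] with u hu using min_eq_left (le_of_lt hu)
  · refine (contDiffAt_const (c := c)).congr_of_eventuallyEq ?_
    filter_upwards [lt_mem_nhds h] with u hu using min_eq_right (le_of_lt hu)

/-- The end points of a piece and of its gaps lie in `B`. -/
def EndsIn (γ : ClosedSubcurve C) (B : Set ℝ) : Prop :=
  γ.left ∈ B ∧ γ.right ∈ B ∧ ∀ g ∈ γ.gaps, g.1 ∈ B ∧ g.2 ∈ B

theorem contDiffAt_progress {γ : ClosedSubcurve C} {B : Set ℝ} (hγ : EndsIn γ B) {t : ℝ}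
    (ht : t ∉ B) : ContDiffAt ℝ 1 γ.progress t := by
  unfold ClosedSubcurve.progress
  refine ContDiffAt.div_const ((contDiffAt_id.sub contDiffAt_const).sub
    (ContDiffAt.sum fun g hg => ?_)) _
  exact (contDiffAt_min_const fun h => ht (by rw [h]; exact (hγ.2.2 g hg).2)).sub
    (contDiffAt_min_const fun h => ht (by rw [h]; exact (hγ.2.2 g hg).1))

theorem circ_progress_ne_one {γ : ClosedSubcurve C} {t : ℝ} (ht : t ∈ Ioo γ.left γ.right) :
    circ (γ.progress t) ≠ 1 := by
  rw [Ne, circ_eq_one_iff]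
  rintro ⟨n, hn⟩
  have h1 := γ.progress_pos ht.1
  have h2 := γ.progress_lt_one ht.2
  rw [hn] at h1 h2
  have h3 : (0 : ℤ) < n := by exact_mod_cast h1
  have h4 : n < (1 : ℤ) := by exact_mod_cast h2
  omega

theorem isOpen_Ioo_diff {B : Set ℝ} (hB : B.Finite) : IsOpen (Ioo (0 : ℝ) 1 \ B) :=
  isOpen_Ioo.sdiff hB.isClosed

variable {γ : ClosedSubcurve C} {F : ℂ → ℂ} {D : ℝ → ℂ} {B : Set ℝ}

theorem contDiffOn_afterContraction (hB : B.Finite) (hγ : EndsIn γ B)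
    (hD : ContDiffOn ℝ 1 D (Ioo 0 1 \ B)) :
    ContDiffOn ℝ 1 (afterContraction γ D) (Ioo 0 1 \ B) := by
  intro t ht
  refine ContDiffAt.contDiffWithinAt ?_
  by_cases hI : t ∈ Icc γ.left γ.right
  · have hI' : t ∈ Ioo γ.left γ.right :=
      ⟨lt_of_le_of_ne hI.1 fun h => ht.2 (h ▸ hγ.1), lt_of_le_of_ne hI.2 fun h => ht.2 (h ▸ hγ.2.1)⟩
    refine (contDiffAt_const (c := γ.root)).congr_of_eventuallyEq ?_
    filter_upwards [Ioo_mem_nhds hI'.1 hI'.2] with u hu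
    rw [afterContraction, if_pos (Ioo_subset_Icc_self hu)]
  · refine ((hD t ht).contDiffAt ((isOpen_Ioo_diff hB).mem_nhds ht)).congr_of_eventuallyEq ?_
    filter_upwards [isClosed_Icc.isOpen_compl.mem_nhds hI] with u hu
    rw [afterContraction, if_neg hu]

/-- At times strictly between `0` and `1` the retraction stays in the open disk, where `F` is `C¹`.
The extreme times give the curves before and after the contraction, which are handled separately,
and a parameter outside the open span does not move. -/
theorem isGridSmooth_contractPiece (hB : B.Finite) (hγ : EndsIn γ B)
    (hF : IsImmersedDisk F γ.curve) (hD : ContDiffOn ℝ 1 D (Ioo 0 1 \ B)) (h1 : F 1 = γ.root)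
    (h : ∀ t ∈ Icc γ.left γ.right, D t = F (circ (γ.progress t))) :
    IsGridSmooth (contractPiece γ F D) ∅ B := by
  have hint : ∀ s ∈ Ioo (0 : ℝ) 1, ∀ t ∈ Ioo (0 : ℝ) 1 \ B,
      ContDiffAt ℝ 1 (contractPiece γ F D) (s, t) := by
    intro s hs t ht
    by_cases hI : t ∈ Icc γ.left γ.right
    · have hI' : t ∈ Ioo γ.left γ.right :=
        ⟨lt_of_le_of_ne hI.1 fun h => ht.2 (h ▸ hγ.1),
          lt_of_le_of_ne hI.2 fun h => ht.2 (h ▸ hγ.2.1)⟩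
      have hp : ContDiffAt ℝ 1 (fun p : ℝ × ℝ => γ.progress p.2) (s, t) :=
        (contDiffAt_progress hγ ht.2).comp (s, t) contDiffAt_snd
      have hs' : ContDiffAt ℝ 1 (fun p : ℝ × ℝ => (p.1 : ℂ)) (s, t) :=
        Complex.ofRealCLM.contDiff.contDiffAt.comp (s, t) contDiffAt_fst
      have hG : ContDiffAt ℝ 1 (fun p : ℝ × ℝ => (1 - p.1 : ℂ) * circ (γ.progress p.2) + p.1)
          (s, t) :=
        ((contDiffAt_const.sub hs').mul (contDiff_circ.contDiffAt.comp (s, t) hp)).add hs'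
      have hFG := ContDiffAt.comp (s, t) (hF.contDiffAt
        (retract_mem_ball hs (norm_circ _) (circ_progress_ne_one hI'))).1 hG
      refine hFG.congr_of_eventuallyEq ?_
      filter_upwards [continuous_snd.continuousAt.preimage_mem_nhds
        (Ioo_mem_nhds hI'.1 hI'.2)] with p hp
      exact contractPiece_of_mem (Ioo_subset_Icc_self hp)
    · have hDt : ContDiffAt ℝ 1 (fun p : ℝ × ℝ => D p.2) (s, t) :=
        ((hD t ht).contDiffAt ((isOpen_Ioo_diff hB).mem_nhds ht)).comp (s, t) contDiffAt_snd
      refine hDt.congr_of_eventuallyEq ?_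
      filter_upwards [continuous_snd.continuousAt.preimage_mem_nhds
        (isClosed_Icc.isOpen_compl.mem_nhds hI)] with p hp
      exact contractPiece_of_notMem hp
  refine ⟨finite_empty, hB, ?_, fun s hs => ?_, fun t => ?_⟩
  · rintro ⟨s, t⟩ ⟨hs, ht⟩
    exact (hint s hs.1 t ht).contDiffWithinAt
  · rcases hs.1.eq_or_lt with rfl | h0
    · exact hD.congr fun t _ => contractPiece_zero h t
    · rcases hs.2.eq_or_lt with rfl | hs1
      · exact (contDiffOn_afterContraction hB hγ hD).congr fun t _ => contractPiece_one h1 t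
      · intro t ht
        exact ((hint s ⟨h0, hs1⟩ t ht).comp t
          (contDiffAt_const.prodMk contDiffAt_id)).contDiffWithinAt
  · by_cases hI : t ∈ Ioo γ.left γ.right
    · intro s hs
      have hs' : ContDiffAt ℝ 1 (fun s : ℝ => (s : ℂ)) s := Complex.ofRealCLM.contDiff.contDiffAt
      have hG : ContDiffAt ℝ 1 (fun s : ℝ => (1 - s : ℂ) * circ (γ.progress t) + s) s :=
        ((contDiffAt_const.sub hs').mul contDiffAt_const).add hs'
      have hFG := ContDiffAt.comp s (hF.contDiffAt
        (retract_mem_ball hs.1 (norm_circ _) (circ_progress_ne_one hI))).1 hG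
      refine (hFG.congr_of_eventuallyEq (Eventually.of_forall fun u => ?_)).contDiffWithinAt
      exact contractPiece_of_mem (Ioo_subset_Icc_self hI)
    · exact contDiffOn_const.congr fun s _ => contractPiece_of_notMem_Ioo h hI s

theorem isGridSmooth_concat {H₁ H₂ : ℝ × ℝ → ℂ} {A₁ A₂ : Set ℝ} (h₁ : IsGridSmooth H₁ A₁ B)
    (h₂ : IsGridSmooth H₂ A₂ B) (h : ∀ t, H₁ (1, t) = H₂ (0, t)) :
    IsGridSmooth (concat H₁ H₂)
      ({1 / 2} ∪ ((fun s => s / 2) '' A₁ ∪ (fun s => (s + 1) / 2) '' A₂)) B := by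
  set A : Set ℝ := {1 / 2} ∪ ((fun s => s / 2) '' A₁ ∪ (fun s => (s + 1) / 2) '' A₂) with hA
  have hA1 : ∀ s ∈ Ioo (0 : ℝ) 1 \ A, s < 1 / 2 → 2 * s ∈ Ioo (0 : ℝ) 1 \ A₁ := fun s hs hlt =>
    ⟨⟨by linarith [hs.1.1], by linarith⟩, fun h => hs.2 (Or.inr (Or.inl ⟨_, h, by simp⟩))⟩
  have hA2 : ∀ s ∈ Ioo (0 : ℝ) 1 \ A, 1 / 2 < s → 2 * s - 1 ∈ Ioo (0 : ℝ) 1 \ A₂ :=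
    fun s hs hlt => ⟨⟨by linarith, by linarith [hs.1.2]⟩,
      fun h => hs.2 (Or.inr (Or.inr ⟨_, h, by simp⟩))⟩
  have hne : ∀ s ∈ Ioo (0 : ℝ) 1 \ A, s ≠ 1 / 2 := fun s hs h => hs.2 (Or.inl h)
  refine ⟨(finite_singleton _).union
    ((h₁.finite_times.image _).union (h₂.finite_times.image _)), h₁.finite_params, ?_, ?_, ?_⟩
  · rintro ⟨s, t⟩ ⟨hs, ht⟩
    have hs : s ∈ Ioo (0 : ℝ) 1 \ A := hs
    have ht : t ∈ Ioo (0 : ℝ) 1 \ B := ht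
    refine ContDiffAt.contDiffWithinAt ?_
    rcases lt_or_gt_of_ne (hne s hs) with hlt | hgt
    · have hmem : (2 * s, t) ∈ (Ioo 0 1 \ A₁) ×ˢ (Ioo 0 1 \ B) := ⟨hA1 s hs hlt, ht⟩
      have h3 : ContDiffAt ℝ 1 H₁ (2 * s, t) := (h₁.interior _ hmem).contDiffAt
        (((isOpen_Ioo_diff h₁.finite_times).prod (isOpen_Ioo_diff h₁.finite_params)).mem_nhds hmem)
      have h4 : ContDiffAt ℝ 1 (fun p : ℝ × ℝ => (2 * p.1, p.2)) (s, t) :=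
        (contDiffAt_const.mul contDiffAt_fst).prodMk contDiffAt_snd
      refine (ContDiffAt.comp (s, t) h3 h4).congr_of_eventuallyEq ?_
      filter_upwards [continuous_fst.continuousAt.preimage_mem_nhds
        (gt_mem_nhds hlt)] with p hp
      exact concat_of_le (le_of_lt hp)
    · have hmem : (2 * s - 1, t) ∈ (Ioo 0 1 \ A₂) ×ˢ (Ioo 0 1 \ B) := ⟨hA2 s hs hgt, ht⟩
      have h3 : ContDiffAt ℝ 1 H₂ (2 * s - 1, t) := (h₂.interior _ hmem).contDiffAt
        (((isOpen_Ioo_diff h₂.finite_times).prod (isOpen_Ioo_diff h₂.finite_params)).mem_nhds hmem)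
      have h4 : ContDiffAt ℝ 1 (fun p : ℝ × ℝ => (2 * p.1 - 1, p.2)) (s, t) :=
        ((contDiffAt_const.mul contDiffAt_fst).sub contDiffAt_const).prodMk contDiffAt_snd
      refine (ContDiffAt.comp (s, t) h3 h4).congr_of_eventuallyEq ?_
      filter_upwards [continuous_fst.continuousAt.preimage_mem_nhds
        (lt_mem_nhds hgt)] with p hp
      exact concat_of_ge h (le_of_lt hp)
  · intro s hs
    rcases le_total s (1 / 2) with hle | hge
    · exact (h₁.time (2 * s) ⟨by linarith [hs.1], by linarith⟩).congr fun t _ => concat_of_le hle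
    · exact (h₂.time (2 * s - 1) ⟨by linarith, by linarith [hs.2]⟩).congr
        fun t _ => concat_of_ge h hge
  · intro t s hs
    refine ContDiffAt.contDiffWithinAt ?_
    rcases lt_or_gt_of_ne (hne s hs) with hlt | hgt
    · have h3 : ContDiffAt ℝ 1 (fun s => H₁ (s, t)) (2 * s) :=
        (h₁.param t _ (hA1 s hs hlt)).contDiffAt
          ((isOpen_Ioo_diff h₁.finite_times).mem_nhds (hA1 s hs hlt))
      refine (ContDiffAt.comp s h3 (contDiffAt_const.mul contDiffAt_id)).congr_of_eventuallyEq ?_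
      filter_upwards [gt_mem_nhds hlt] with u hu
      exact concat_of_le (le_of_lt hu)
    · have h3 : ContDiffAt ℝ 1 (fun s => H₂ (s, t)) (2 * s - 1) :=
        (h₂.param t _ (hA2 s hs hgt)).contDiffAt
          ((isOpen_Ioo_diff h₂.finite_times).mem_nhds (hA2 s hs hgt))
      refine (ContDiffAt.comp s h3 ((contDiffAt_const.mul contDiffAt_id).sub
        contDiffAt_const)).congr_of_eventuallyEq ?_
      filter_upwards [lt_mem_nhds hgt] with u hu
      exact concat_of_ge h (le_of_lt hu)

theorem exists_isGridSmooth_contractList (hB : B.Finite) :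
    ∀ (L : List (ClosedSubcurve C × (ℂ → ℂ))) {D : ℝ → ℂ}, L ≠ [] → IsContractible L D →
      (∀ y ∈ L, IsImmersedDisk y.2 y.1.curve ∧ EndsIn y.1 B) →
      ContDiffOn ℝ 1 D (Ioo 0 1 \ B) → ∃ A, IsGridSmooth (contractList L D) A B
  | [], _, h, _, _, _ => absurd rfl h
  | [y], D, _, h, hF, hD =>
    ⟨∅, isGridSmooth_contractPiece hB (hF y (by simp)).2 (hF y (by simp)).1 hD h.2.2.1 h.2.2.2.1⟩
  | y :: z :: L, D, _, h, hF, hD => by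
    obtain ⟨A, hA⟩ := exists_isGridSmooth_contractList hB (z :: L) (by simp) h.2.2.2.2
      (fun x hx => hF x (List.mem_cons_of_mem _ hx))
      (contDiffOn_afterContraction hB (hF y (by simp)).2 hD)
    exact ⟨_, isGridSmooth_concat (isGridSmooth_contractPiece hB (hF y (by simp)).2
      (hF y (by simp)).1 hD h.2.2.1 h.2.2.2.1) hA (contractPiece_one_eq h)⟩

theorem IsPiecewiseRegular.exists_contDiffAt (hC : IsPiecewiseRegular C) :
    ∃ T : Set ℝ, T.Finite ∧ ∀ t ∈ Ioo (0 : ℝ) 1 \ T, ContDiffAt ℝ 1 C t := by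
  obtain ⟨m, τ, hτ, h0, h1, h⟩ := hC
  refine ⟨range τ, finite_range τ, fun t ht => ?_⟩
  obtain ⟨i, hi⟩ : ∃ i : Fin m, t ∈ Ico (τ i.castSucc) (τ i.succ) := by
    by_contra! hcon
    have : ∀ i, τ i ≤ t := by
      intro i
      induction i using Fin.induction with
      | zero => rw [h0]; exact ht.1.1.le
      | succ i ih =>
        by_contra! h2
        exact hcon i ⟨ih, h2⟩
    have h2 := this (Fin.last m)
    rw [h1] at h2
    exact absurd ht.1.2 (not_lt.2 h2)
  have hi' : τ i.castSucc < t := lt_of_le_of_ne hi.1 fun h => ht.2 ⟨_, h⟩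
  exact ((h i).1 t ⟨hi.1, hi.2.le⟩).contDiffAt (Icc_mem_nhds hi' hi.2)

end Smooth

theorem IsOrdered.isPiecewiseDifferentiable {C : ℝ → ℂ} {l : ℕ} {Γ : Decomposition C l}
    {P : ℕ → ClosedSubcurve C × (ℂ → ℂ)} {e : Equiv.Perm (Fin l)} (hC : IsNormalCurve C)
    (h : IsOrdered Γ P e) : IsPiecewiseDifferentiable (contractList (reverseList P l) C) := by
  obtain ⟨T, hT, hCT⟩ := hC.piecewiseRegular.exists_contDiffAt
  set B : Set ℝ := T ∪ ⋃ j ∈ Iio l, ({(P j).1.left, (P j).1.right} ∪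
    ⋃ g ∈ (P j).1.gaps, {g.1, g.2}) with hBdef
  have hB : B.Finite := by
    refine hT.union ((finite_Iio l).biUnion fun j _ => (toFinite _).union ?_)
    exact (P j).1.gaps.finite_toSet.biUnion fun g _ => toFinite _
  have hne : reverseList P l ≠ [] := by
    have := Γ.pos
    simp [reverseList]; omega
  obtain ⟨A, hA⟩ := exists_isGridSmooth_contractList hB (reverseList P l) hne (h.isContractible hC)
    (fun y hy => by
      obtain ⟨j, hj, rfl⟩ := mem_reverseList.1 hy
      refine ⟨h.disk ⟨j, hj⟩, ?_, ?_, fun g hg => ⟨?_, ?_⟩⟩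
      · exact Or.inr (mem_iUnion₂.2 ⟨j, hj, Or.inl (by simp)⟩)
      · exact Or.inr (mem_iUnion₂.2 ⟨j, hj, Or.inl (by simp)⟩)
      · exact Or.inr (mem_iUnion₂.2 ⟨j, hj, Or.inr (mem_iUnion₂.2 ⟨g, hg, by simp⟩)⟩)
      · exact Or.inr (mem_iUnion₂.2 ⟨j, hj, Or.inr (mem_iUnion₂.2 ⟨g, hg, by simp⟩)⟩))
    (fun t ht => (hCT t ⟨ht.1, fun hT => ht.2 (Or.inl hT)⟩).contDiffWithinAt)
  exact hA.isPiecewiseDifferentiable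

/-! ### Existence of an ordering -/

/-- A vertex on a piece is an end point of an edge of the piece. -/
theorem PieceSystem.own_eq_or {ι : Type*} {N : ℕ} (S : PieceSystem ι N) {j : ι} {v : ℕ}
    (h1 : S.lft j ≤ v) (h2 : v ≤ S.rgt j) (h3 : ∀ c d, S.gap j c d → v ≤ c ∨ d ≤ v) :
    S.own v = j ∨ ∃ k, v = k + 1 ∧ S.own k = j := by
  have h4 := S.lft_lt j
  have h5 := S.rgt_le j
  by_cases hv : v = S.rgt j
  · exact Or.inr ⟨v - 1, by omega, S.own_of_rgt (by omega)⟩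
  by_cases hg : ∃ d, S.gap j v d
  · obtain ⟨d, hd⟩ := hg
    have h6 := S.gap_mem hd
    obtain ⟨k, rfl⟩ : ∃ k, v = k + 1 := ⟨v - 1, by omega⟩
    exact Or.inr ⟨k, rfl, S.own_of_gap_left hd⟩
  · push Not at hg
    refine Or.inl ((S.own_iff (by omega)).2 ⟨h1, by omega, fun c d h => ?_⟩)
    have h6 := h3 c d h
    have : c ≠ v := by rintro rfl; exact hg d h
    omega

/-- A piece that passes through the root of another piece spans a longer parameter interval. -/
theorem Decomposition.span_lt {C : ℝ → ℂ} (hC : IsNormalCurve C) {l : ℕ} (Γ : Decomposition C l)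
    {i j : Fin l} (hij : i ≠ j) (h : (Γ.piece i).root ∈ (Γ.piece j).trace) :
    (Γ.piece i).right - (Γ.piece i).left < (Γ.piece j).right - (Γ.piece j).left := by
  obtain ⟨N, b, hb⟩ := hC.exists_isSubdivision
  obtain ⟨S, hS⟩ := Γ.exists_fits hC hb
  have hmono := hb.strictMono
  obtain ⟨s, hs, hsi⟩ := h
  rw [ClosedSubcurve.root] at hsi
  rw [ClosedSubcurve.mem_support_iff] at hs
  have hi0 := (Γ.piece i).left_nonneg
  have hi1 := (Γ.piece i).left_lt_right
  have hi2 := (Γ.piece i).right_le_one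
  have hj0 := (Γ.piece j).left_nonneg
  have hj1 := (Γ.piece j).left_lt_right
  have hj2 := (Γ.piece j).right_le_one
  have hinj : S.lft i ≠ S.lft j := fun e => hij (by rw [← S.own_lft i, e, S.own_lft])
  -- If piece `i` starts at the base point, a piece through that root must also start at `0`, but
  -- distinct pieces start at distinct vertices.
  by_cases hl : S.lft i = 0
  · exfalso
    have hil : (Γ.piece i).left = 0 := by rw [← hS.lft, hl, hb.zero]
    have hjl : (Γ.piece j).left ≠ 0 := by
      rw [← hil, ← hS.lft, ← hS.lft]
      exact fun e => hinj (hmono.injective e).symm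
    have hjr : (Γ.piece j).right ≠ 1 := fun e => by
      rcases hC.eq_ends_or hj0 hj1 hj2 (Γ.piece j).closed with h | h
      · exact hjl h.1
      · exact h.2.ne e
    rw [hil] at hsi
    exact hC.base_simple s ⟨(lt_of_le_of_ne hj0 hjl.symm).trans_le hs.1.1,
      hs.1.2.trans_lt (lt_of_le_of_ne hj2 hjr)⟩ hsi
  · obtain ⟨p, hp⟩ := S.exists_gap_of_lft_ne_zero hl
    by_cases hpj : p = j
    · subst hpj
      obtain ⟨h1, -, h2⟩ := (Γ.piece p).gaps_mem _ ((hS.gap _ _ _).1 hp)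
      simp only [hS.lft, hS.rgt] at h1 h2
      linarith
    -- Piece `i` fills a gap of `p`, so the edges next to the two passages through the root are
    -- owned by `i` and `p`. A third piece through the root would own one of them.
    · exfalso
      obtain ⟨k, hk⟩ := Nat.exists_eq_succ_of_ne_zero hl
      obtain ⟨m, hm⟩ := Nat.exists_eq_succ_of_ne_zero (S.lft_lt i).ne_bot
      have hil : (Γ.piece i).left ≠ 0 := by
        rw [← hb.zero, ← hS.lft]
        exact fun e => hl (hmono.injective e)
      have key : ∀ v, b v = s → S.own v = j ∨ ∃ k, v = k + 1 ∧ S.own k = j := by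
        rintro v rfl
        refine S.own_eq_or ?_ ?_ fun c d hcd => ?_
        · rw [← hmono.le_iff_le, hS.lft]; exact hs.1.1
        · rw [← hmono.le_iff_le, hS.rgt]; exact hs.1.2
        · have := hs.2 _ ((hS.gap _ _ _).1 hcd)
          rwa [hmono.le_iff_le, hmono.le_iff_le] at this
      have hends : s = b (S.lft i) ∨ s = b (S.rgt i) := by
        rw [hS.lft, hS.rgt]
        rcases lt_trichotomy s (Γ.piece i).left with h | h | h
        · exact absurd (Γ.piece i).closed fun e =>
            hC.not_chain (hj0.trans hs.1.1) h hi1 hi2 hsi e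
        · exact Or.inl h
        · exact Or.inr (hC.eq_right hi0 h (hs.1.2.trans hj2) hi1 hi2 hsi.symm
            (Γ.piece i).closed)
      rcases hends with h | h
      · rcases key _ h.symm with h' | ⟨k', hk', h'⟩
        · exact hij (by rw [← h', S.own_lft])
        · rw [hk'] at hp
          exact hpj (by rw [← h', S.own_of_gap_left hp])
      · rcases key _ h.symm with h' | ⟨k', hk', h'⟩
        · exact hpj (by rw [← h', S.own_of_gap_right hp])
        · exact hij (by rw [← h', S.own_of_rgt hk'])

/-- Sequence of the pieces, in the order `e`, with their disks. -/
def Decomposition.sequence {C : ℝ → ℂ} {l : ℕ} (Γ : Decomposition C l) (e : Equiv.Perm (Fin l))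
    (F : Fin l → ℂ → ℂ) (hl : 0 < l) (j : ℕ) : ClosedSubcurve C × (ℂ → ℂ) :=
  if h : j < l then (Γ.piece (e ⟨j, h⟩), F ⟨j, h⟩) else (Γ.piece ⟨0, hl⟩, F ⟨0, hl⟩)

theorem Decomposition.sequence_val {C : ℝ → ℂ} {l : ℕ} (Γ : Decomposition C l)
    (e : Equiv.Perm (Fin l)) (F : Fin l → ℂ → ℂ) (hl : 0 < l) (i : Fin l) :
    Γ.sequence e F hl i = (Γ.piece (e i), F i) := by
  rw [Decomposition.sequence, dif_pos i.2]

theorem Decomposition.isOrdered_sequence {C : ℝ → ℂ} {l : ℕ} (Γ : Decomposition C l)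
    (e : Equiv.Perm (Fin l)) (F : Fin l → ℂ → ℂ) (hl : 0 < l)
    (hroot : ∀ i j, i < j → (Γ.piece (e i)).root ∉ (Γ.piece (e j)).trace)
    (hF : ∀ i, IsImmersedDisk (F i) (Γ.piece (e i)).curve) :
    IsOrdered Γ (Γ.sequence e F hl) e where
  piece i := by rw [Γ.sequence_val]
  root := hroot
  disk i := by rw [Γ.sequence_val]; exact hF i

theorem Decomposition.Induces.exists_isOrdered {C : ℝ → ℂ} {l : ℕ} {Γ : Decomposition C l}
    {H : ℝ × ℝ → ℂ} (h : Γ.Induces H) : ∃ P e, IsOrdered Γ P e ∧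
      H = contractList (reverseList P l) C := by
  obtain ⟨e, F, hroot, hF, rfl⟩ := h
  refine ⟨Γ.sequence e F Γ.pos, e, Γ.isOrdered_sequence e F Γ.pos hroot hF, ?_⟩
  congr 1
  rw [reverseList, List.ofFn_eq_map, ← List.map_coe_finRange_eq_range, List.map_map]
  congr 2
  ext1 i
  exact (Γ.sequence_val e F Γ.pos i).symm

/-- Sorting by decreasing span works, because a piece through the root of another has the larger
span (`Decomposition.span_lt`). -/
theorem Decomposition.exists_isOrdered {C : ℝ → ℂ} (hC : IsNormalCurve C) {l : ℕ}
    (Γ : Decomposition C l) {F : Fin l → ℂ → ℂ}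
    (hF : ∀ i, IsImmersedDisk (F i) (Γ.piece i).curve) :
    ∃ P e, IsOrdered Γ P e ∧ ∀ i : Fin l, (P i).2 = F (e i) := by
  set d : Fin l → ℝ := fun i => -((Γ.piece i).right - (Γ.piece i).left) with hd
  have hs : Monotone (d ∘ Tuple.sort d) := Tuple.monotone_sort d
  refine ⟨Γ.sequence (Tuple.sort d) (fun i => F (Tuple.sort d i)) Γ.pos, Tuple.sort d,
    Γ.isOrdered_sequence _ _ Γ.pos (fun i j hij hr => ?_) fun i => hF _, fun i => ?_⟩
  · have h1 := hs hij.le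
    have h2 := Γ.span_lt hC ((Tuple.sort d).injective.ne hij.ne) hr
    simp only [hd, Function.comp] at h1 h2
    linarith
  · rw [Γ.sequence_val]

/-! ### Signs -/

/-- The immersed disk `F` with boundary `C` preserves (`ε = 1`) or reverses (`ε = -1`) the
orientation. -/
structure HasSign (F : ℂ → ℂ) (C : ℝ → ℂ) (ε : ℤ) : Prop where
  eq_or : ε = 1 ∨ ε = -1
  chords : ∀ᶠ r in 𝓝[>] (0 : ℝ), NonvanishingOn (chord C r) 0 1 ∧
    logVar (chord C r) 0 1 = 2 * Real.pi * Complex.I * ε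
  winding : ∀ x ∉ range C,
    logVar (fun t => C t - x) 0 1 = 2 * Real.pi * Complex.I * (ε * fibreCount F x)

theorem IsImmersedDisk.exists_hasSign {F : ℂ → ℂ} {C : ℝ → ℂ} (h : IsImmersedDisk F C) :
    ∃ ε, HasSign F C ε := by
  obtain ⟨ε, h1, h2, h3⟩ := h.exists_sign
  exact ⟨ε, h1, h2, h3⟩

section Signs

variable {C : ℝ → ℂ} {k l : ℕ}

/-- Additivity of chord windings computes the turning of `C` as the sum of the signs; evaluated at
one small scale, it makes this sum the same for any two decompositions. -/
theorem Decomposition.eventually_sum_sign (hC : IsNormalCurve C) (Γ : Decomposition C l)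
    {F : Fin l → ℂ → ℂ} {ε : Fin l → ℤ} (hε : ∀ i, HasSign (F i) (Γ.piece i).curve (ε i)) :
    ∀ᶠ h in 𝓝[>] (0 : ℝ), logVar (chord C h) 0 1 =
      2 * Real.pi * Complex.I * ((∑ i, ε i : ℤ) : ℂ) := by
  have h1 : ∀ i, Tendsto (fun h : ℝ => h / (Γ.piece i).length) (𝓝[>] 0) (𝓝[>] 0) := fun i => by
    have hpos := (Γ.piece i).length_pos
    refine tendsto_nhdsWithin_iff.2 ⟨?_, ?_⟩
    · have : Tendsto (fun h : ℝ => h / (Γ.piece i).length) (𝓝 0) (𝓝 (0 / (Γ.piece i).length)) :=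
        tendsto_id.div_const _
      rw [zero_div] at this
      exact this.mono_left nhdsWithin_le_nhds
    · filter_upwards [self_mem_nhdsWithin] with h hh using div_pos hh hpos
  have h2 : ∀ᶠ h in 𝓝[>] (0 : ℝ), ∀ i, logVar (chord (Γ.piece i).curve
      (h / (Γ.piece i).length)) 0 1 = 2 * Real.pi * Complex.I * ε i :=
    eventually_all.2 fun i => (h1 i).eventually ((hε i).chords.mono fun _ h => h.2)
  filter_upwards [h2, Γ.sum_logVar_chord hC fun i => (hε i).chords.mono fun _ h => h.1] with h h3 h4
  rw [← h4, Finset.sum_congr rfl fun i _ => h3 i, ← Finset.mul_sum]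
  push_cast
  rfl

theorem Decomposition.sum_sign_eq (hC : IsNormalCurve C) (Γ : Decomposition C l)
    (Γ' : Decomposition C k) {F : Fin l → ℂ → ℂ} {ε : Fin l → ℤ}
    (hε : ∀ i, HasSign (F i) (Γ.piece i).curve (ε i)) {F' : Fin k → ℂ → ℂ} {ε' : Fin k → ℤ}
    (hε' : ∀ i, HasSign (F' i) (Γ'.piece i).curve (ε' i)) : ∑ i, ε i = ∑ i, ε' i := by
  obtain ⟨h, h1, h2⟩ :=
    ((Γ.eventually_sum_sign hC hε).and (Γ'.eventually_sum_sign hC hε')).exists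
  rw [h1] at h2
  exact_mod_cast mul_left_cancel₀ Complex.two_pi_I_ne_zero h2

theorem Decomposition.sum_sign_mul (hC : IsNormalCurve C) (Γ : Decomposition C l)
    {F : Fin l → ℂ → ℂ} {ε : Fin l → ℤ}
    (hε : ∀ i, HasSign (F i) (Γ.piece i).curve (ε i)) {x : ℂ} (hx : x ∉ range C) :
    logVar (fun t => C t - x) 0 1 =
      2 * Real.pi * Complex.I * ((∑ i, ε i * fibreCount (F i) x : ℤ) : ℂ) := by
  have h1 : ∀ i, x ∉ range (Γ.piece i).curve := by
    rintro i ⟨t, ht⟩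
    obtain ⟨s, -, hs⟩ := (Γ.piece i).exists_curve_eq t
    exact hx ⟨s, by rw [← hs, ht]⟩
  rw [← Γ.sum_logVar_sub hC hx, Finset.sum_congr rfl fun i _ => (hε i).winding x (h1 i),
    ← Finset.mul_sum]
  push_cast
  rfl

/-- If the pieces of `Γ'` have a common sign and `Γ` has more pieces than `Γ'`, then the disks of
`Γ` cover more than those of `Γ'`. -/
theorem Decomposition.exists_sum_fibreCount_le (hC : IsNormalCurve C) (Γ : Decomposition C l)
    (Γ' : Decomposition C k) (hkl : k < l) {F : Fin l → ℂ → ℂ} {F' : Fin k → ℂ → ℂ}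
    (hF : ∀ i, IsImmersedDisk (F i) (Γ.piece i).curve) {ε' : ℤ}
    (hε' : ∀ i, HasSign (F' i) (Γ'.piece i).curve ε') :
    ∃ i, ∀ x ∉ range C,
      ∑ j, fibreCount (F' j) x + fibreCount (F i) x ≤ ∑ j, fibreCount (F j) x := by
  choose ε hε using fun i => (hF i).exists_hasSign
  have hsq : ε' * ε' = 1 := by
    rcases (hε' ⟨0, Γ'.pos⟩).eq_or with h | h <;> simp [h]
  have hone : ∀ i, ε' * ε i = 1 ∨ ε' * ε i = -1 := fun i => by
    rcases (hε' ⟨0, Γ'.pos⟩).eq_or with h | h <;> rcases (hε i).eq_or with h' | h' <;>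
      simp [h, h']
  have hsum := Γ.sum_sign_eq hC Γ' hε hε'
  -- If every sign were `ε'`, multiplying the equality of the two sums by `ε'` would give `l = k`.
  obtain ⟨i₀, hi₀⟩ : ∃ i, ε' * ε i = -1 := by
    by_contra! hcon
    have h1 : ∑ i, ε' * ε i = l := by
      rw [Finset.sum_congr rfl fun i _ => (hone i).resolve_right (hcon i)]
      simp
    rw [← Finset.mul_sum, hsum] at h1
    simp only [Finset.sum_const, Finset.card_univ, Fintype.card_fin, nsmul_eq_mul] at h1
    have h2 : (k : ℤ) = l := by linear_combination h1 - (k : ℤ) * hsq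
    omega
  refine ⟨i₀, fun x hx => ?_⟩
  have h1 := Γ.sum_sign_mul hC hε hx
  rw [Γ'.sum_sign_mul hC hε' hx] at h1
  have h2 : ∑ i, ε' * (fibreCount (F' i) x : ℤ) = ∑ i, ε i * (fibreCount (F i) x : ℤ) := by
    exact_mod_cast mul_left_cancel₀ Complex.two_pi_I_ne_zero h1
  have h3 : ∑ i, (fibreCount (F' i) x : ℤ) = ∑ i, ε' * ε i * (fibreCount (F i) x : ℤ) := by
    have := congrArg (ε' * ·) h2
    simp only [Finset.mul_sum, ← mul_assoc, hsq, one_mul] at this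
    exact this
  -- The right side is the excess of `Γ` over `Γ'`; its terms are nonnegative, and the one at `i₀`
  -- counts the fibre twice.
  have h4 : (fibreCount (F i₀) x : ℤ) ≤ ∑ i, (1 - ε' * ε i) * (fibreCount (F i) x : ℤ) := by
    have h5 : ∀ i ∈ Finset.univ, 0 ≤ (1 - ε' * ε i) * (fibreCount (F i) x : ℤ) := fun i _ =>
      mul_nonneg (by rcases hone i with h | h <;> rw [h] <;> norm_num) (Int.natCast_nonneg _)
    have h6 := Finset.single_le_sum h5 (Finset.mem_univ i₀)
    rw [hi₀] at h6
    have := Int.natCast_nonneg (fibreCount (F i₀) x)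
    linarith
  have h7 : ∑ i, (1 - ε' * ε i) * (fibreCount (F i) x : ℤ) =
      ∑ i, (fibreCount (F i) x : ℤ) - ∑ i, ε' * ε i * (fibreCount (F i) x : ℤ) := by
    rw [← Finset.sum_sub_distrib]
    exact Finset.sum_congr rfl fun i _ => by ring
  zify
  linarith

end Signs

/-! ### Comparison of areas -/

/-- Off finitely many parameters, `z ↦ C z.re` is differentiable on the real axis, a null set in the
plane; differentiable images of null sets are null. -/
theorem IsNormalCurve.volume_range {C : ℝ → ℂ} (hC : IsNormalCurve C) :
    volume (range C) = 0 := by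
  obtain ⟨T, hT, hTC⟩ := hC.piecewiseRegular.exists_contDiffAt
  have hline : volume {z : ℂ | z.im = 0} = 0 := by
    have h1 := Measure.addHaar_submodule (volume : Measure ℂ) (LinearMap.ker Complex.imLm) ?_
    · exact h1
    · intro h
      have : Complex.I ∈ LinearMap.ker Complex.imLm := by rw [h]; trivial
      simp at this
  have h1 : volume ((fun z : ℂ => C z.re) '' {z : ℂ | z.im = 0 ∧ z.re ∈ Ioo 0 1 \ T}) = 0 := by
    refine addHaar_image_eq_zero_of_differentiableOn_of_addHaar_eq_zero volume (fun z hz => ?_)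
      (measure_mono_null (fun z hz => hz.1) hline)
    have h2 : DifferentiableAt ℝ C z.re := (hTC _ hz.2).differentiableAt one_ne_zero
    have h3 : DifferentiableAt ℝ (fun z : ℂ => z.re) z := Complex.reCLM.differentiableAt
    exact (h2.comp z h3).differentiableWithinAt
  have h2 : volume (C '' (T ∪ {0})) = 0 :=
    ((hT.union (finite_singleton 0)).image C).measure_zero _
  refine measure_mono_null ?_ (measure_union_null h1 h2)
  rintro _ ⟨t, rfl⟩
  have h3 : C (Int.fract t) = C t := by
    rw [Int.fract]; simpa using hC.periodic.sub_zsmul_eq (x := t) ⌊t⌋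
  by_cases h4 : Int.fract t ∈ T ∪ {0}
  · exact Or.inr ⟨_, h4, h3⟩
  · rw [mem_union, not_or] at h4
    exact Or.inl ⟨((Int.fract t : ℝ) : ℂ), ⟨Complex.ofReal_im _, by
      simpa using ⟨⟨lt_of_le_of_ne (Int.fract_nonneg t) (Ne.symm h4.2), Int.fract_lt_one t⟩,
        h4.1⟩⟩, by simpa using h3⟩

/-- Fibres are uniformly bounded and the image is compact. The measurable majorant yields finite
area without measurability of the fibre count. -/
theorem IsImmersedDisk.exists_fibreCount_le {F : ℂ → ℂ} {C : ℝ → ℂ} (h : IsImmersedDisk F C) :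
    ∃ g : ℂ → ℝ≥0∞, Measurable g ∧ ∫⁻ x, g x < ∞ ∧ ∀ x, (fibreCount F x : ℝ≥0∞) ≤ g x := by
  obtain ⟨m, hm⟩ := exists_encard_fibre_le h.locallyInjective
  have hK : IsCompact (F '' disk) := isCompact_disk.image_of_continuousOn h.continuousOn
  refine ⟨(F '' disk).indicator fun _ => (m : ℝ≥0∞),
    measurable_const.indicator hK.measurableSet, ?_, fun x => ?_⟩
  · rw [lintegral_indicator_const hK.measurableSet]
    exact ENNReal.mul_lt_top (ENNReal.natCast_lt_top m) hK.measure_lt_top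
  · by_cases hx : x ∈ F '' disk
    · rw [indicator_of_mem hx, Nat.cast_le]
      exact ENat.toNat_le_of_le_natCast (hm x)
    · rw [indicator_of_notMem hx]
      have : {z | z ∈ disk ∧ F z = x} = ∅ :=
        eq_empty_of_forall_notMem fun z hz => hx ⟨z, hz.1, hz.2⟩
      have h0 : fibreCount F x = 0 := by rw [fibreCount, this, ncard_empty]
      simp [h0]

section Area

variable {C : ℝ → ℂ} {k l : ℕ}

theorem IsOrdered.sweepCount_ae_eq (hC : IsNormalCurve C) {Γ : Decomposition C l}
    {P : ℕ → ClosedSubcurve C × (ℂ → ℂ)} {e : Equiv.Perm (Fin l)} (h : IsOrdered Γ P e) :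
    ∀ᵐ x, (sweepCount (contractList (reverseList P l) C) x : ℝ≥0∞) =
      ((∑ i : Fin l, fibreCount (P i).2 x : ℕ) : ℝ≥0∞) := by
  filter_upwards [measure_eq_zero_iff_ae_notMem.1 hC.volume_range] with x hx
  rw [h.sweepCount_eq hC hx, ENat.toENNReal_coe]

/-- The homotopy induced by a decomposition is not minimum if there is a decomposition into
fewer pieces that have a common sign. -/
theorem Decomposition.Induces.not_isMinimumHomotopy (hC : IsNormalCurve C)
    {Γ : Decomposition C l} {H : ℝ × ℝ → ℂ} (hH : Γ.Induces H) (Γ' : Decomposition C k)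
    (hkl : k < l) {F' : Fin k → ℂ → ℂ} (hF' : ∀ i, IsImmersedDisk (F' i) (Γ'.piece i).curve)
    {ε' : ℤ} (hε' : ∀ i, HasSign (F' i) (Γ'.piece i).curve ε') :
    IsNullHomotopy C H ∧ ¬ IsMinimumHomotopy C H := by
  obtain ⟨P, e, hP, rfl⟩ := hH.exists_isOrdered
  refine ⟨hP.isNullHomotopy hC, fun hmin => ?_⟩
  obtain ⟨P', e', hP', hPF⟩ := Γ'.exists_isOrdered hC hF'
  have hsum' : ∀ x, ∑ i : Fin k, fibreCount (P' i).2 x = ∑ i, fibreCount (F' i) x := fun x => by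
    rw [← Equiv.sum_comp e' fun i => fibreCount (F' i) x]
    exact Finset.sum_congr rfl fun i _ => by rw [hPF]
  set F : Fin l → ℂ → ℂ := fun i => (P (e.symm i)).2 with hFdef
  have hF : ∀ i, IsImmersedDisk (F i) (Γ.piece i).curve := fun i => by
    have h1 := hP.disk (e.symm i)
    rwa [hP.piece, Equiv.apply_symm_apply] at h1
  have hsum : ∀ x, ∑ i : Fin l, fibreCount (P i).2 x = ∑ i, fibreCount (F i) x := fun x => by
    rw [← Equiv.sum_comp e fun i => fibreCount (F i) x]
    exact Finset.sum_congr rfl fun i _ => by simp [hFdef]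
  obtain ⟨i, hi⟩ := Γ.exists_sum_fibreCount_le hC Γ' hkl hF hε'
  obtain ⟨U, hU, hUne, hUi⟩ := (hF i).exists_isOpen
  set H' := contractList (reverseList P' k) C
  -- Finiteness is needed to turn the added positive volume into a strict inequality.
  have hfin : area H' ≠ ∞ := by
    choose g hgm hg hFg using fun i => (hF' i).exists_fibreCount_le
    refine ne_of_lt (lt_of_le_of_lt (lintegral_mono_ae (g := fun x => ∑ i, g i x) ?_) ?_)
    · filter_upwards [hP'.sweepCount_ae_eq hC] with x hx
      rw [hx, hsum', Nat.cast_sum]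
      exact Finset.sum_le_sum fun i _ => hFg i x
    · rw [lintegral_finsetSum _ fun i _ => hgm i]
      exact ENNReal.sum_lt_top.2 fun i _ => hg i
  have hle : area H' + volume U ≤ area (contractList (reverseList P l) C) := by
    rw [← lintegral_indicator_one hU.measurableSet]
    -- Superadditivity of the lower integral requires no measurability of the sweep counts.
    refine (le_lintegral_add _ _).trans (lintegral_mono_ae ?_)
    filter_upwards [hP.sweepCount_ae_eq hC, hP'.sweepCount_ae_eq hC,
      measure_eq_zero_iff_ae_notMem.1 hC.volume_range] with x h1 h2 h3
    rw [h1, h2, hsum, hsum']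
    have h4 : U.indicator 1 x ≤ ((fibreCount (F i) x : ℕ) : ℝ≥0∞) := by
      by_cases hx : x ∈ U
      · rw [indicator_of_mem hx]
        simpa using hUi x hx
      · rw [indicator_of_notMem hx]
        exact zero_le
    refine (add_le_add le_rfl h4).trans ?_
    exact_mod_cast hi x h3
  have hlt : area H' < area (contractList (reverseList P l) C) :=
    (ENNReal.lt_add_right hfin (hU.measure_pos volume hUne).ne').trans_le hle
  have hinf : minArea C ≤ area H' :=
    iInf₂_le H' ⟨hP'.isNullHomotopy hC, hP'.isPiecewiseDifferentiable hC⟩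
  rw [hmin.2] at hlt
  exact absurd hinf (not_le.2 hlt)

end Area

/-! ### The two cases -/

/-- A self-overlapping curve is a decomposition of itself. -/
theorem IsNormalCurve.exists_decomposition_one {C : ℝ → ℂ} (hC : IsNormalCurve C)
    (h : IsSelfOverlapping C) : ∃ Γ : Decomposition C 1, ∀ i, (Γ.piece i).curve = C := by
  let γ : ClosedSubcurve C :=
    { left := 0
      right := 1
      gaps := ∅
      left_nonneg := le_rfl
      left_lt_right := zero_lt_one
      right_le_one := le_rfl
      closed := hC.apply_one.symm
      gaps_mem := by simp
      gaps_closed := by simp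
      gaps_disjoint := by simp }
  have hfract : ∀ t, C (Int.fract t) = C t := fun t => by
    rw [Int.fract]; simpa using hC.periodic.sub_zsmul_eq (x := t) ⌊t⌋
  have hcurve : γ.curve = C := by
    funext x
    rw [ClosedSubcurve.curve, ← hfract x]
    congr 1
    have hp : ∀ t, γ.progress t = t := fun t => by
      simp [ClosedSubcurve.progress, ClosedSubcurve.length, γ]
    refine IsLeast.csInf_eq ⟨⟨⟨Int.fract_nonneg x, (Int.fract_lt_one x).le⟩, (hp _).ge⟩, ?_⟩
    rintro t ⟨-, ht⟩
    rwa [hp] at ht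
  refine ⟨⟨fun _ => γ, fun _ => by rwa [hcurve], fun i j hij => absurd (Subsingleton.elim i j) hij,
    ?_⟩, fun _ => hcurve⟩
  refine (iUnion_const _).trans (subset_antisymm (image_subset_range _ _) ?_)
  rintro _ ⟨t, rfl⟩
  exact ⟨Int.fract t, γ.mem_support_iff.2 ⟨⟨Int.fract_nonneg t, (Int.fract_lt_one t).le⟩,
    by simp [γ]⟩, hfract t⟩

/-- This is why chords are used throughout: the Whitney index is the winding number of the chord
function at small scales. -/
theorem deriv_smoothing {f : ℝ → ℂ} (hf : Continuous f) (h t : ℝ) :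
    deriv (smoothing f h) t = (h : ℂ)⁻¹ * chord f h t := by
  have h1 : smoothing f h = fun t => (h : ℂ)⁻¹ * ((∫ u in (0 : ℝ)..(t + h), f u) -
      ∫ u in (0 : ℝ)..t, f u) := by
    funext t
    rw [smoothing, intervalIntegral.integral_interval_sub_left (hf.intervalIntegrable _ _)
      (hf.intervalIntegrable _ _)]
  have h2 : ∀ t, HasDerivAt (fun t => ∫ u in (0 : ℝ)..t, f u) (f t) t := fun t =>
    intervalIntegral.integral_hasDerivAt_right (hf.intervalIntegrable _ _)
      (hf.stronglyMeasurableAtFilter _ _) hf.continuousAt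
  rw [h1]
  exact ((((h2 (t + h)).comp_add_const t h).sub (h2 t)).const_mul _).deriv

/-- The sign of a disk with positive boundary. -/
theorem HasSign.eq_of_hasWhitneyIndex {F : ℂ → ℂ} {f : ℝ → ℂ} (hf : Continuous f)
    (hper : f.Periodic 1) {ε n : ℤ} (h : HasSign F f ε) (hn : HasWhitneyIndex f n) : ε = n := by
  obtain ⟨r, ⟨h1, h2⟩, h3, hr⟩ :=
    (h.chords.and ((show ∀ᶠ h in 𝓝[>] (0 : ℝ), HasWindingNumberZero (deriv (smoothing f h)) n
      from hn).and self_mem_nhdsWithin)).exists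
  have hr0 : (r : ℂ)⁻¹ ≠ 0 := inv_ne_zero (by exact_mod_cast (ne_of_gt hr))
  have h4 : deriv (smoothing f r) = fun t => (r : ℂ)⁻¹ * chord f r t :=
    funext fun t => deriv_smoothing hf r t
  rw [h4] at h3
  have hc : Continuous fun t => (r : ℂ)⁻¹ * chord f r t := by
    unfold chord; fun_prop
  have h5 := logVar_of_hasWindingNumberZero hc.continuousOn
    (by simp only [chord]
        rw [add_comm (1 : ℝ) r, hper, zero_add]
        congr 2
        simpa using hper 0) h3
  have h6 : logVar (fun t => (r : ℂ)⁻¹ * chord f r t) 0 1 = logVar (chord f r) 0 1 := by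
    rw [logVar_mul zero_le_one ⟨continuousOn_const, fun _ _ => hr0⟩ h1,
      logVar_of_const zero_le_one hr0 fun _ _ => rfl, zero_add]
  rw [h6, h2] at h5
  exact_mod_cast mul_left_cancel₀ Complex.two_pi_I_ne_zero h5

end MinHomotopy

end

theorem mainTheorem6 (C : ℝ → ℂ) (hC : MinHomotopy.IsNormalCurve C) :
    (MinHomotopy.IsSelfOverlapping C →
      ∀ (l : ℕ) (Γ : MinHomotopy.Decomposition C l), 1 < l →
        ∀ H : ℝ × ℝ → ℂ, Γ.Induces H →
          MinHomotopy.IsNullHomotopy C H ∧ ¬ MinHomotopy.IsMinimumHomotopy C H) ∧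
    (∀ k : ℕ, MinHomotopy.IsKBoundary C k →
      ∀ (l : ℕ) (Γ : MinHomotopy.Decomposition C l), k < l →
        ∀ H : ℝ × ℝ → ℂ, Γ.Induces H →
          MinHomotopy.IsNullHomotopy C H ∧ ¬ MinHomotopy.IsMinimumHomotopy C H) := by
  refine ⟨fun h l Γ hl H hH => ?_, fun k ⟨Γ', hΓ'⟩ l Γ hl H hH => ?_⟩
  · obtain ⟨F, hF⟩ := h
    obtain ⟨Γ', hΓ'⟩ := hC.exists_decomposition_one ⟨F, hF⟩
    -- The curve may have either orientation; the comparison only asks for a common sign, which is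
    -- automatic for one piece.
    obtain ⟨ε, hε⟩ := hF.exists_hasSign
    exact hH.not_isMinimumHomotopy hC Γ' hl (F' := fun _ => F) (fun i => by rwa [hΓ'])
      (ε' := ε) fun i => by rwa [hΓ']
  · choose F' hF' using fun i => (hΓ' i).1
    choose ε hε using fun i => (hF' i).exists_hasSign
    have hε1 : ∀ i, ε i = 1 := fun i => (hε i).eq_of_hasWhitneyIndex (hF' i).continuous
      (fun t => by simpa using (Γ'.piece i).curve_periodic t 1) (hΓ' i).2
    exact hH.not_isMinimumHomotopy hC Γ' hl hF' (ε' := 1) fun i => hε1 i ▸ hε i
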